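/- **Theorem 1.2.** Let $\varepsilon\in\mathbb R$, $q_-\in\mathbb C\setminus\{0\}$, $q_0=|q_-|$, $N\ge 0$. Let $z_1,\dots,z_N$ be distinct complex numbers with $|z_n|>q_0$, $\operatorname{Im}z_n<0$, and let $b_1,\dots,b_N\in\mathbb C\setminus\{0\}$, $d_1,\dots,d_N\in\mathbb C$. Write ${}^*$ for complex conjugation. *Spectral notation.* $k(z)=\frac12(z-q_0^2/z)$, $\lambda(z)=\frac12(z+q_0^2/z)$, $\gamma(z)=1+q_0^2/z^2$, $$\theta(x,t;z)=\lambda\,[x+(16\varepsilon k^4-8\varepsilon q_0^2k^2+2k+6\varepsilon q_0^4+1)\,t],$$ $D^\pm=\{z:\pm(|z|^2-q_0^2)\operatorname{Im}z>0\}$, $\Sigma_1=\{z\ne0,\pm iq_0:\ z\in\mathbb R\text{ or }|z|=q_0\}$, $Wr(u,v)=u_1v_2-u_2v_1$. *Data.* For $n=1,\dots,N$ let $\eta_n=z_n$, $\eta_{N+n}=-q_0^2/z_n^*$, and for $n=1,\dots,2N$ let $\hat\eta_n=-q_0^2/\eta_n$ (so $\hat\eta_{N+n}=z_n^*$). Put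 $$s_{11}(z)=\prod_{n=1}^N\frac{(z-z_n)^2(z+q_0^2/z_n^*)^2}{(z-z_n^*)^2(z+q_0^2/z_n)^2},\qquad s_{22}(z)=\frac1{s_{11}(z)},\qquad q_+=q_-\prod_{n=1}^N\Big(\frac{z_n^*}{z_n}\Big)^4,$$ and, for $n=1,\dots,N$, $$b_-(\eta_n)=b_n,\quad b_+(\hat\eta_n)=\frac{q_-}{q_+^*}b_n,\quad b_+(\hat\eta_{N+n})=-b_n^*,\quad b_-(\eta_{N+n})=-b_+(\hat\eta_n)^*,$$ $$d_-(\eta_n)=d_n,\quad d_+(\hat\eta_n)=\frac{q_-}{q_+^*}\frac{z_n^2}{q_0^2}d_n,\quad d_+(\hat\eta_{N+n})=-d_n^*,\quad d_-(\eta_{N+n})=-d_+(\hat\eta_n)^*.$$ For $n=1,\dots,2N$ let $$A_+[\hat\eta_n]=\frac{2b_+(\hat\eta_n)}{s_{22}''(\hat\eta_n)},\qquad B_+[\hat\eta_n]=\frac{d_+(\hat\eta_n)}{b_+(\hat\eta_n)}-\frac{s_{22}'''(\hat\eta_n)}{3s_{22}''(\hat\eta_n)}.$$ *The formula.* With $'$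 the $z$-derivative, let $\Delta_n^+=B_+[\hat\eta_n]-2i\theta'(\hat\eta_n)$ and $\nabla_n^+(z)=\frac{A_+[\hat\eta_n]}{z-\hat\eta_n}e^{-2i\theta(\hat\eta_n)}$. Let $\tilde G=\begin{pmatrix}\tilde G^{11}&\tilde G^{12}\\ \tilde G^{21}&\tilde G^{22}\end{pmatrix}$ be the $4N\times4N$ matrix with $2N\times 2N$ blocks $$\tilde g^{11}_{kn}=\nabla_n^+(\eta_k)\Big(\Delta_n^++\frac1{\eta_k-\hat\eta_n}\Big)+\frac{iq_-}{\eta_k}\delta_{kn},\qquad \tilde g^{12}_{kn}=\nabla_n^+(\eta_k),$$ $$\tilde g^{21}_{kn}=\frac{\nabla_n^+(\eta_k)}{\eta_k-\hat\eta_n}\Big(\Delta_n^++\frac2{\eta_k-\hat\eta_n}\Big)+\frac{iq_-}{\eta_k^2}\delta_{kn},\qquad \tilde g^{22}_{kn}=\frac{\nabla_n^+(\eta_k)}{\eta_k-\hat\eta_n}-\frac{iq_-q_0^2}{\eta_k^3}\delta_{kn},$$ and let $\nu=(\nu^{(1)},\nu^{(2)})$, $\omega=(\omega^{(1)},\omega^{(2)})$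 be the vectors in $\mathbb C^{4N}$ with $$\nu^{(1)}_n=\frac{iq_-}{\eta_n},\quad \nu_n^{(2)}=\frac{iq_-}{\eta_n^2},\quad \omega_n^{(1)}=A_+[\hat\eta_n]e^{-2i\theta(\hat\eta_n)}\Delta_n^+,\quad \omega_n^{(2)}=A_+[\hat\eta_n]e^{-2i\theta(\hat\eta_n)}.$$ Then $\det\tilde G(x,t)\ne0$ for all $x,t\in\mathbb R$, and $$q(x,t)=q_--i\,\frac{\det\begin{pmatrix}\tilde G&\nu\\ \omega^T&0\end{pmatrix}}{\det\tilde G}$$ is a $C^\infty$ function on $\mathbb R^2$ with the following properties. 1. It satisfies $$iq_t+2(|q|^2-q_0^2)q-i\varepsilon q_{xxxxx}-10i\varepsilon|q|^2q_{xxx}-20i\varepsilon q_xq^*q_{xx}-30i\varepsilon|q|^4q_x-10i\varepsilon(|q_x|^2q)_x+q_{xx}-iq_x=0;$$ consequently so does $-q=-q_-+i\det\begin{pmatrix}\tilde G&\nu\\ \omega^T&0\end{pmatrix}/\det\tilde G$, and $u=qe^{2iq_0^2t}$ satisfies the ifoNLS equation, which is the same equation without the term $-2q_0^2q$. 2. $|q_+|=q_0$,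 and for every $t$, $q(x,t)\to q_\pm$ as $x\to\pm\infty$. 3. $q$ is a reflectionless potential with double zeros and with the given data. Precisely, consider $\phi_x=\begin{pmatrix}-ik&q\\-q^*&ik\end{pmatrix}\phi$. There are solutions $\phi_{\pm,1},\phi_{\pm,2}$ such that for every $t$, as $x\to\pm\infty$, $e^{i\theta}\phi_{\pm,1}\to(1,-iq_\pm^*/z)^T$ and $e^{-i\theta}\phi_{\pm,2}\to(-iq_\pm/z,1)^T$; here $\phi_{-,1},\phi_{+,2}$ are defined for $z\in D^+\cup\Sigma_1$ and analytic in $z\in D^+$, and $\phi_{-,2},\phi_{+,1}$ are defined for $z\in D^-\cup\Sigma_1$ and analytic in $z\in D^-$. For all $x,t$, they satisfy: $Wr(\phi_{+,1},\phi_{-,2})=\gamma s_{11}$ on $D^-\cup\Sigma_1$; $Wr(\phi_{-,1},\phi_{+,2})=\gamma s_{22}$ on $D^+\cup\Sigma_1$; and $Wr(\phi_{+,2},\phi_{-,2})=0=Wr(\phi_{-,1},\phi_{+,1})$ on $\Sigma_1$ (that is, $s_{12}=s_{21}=0$). The zeros of $s_{11}$ in $D^-$ are exactly $\eta_1,\dots,\eta_{2N}$,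 those of $s_{22}$ in $D^+$ are exactly $\hat\eta_1,\dots,\hat\eta_{2N}$, and all of them are double. For all $n=1,\dots,2N$ and all $x,t$, $$\phi_{+,1}(\eta_n)=b_-(\eta_n)\phi_{-,2}(\eta_n),\quad \phi_{+,1}'(\eta_n)=d_-(\eta_n)\phi_{-,2}(\eta_n)+b_-(\eta_n)\phi_{-,2}'(\eta_n),$$ $$\phi_{+,2}(\hat\eta_n)=b_+(\hat\eta_n)\phi_{-,1}(\hat\eta_n),\quad \phi_{+,2}'(\hat\eta_n)=d_+(\hat\eta_n)\phi_{-,1}(\hat\eta_n)+b_+(\hat\eta_n)\phi_{-,1}'(\hat\eta_n).$$ -/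

import Mathlib

open Filter Topology Matrix
open scoped ContDiff ComplexConjugate

noncomputable section

namespace IfoNLS

/-! ### The equation -/

/-- The function `q` of `(x, t)` satisfies, at every point,
`i q_t + 2 (|q|² - c) q - i ε q_xxxxx - 10 i ε |q|² q_xxx - 20 i ε q_x q^* q_xx - 30 i ε |q|⁴ q_x
  - 10 i ε (|q_x|² q)_x + q_xx - i q_x = 0`.
With `c = 0` this is the ifoNLS equation itself; with `c = q₀²` it is the equation satisfied by
`q` when `u = q e^{2 i q₀² t}` satisfies the ifoNLS equation. -/
def SolvesIfoNLS (ε c : ℝ) (q : ℝ → ℝ → ℂ) : Prop :=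
  ∀ x t : ℝ,
    Complex.I * deriv (fun s => q x s) t
      + 2 * ((‖q x t‖ ^ 2 - c : ℝ) : ℂ) * q x t
      - Complex.I * ε * iteratedDeriv 5 (fun y => q y t) x
      - 10 * Complex.I * ε * ((‖q x t‖ ^ 2 : ℝ) : ℂ) * iteratedDeriv 3 (fun y => q y t) x
      - 20 * Complex.I * ε * deriv (fun y => q y t) x * conj (q x t)
          * iteratedDeriv 2 (fun y => q y t) x
      - 30 * Complex.I * ε * ((‖q x t‖ ^ 4 : ℝ) : ℂ) * deriv (fun y => q y t) x
      - 10 * Complex.I * ε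
          * deriv (fun y => ((‖deriv (fun s => q s t) y‖ ^ 2 : ℝ) : ℂ) * q y t) x
      + iteratedDeriv 2 (fun y => q y t) x
      - Complex.I * deriv (fun y => q y t) x = 0

/-! ### The uniformization variable and the phase -/

/-- `k(z) = (z - q₀² / z) / 2`. -/
def specK (q₀ : ℝ) (z : ℂ) : ℂ := (z - (q₀ : ℂ) ^ 2 / z) / 2

/-- `λ(z) = (z + q₀² / z) / 2`. -/
def specLam (q₀ : ℝ) (z : ℂ) : ℂ := (z + (q₀ : ℂ) ^ 2 / z) / 2

/-- `θ(x, t; z) = λ [x + (16 ε k⁴ - 8 ε q₀² k² + 2 k + 6 ε q₀⁴ + 1) t]`. -/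
def phase (q₀ ε : ℝ) (x t : ℝ) (z : ℂ) : ℂ :=
  specLam q₀ z * (x + (16 * specK q₀ z ^ 4 * ε - 8 * specK q₀ z ^ 2 * (q₀ : ℂ) ^ 2 * ε
    + 2 * specK q₀ z + 6 * (q₀ : ℂ) ^ 4 * ε + 1) * t)

/-- `D⁺ = {z | (|z|² - q₀²) Im z > 0}`. -/
def Dplus (q₀ : ℝ) : Set ℂ := {z | 0 < (‖z‖ ^ 2 - q₀ ^ 2) * z.im}

/-- `D⁻ = {z | (|z|² - q₀²) Im z < 0}`. -/
def Dminus (q₀ : ℝ) : Set ℂ := {z | (‖z‖ ^ 2 - q₀ ^ 2) * z.im < 0}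

/-- The continuous spectrum `ℝ ∪ {|z| = q₀}` without the branch points `± i q₀`, and without
`z = 0` (which corresponds to `k = ∞`). -/
def contSpec (q₀ : ℝ) : Set ℂ :=
  {z | (z.im = 0 ∨ ‖z‖ = q₀) ∧ z ≠ 0 ∧ z ≠ Complex.I * q₀ ∧ z ≠ -(Complex.I * q₀)}

/-! ### Jost functions and Wronskians -/

/-- The matrix `U = -i k σ₃ + U₀` of the scattering problem `φ_x = U φ`, where `w` is the value
of the potential. -/
def scatU (q₀ : ℝ) (z w : ℂ) : Matrix (Fin 2) (Fin 2) ℂ :=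
  !![-Complex.I * specK q₀ z, w; -conj w, Complex.I * specK q₀ z]

/-- First column of `E = I - (i / z) σ₃ Q`, where `w` is the boundary value. -/
def Ecol1 (w z : ℂ) : Fin 2 → ℂ := ![1, -Complex.I * conj w / z]

/-- Second column of `E = I - (i / z) σ₃ Q`, where `w` is the boundary value. -/
def Ecol2 (w z : ℂ) : Fin 2 → ℂ := ![-Complex.I * w / z, 1]

/-- `φ` is, at the spectral value `z`, the first column of the Jost solution normalized at the end
`l` (`atBot` or `atTop`) of the line: `φ_x = U φ` and `φ ∼ E₁ e^{-iθ}` as `x → l`, where `w` is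
the boundary value of the potential at that end. -/
def IsJost1 (q₀ ε : ℝ) (q : ℝ → ℝ → ℂ) (l : Filter ℝ) (w z : ℂ)
    (φ : ℝ → ℝ → Fin 2 → ℂ) : Prop :=
  (∀ x t, HasDerivAt (fun y => φ y t) (scatU q₀ z (q x t) *ᵥ φ x t) x) ∧
  ∀ t, Tendsto (fun x => Complex.exp (Complex.I * phase q₀ ε x t z) • φ x t) l (𝓝 (Ecol1 w z))

/-- The same for the second column: `φ_x = U φ` and `φ ∼ E₂ e^{iθ}` as `x → l`. -/
def IsJost2 (q₀ ε : ℝ) (q : ℝ → ℝ → ℂ) (l : Filter ℝ) (w z : ℂ)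
    (φ : ℝ → ℝ → Fin 2 → ℂ) : Prop :=
  (∀ x t, HasDerivAt (fun y => φ y t) (scatU q₀ z (q x t) *ᵥ φ x t) x) ∧
  ∀ t, Tendsto (fun x => Complex.exp (-(Complex.I * phase q₀ ε x t z)) • φ x t) l
    (𝓝 (Ecol2 w z))

/-- `φm1, φm2` (normalized at `x → -∞`) and `φp1, φp2` (normalized at `x → +∞`) are the columns
of the Jost solutions of the scattering problem with potential `q` and boundary values `qm, qp`;
the first argument is the spectral variable `z`. Each column is taken on the region
`D^±` on which it is analytic, and on the continuous spectrum. -/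
structure IsJostSystem (q₀ ε : ℝ) (q : ℝ → ℝ → ℂ) (qm qp : ℂ)
    (φm1 φm2 φp1 φp2 : ℂ → ℝ → ℝ → Fin 2 → ℂ) : Prop where
  jost_m1 : ∀ z ∈ Dplus q₀ ∪ contSpec q₀, IsJost1 q₀ ε q atBot qm z (φm1 z)
  jost_m2 : ∀ z ∈ Dminus q₀ ∪ contSpec q₀, IsJost2 q₀ ε q atBot qm z (φm2 z)
  jost_p1 : ∀ z ∈ Dminus q₀ ∪ contSpec q₀, IsJost1 q₀ ε q atTop qp z (φp1 z)
  jost_p2 : ∀ z ∈ Dplus q₀ ∪ contSpec q₀, IsJost2 q₀ ε q atTop qp z (φp2 z)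
  analytic_m1 : ∀ x t, DifferentiableOn ℂ (fun z => φm1 z x t) (Dplus q₀)
  analytic_m2 : ∀ x t, DifferentiableOn ℂ (fun z => φm2 z x t) (Dminus q₀)
  analytic_p1 : ∀ x t, DifferentiableOn ℂ (fun z => φp1 z x t) (Dminus q₀)
  analytic_p2 : ∀ x t, DifferentiableOn ℂ (fun z => φp2 z x t) (Dplus q₀)

/-- `Wr(u, v) / γ(z)` with `Wr(u, v) = u₁ v₂ - u₂ v₁` and `γ(z) = 1 + q₀² / z²`. The scattering
coefficients are `s₁₁ = Wr(φ₊₁, φ₋₂)/γ`, `s₂₂ = Wr(φ₋₁, φ₊₂)/γ`, `s₁₂ = Wr(φ₊₂, φ₋₂)/γ`,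
`s₂₁ = Wr(φ₋₁, φ₊₁)/γ`. -/
def wronskianCoeff (q₀ : ℝ) (z : ℂ) (u v : Fin 2 → ℂ) : ℂ :=
  (u 0 * v 1 - u 1 * v 0) / (1 + (q₀ : ℂ) ^ 2 / z ^ 2)

/-- `f` has a zero of order exactly two at `a`. -/
def HasDoubleZero (f : ℂ → ℂ) (a : ℂ) : Prop :=
  AnalyticAt ℂ f a ∧ f a = 0 ∧ deriv f a = 0 ∧ iteratedDeriv 2 f a ≠ 0

/-! ### Reflectionless scattering data with double zeros -/

/-- The free parameters: the coefficient `ε` of the equation, the boundary value `q₋`, the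
eigenvalues `z₁, …, z_N`, and the constants `b₋(z_n)`, `d₋(z_n)`. -/
structure Data (N : ℕ) where
  ε : ℝ
  qm : ℂ
  z : Fin N → ℂ
  b : Fin N → ℂ
  d : Fin N → ℂ

namespace Data

variable {N : ℕ} (D : Data N)

/-- `q₀ = |q₋|`. -/
def q₀ : ℝ := ‖D.qm‖

/-- The zeros of `s₁₁`: `η_n = z_n` and `η_{N+n} = -q₀² / z_n^*`. -/
def eta : Fin N ⊕ Fin N → ℂ :=
  Sum.elim D.z fun n => -((D.q₀ : ℂ) ^ 2 / conj (D.z n))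

/-- The zeros of `s₂₂`: `η̂_n = -q₀² / η_n`. -/
def etaHat (n : Fin N ⊕ Fin N) : ℂ := -((D.q₀ : ℂ) ^ 2 / D.eta n)

/-- The scattering coefficient `s₁₁` (trace formula without reflection, double zeros). -/
def s11 (z : ℂ) : ℂ :=
  ∏ n, (z - D.z n) ^ 2 * (z + (D.q₀ : ℂ) ^ 2 / conj (D.z n)) ^ 2 /
    ((z - conj (D.z n)) ^ 2 * (z + (D.q₀ : ℂ) ^ 2 / D.z n) ^ 2)

/-- The scattering coefficient `s₂₂` (trace formula without reflection, double zeros). -/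
def s22 (z : ℂ) : ℂ :=
  ∏ n, (z - conj (D.z n)) ^ 2 * (z + (D.q₀ : ℂ) ^ 2 / D.z n) ^ 2 /
    ((z - D.z n) ^ 2 * (z + (D.q₀ : ℂ) ^ 2 / conj (D.z n)) ^ 2)

/-- The boundary value at `x → +∞`, given by the theta condition
`arg q₋ - arg q₊ = 8 ∑ arg z_n`. -/
def qp : ℂ := D.qm * ∏ n, (conj (D.z n) / D.z n) ^ 4

/-- `b₊` at the zeros of `s₂₂`. The symmetries of the Jost functions determine it from `b₋(z_n)`:
`b₊(-q₀² / z_n) = (q₋ / q₊^*) b₋(z_n)` and `b₊(z_n^*) = -b₋(z_n)^*`. -/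
def bPlus : Fin N ⊕ Fin N → ℂ :=
  Sum.elim (fun n => D.qm / conj D.qp * D.b n) fun n => -conj (D.b n)

/-- `d₊` at the zeros of `s₂₂`. The symmetries of the Jost functions determine it from `d₋(z_n)`:
`d₊(-q₀² / z_n) = (q₋ / q₊^*) (z_n² / q₀²) d₋(z_n)` and `d₊(z_n^*) = -d₋(z_n)^*`. -/
def dPlus : Fin N ⊕ Fin N → ℂ :=
  Sum.elim (fun n => D.qm / conj D.qp * (D.z n ^ 2 / (D.q₀ : ℂ) ^ 2) * D.d n)
    fun n => -conj (D.d n)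

/-- `b₋` at the zeros of `s₁₁`: the given `b₋(z_n)`, and
`b₋(-q₀² / z_n^*) = -b₊(-q₀² / z_n)^*`. -/
def bMinus : Fin N ⊕ Fin N → ℂ :=
  Sum.elim D.b fun n => -conj (D.bPlus (Sum.inl n))

/-- `d₋` at the zeros of `s₁₁`: the given `d₋(z_n)`, and
`d₋(-q₀² / z_n^*) = -d₊(-q₀² / z_n)^*`. -/
def dMinus : Fin N ⊕ Fin N → ℂ :=
  Sum.elim D.d fun n => -conj (D.dPlus (Sum.inl n))

/-- `A₊[η̂_n] = 2 b₊(η̂_n) / s₂₂''(η̂_n)`. -/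
def Aplus (n : Fin N ⊕ Fin N) : ℂ := 2 * D.bPlus n / iteratedDeriv 2 D.s22 (D.etaHat n)

/-- `B₊[η̂_n] = d₊(η̂_n) / b₊(η̂_n) - s₂₂'''(η̂_n) / (3 s₂₂''(η̂_n))`. -/
def Bplus (n : Fin N ⊕ Fin N) : ℂ :=
  D.dPlus n / D.bPlus n
    - iteratedDeriv 3 D.s22 (D.etaHat n) / (3 * iteratedDeriv 2 D.s22 (D.etaHat n))

/-! ### The explicit formula -/

/-- `Δ_n⁺ = B₊[η̂_n] - 2 i θ'(η̂_n)`, the derivative being taken in `z`. -/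
def deltaPlus (x t : ℝ) (n : Fin N ⊕ Fin N) : ℂ :=
  D.Bplus n - 2 * Complex.I * deriv (phase D.q₀ D.ε x t) (D.etaHat n)

/-- `∇_n⁺(z) = A₊[η̂_n] e^{-2iθ(η̂_n)} / (z - η̂_n)`. -/
def nablaPlus (x t : ℝ) (n : Fin N ⊕ Fin N) (z : ℂ) : ℂ :=
  D.Aplus n / (z - D.etaHat n) * Complex.exp (-(2 * Complex.I * phase D.q₀ D.ε x t (D.etaHat n)))

/-- The block `G̃¹¹`. -/
def G11 (x t : ℝ) : Matrix (Fin N ⊕ Fin N) (Fin N ⊕ Fin N) ℂ :=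
  Matrix.of fun k n =>
    D.nablaPlus x t n (D.eta k) * (D.deltaPlus x t n + 1 / (D.eta k - D.etaHat n))
      + if k = n then Complex.I * D.qm / D.eta k else 0

/-- The block `G̃¹²`. -/
def G12 (x t : ℝ) : Matrix (Fin N ⊕ Fin N) (Fin N ⊕ Fin N) ℂ :=
  Matrix.of fun k n => D.nablaPlus x t n (D.eta k)

/-- The block `G̃²¹`. -/
def G21 (x t : ℝ) : Matrix (Fin N ⊕ Fin N) (Fin N ⊕ Fin N) ℂ :=
  Matrix.of fun k n =>
    D.nablaPlus x t n (D.eta k) / (D.eta k - D.etaHat n)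
        * (D.deltaPlus x t n + 2 / (D.eta k - D.etaHat n))
      + if k = n then Complex.I * D.qm / D.eta k ^ 2 else 0

/-- The block `G̃²²`. -/
def G22 (x t : ℝ) : Matrix (Fin N ⊕ Fin N) (Fin N ⊕ Fin N) ℂ :=
  Matrix.of fun k n =>
    D.nablaPlus x t n (D.eta k) / (D.eta k - D.etaHat n)
      - if k = n then Complex.I * D.qm * (D.q₀ : ℂ) ^ 2 / D.eta k ^ 3 else 0

/-- The `4N × 4N` matrix `G̃`. -/
def G (x t : ℝ) :
    Matrix ((Fin N ⊕ Fin N) ⊕ (Fin N ⊕ Fin N)) ((Fin N ⊕ Fin N) ⊕ (Fin N ⊕ Fin N)) ℂ :=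
  Matrix.fromBlocks (D.G11 x t) (D.G12 x t) (D.G21 x t) (D.G22 x t)

/-- The vector `ν`. -/
def nuVec : (Fin N ⊕ Fin N) ⊕ (Fin N ⊕ Fin N) → ℂ :=
  Sum.elim (fun n => Complex.I * D.qm / D.eta n) fun n => Complex.I * D.qm / D.eta n ^ 2

/-- The vector `ω`. -/
def omegaVec (x t : ℝ) : (Fin N ⊕ Fin N) ⊕ (Fin N ⊕ Fin N) → ℂ :=
  Sum.elim
    (fun n => D.Aplus n * Complex.exp (-(2 * Complex.I * phase D.q₀ D.ε x t (D.etaHat n)))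
      * D.deltaPlus x t n)
    fun n => D.Aplus n * Complex.exp (-(2 * Complex.I * phase D.q₀ D.ε x t (D.etaHat n)))

/-- The bordered matrix with rows `(G̃, ν)` and `(ωᵀ, 0)`. -/
def borderedG (x t : ℝ) :
    Matrix (((Fin N ⊕ Fin N) ⊕ (Fin N ⊕ Fin N)) ⊕ Unit)
      (((Fin N ⊕ Fin N) ⊕ (Fin N ⊕ Fin N)) ⊕ Unit) ℂ :=
  Matrix.fromBlocks (D.G x t) (Matrix.replicateCol Unit D.nuVec)
    (Matrix.replicateRow Unit (D.omegaVec x t)) 0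

/-- The potential `q = q₋ - i det (G̃, ν; ωᵀ, 0) / det G̃`. -/
def q (x t : ℝ) : ℂ := D.qm - Complex.I * (D.borderedG x t).det / (D.G x t).det

end Data

end IfoNLS

end

/-!
The potential `q` comes with an explicit matrix solution of its Lax pair, all of whose entries are
polynomials up to exponential factors and known denominators. The first row of that solution is
`(P e^{-iθ} / W₁, Q e^{iθ} / W₂)` with `W₁ = z ∏ (z - η_n)²`, `W₂ = z ∏ (z - η̂_n)²`, where `P` is
monic of degree `4N + 1` and `Q` has degree at most `4N`; the second row is `(-Q*, P*)` in place of
`(P, Q)`, where `*` conjugates the coefficients. Such a row is subject to two conditions: the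
constants `b`, `d` prescribe the first-order jet of `P` in terms of that of `Q` at each `η_n`, and of
`Q` in terms of that of `P` at each `η̂_n` (`Data.IsRow`), and `z ↦ -q₀² / z` interchanges `P` and
`Q` up to a factor (`Data.IsSym`). Expanded in partial fractions at the points `η̂_n`, the
conditions become the linear system with matrix `G` and right side `ν` (`isRow_of_mulVec`), and the
coefficient of `1 / z` in the second entry is `-i q` (`coeff_numQ`).

Everything rests on one uniqueness statement, `isRow_unique`: a symmetric row that decays at
infinity vanishes. The jet relations make `P P* + Q Q*` divisible by `∏ (z - η_n)² (z - η̂_n)²`, the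
symmetry transports the decay from infinity to zeros at the origin, and the degree leaves no room,
so that `P P* + Q Q* = 0`; on the real axis this sum is `|P|² + |Q|²`. Applied to a null vector of
`G` it gives `det G ≠ 0`, hence smoothness. The same divisibility gives
`P P* + Q Q* = (z² + q₀²) ∏ (z - η_n)² (z - η̂_n)²` (`det_identity`), which is the identity for the
Wronskians.

The derivatives of the row in `x` and in `t` are again rows, for the same jet relations and with the
same symmetry, and so are the two rows themselves multiplied by functions of `k`. Uniqueness
therefore yields a linear differential equation as soon as the coefficients are chosen so that the
growing terms cancel at infinity. In `x` this is the scattering problem (`lax_x`). In `t` the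
coefficients are polynomial parts, in `k`, of `p α` and `p β`, where `p` is the dispersion polynomial
and `α`, `β` are entries of `λ ψ σ₃ ψ⁻¹`; the latter satisfy `β_x = -2ikβ - 2qα` and
`α² + |β|² = k² + q₀²`, which determine their expansion at `k = ∞` recursively
(`IsExpansion.decay`), as differential polynomials in `q`. The point `z = q₀`, where `k = 0`,
suffices: there `lax_t_k_zero` and the equality of mixed derivatives give the equation (`solves`),
the explicit form being the identity `IsExpansion.flow`.

As `x → -∞`, the exponentials in the relations at the points `η̂_n` tend to zero, so that `Q`
acquires double zeros there in the limit; with its value at the origin this determines the limit of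
`Q` (`tendsto_of_jets`). As `x → +∞` the same happens at the points `η_n`. This gives the limits of
`q` and the normalisations of the Jost functions, which are the columns of the matrix solution over
the denominators `W₁` and `W₂`.
-/

open Polynomial

namespace IfoNLS

/-! ### Polynomials: jets, double roots, conjugation and inversion -/

/-- `R` agrees with `(u + v (X - a)) S` to first order at `a`. -/
def JetRel (a u v : ℂ) (R S : ℂ[X]) : Prop :=
  (X - C a) ^ 2 ∣ R - (C u + C v * (X - C a)) * S

theorem sq_dvd_iff_eval (a : ℂ) (F : ℂ[X]) :
    (X - C a) ^ 2 ∣ F ↔ F.eval a = 0 ∧ (derivative F).eval a = 0 := by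
  constructor
  · rintro ⟨G, rfl⟩
    constructor <;> simp [derivative_pow]
  · rintro ⟨h0, h1⟩
    obtain ⟨G, rfl⟩ := dvd_iff_isRoot.2 h0
    have : (X - C a) ∣ G := by
      refine dvd_iff_isRoot.2 ?_
      simpa using h1
    rw [pow_two]
    exact mul_dvd_mul_left _ this

theorem jetRel_iff (a u v : ℂ) (R S : ℂ[X]) :
    JetRel a u v R S ↔ R.eval a = u * S.eval a ∧
      (derivative R).eval a = v * S.eval a + u * (derivative S).eval a := by
  rw [JetRel, sq_dvd_iff_eval]
  simp [sub_eq_zero]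

namespace JetRel

variable {a u v : ℂ} {R S R' S' : ℂ[X]}

theorem add (h : JetRel a u v R S) (h' : JetRel a u v R' S') :
    JetRel a u v (R + R') (S + S') := by
  unfold JetRel at *
  convert dvd_add h h' using 1
  ring

theorem mul_left (F : ℂ[X]) (h : JetRel a u v R S) : JetRel a u v (F * R) (F * S) := by
  unfold JetRel at *
  convert Dvd.dvd.mul_left h F using 1
  ring

end JetRel

/-- The polynomial whose value at `z` is `conj (R (conj z))`. -/
noncomputable def conjP (R : ℂ[X]) : ℂ[X] := R.map (starRingEnd ℂ)

theorem eval_conjP (R : ℂ[X]) (z : ℂ) : (conjP R).eval z = conj (R.eval (conj z)) := by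
  have := Polynomial.eval_map_apply (p := R) (starRingEnd ℂ) (conj z)
  simpa [conjP] using this

@[simp] theorem conjP_conjP (R : ℂ[X]) : conjP (conjP R) = R := by
  ext n; simp [conjP]

theorem conjP_mul (R S : ℂ[X]) : conjP (R * S) = conjP R * conjP S := by simp [conjP]

theorem coeff_conjP (R : ℂ[X]) (n : ℕ) : (conjP R).coeff n = conj (R.coeff n) := by
  simp [conjP]

theorem natDegree_conjP (R : ℂ[X]) : (conjP R).natDegree = R.natDegree :=
  natDegree_map _

theorem JetRel.conj {a u v : ℂ} {R S : ℂ[X]} (h : JetRel a u v R S) :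
    JetRel (conj a) (conj u) (conj v) (conjP R) (conjP S) := by
  have := Polynomial.map_dvd (starRingEnd ℂ) h
  simpa [JetRel, conjP] using this

/-- `|R|² + |S|²` vanishes on the real line only if `R` and `S` vanish. -/
theorem eq_zero_of_sum_conjP_eq_zero {R S : ℂ[X]} (h : R * conjP R + S * conjP S = 0) :
    R = 0 ∧ S = 0 := by
  have key : ∀ x : ℝ, R.eval (x : ℂ) = 0 ∧ S.eval (x : ℂ) = 0 := by
    intro x
    have := congrArg (Polynomial.eval (x : ℂ)) h
    simp only [eval_add, eval_mul, eval_conjP, Complex.conj_ofReal, eval_zero,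
      Complex.mul_conj] at this
    have h' : Complex.normSq (R.eval (x : ℂ)) + Complex.normSq (S.eval (x : ℂ)) = 0 := by
      exact_mod_cast this
    have h1 := Complex.normSq_nonneg (R.eval (x : ℂ))
    have h2 := Complex.normSq_nonneg (S.eval (x : ℂ))
    exact ⟨Complex.normSq_eq_zero.1 (by linarith), Complex.normSq_eq_zero.1 (by linarith)⟩
  have inf : (Set.range fun x : ℝ => (x : ℂ)).Infinite :=
    Set.infinite_range_of_injective Complex.ofReal_injective
  constructor
  · refine Polynomial.eq_zero_of_infinite_isRoot _ (inf.mono ?_)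
    rintro _ ⟨x, rfl⟩
    exact (key x).1
  · refine Polynomial.eq_zero_of_infinite_isRoot _ (inf.mono ?_)
    rintro _ ⟨x, rfl⟩
    exact (key x).2

theorem eq_of_eval_eq_of_ne_zero {R S : ℂ[X]} (h : ∀ z : ℂ, z ≠ 0 → R.eval z = S.eval z) :
    R = S := by
  refine Polynomial.eq_of_infinite_eval_eq _ _ (Set.Infinite.mono (s := {0}ᶜ) ?_ ?_)
  · exact fun z hz => h z hz
  · exact (Set.finite_singleton (0 : ℂ)).infinite_compl

/-- The polynomial `z ^ n * R (a / z)`. -/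
noncomputable def invert (a : ℂ) (n : ℕ) (R : ℂ[X]) : ℂ[X] :=
  ∑ j ∈ Finset.range (n + 1), C (R.coeff j * a ^ j) * X ^ (n - j)

theorem eval_invert {a : ℂ} {n : ℕ} {R : ℂ[X]} (hR : R.natDegree ≤ n) {z : ℂ} (hz : z ≠ 0) :
    (invert a n R).eval z = z ^ n * R.eval (a / z) := by
  rw [invert, eval_finsetSum, Polynomial.eval_eq_sum_range' (Nat.lt_succ_of_le hR),
    Finset.mul_sum]
  refine Finset.sum_congr rfl fun j hj => ?_
  have hj' : j ≤ n := Nat.lt_succ_iff.1 (Finset.mem_range.1 hj)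
  simp only [eval_mul, eval_C, eval_pow, eval_X]
  rw [div_pow, pow_sub₀ _ hz hj']
  ring

theorem coeff_invert {a : ℂ} {n : ℕ} {R : ℂ[X]} {j : ℕ} (hj : j ≤ n) :
    (invert a n R).coeff (n - j) = R.coeff j * a ^ j := by
  rw [invert, finsetSum_coeff, Finset.sum_eq_single j]
  · simp [coeff_C_mul, -map_mul, -map_pow]
  · intro b hb hbj
    have hb' : b ≤ n := Nat.lt_succ_iff.1 (Finset.mem_range.1 hb)
    rw [coeff_C_mul, coeff_X_pow, if_neg, mul_zero]
    omega
  · intro h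
    exact absurd (Finset.mem_range.2 (Nat.lt_succ_of_le hj)) h

theorem natDegree_invert_le (a : ℂ) (n : ℕ) (R : ℂ[X]) : (invert a n R).natDegree ≤ n := by
  refine natDegree_sum_le_of_forall_le _ _ fun j _ => ?_
  exact (natDegree_C_mul_X_pow_le _ _).trans (Nat.sub_le _ _)

theorem invert_add (a : ℂ) (n : ℕ) (R S : ℂ[X]) :
    invert a n (R + S) = invert a n R + invert a n S := by
  simp only [invert, coeff_add, add_mul, C_add, Finset.sum_add_distrib]

theorem invert_smul (a : ℂ) (n : ℕ) (c : ℂ) (R : ℂ[X]) :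
    invert a n (c • R) = c • invert a n R := by
  rw [invert, invert, Finset.smul_sum]
  refine Finset.sum_congr rfl fun j _ => ?_
  rw [coeff_smul, smul_eq_mul, smul_eq_C_mul, mul_assoc c, C_mul, mul_assoc]

/-- `invert` as a linear map. -/
noncomputable def invertₗ (a : ℂ) (n : ℕ) : ℂ[X] →ₗ[ℂ] ℂ[X] where
  toFun := invert a n
  map_add' := invert_add a n
  map_smul' := invert_smul a n

/-- If `R(z) = κ z ^ (n + l) S(a / z)` with `deg S ≤ n` then `R` vanishes to order `l` at `0`. -/
theorem X_pow_dvd_of_eval_eq {κ a : ℂ} {n l : ℕ} {R S : ℂ[X]} (hS : S.natDegree ≤ n)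
    (h : ∀ z : ℂ, z ≠ 0 → R.eval z = κ * z ^ (n + l) * S.eval (a / z)) : X ^ l ∣ R := by
  refine ⟨C κ * invert a n S, eq_of_eval_eq_of_ne_zero fun z hz => ?_⟩
  rw [h z hz, eval_mul, eval_mul, eval_invert hS hz]
  simp only [eval_pow, eval_X, eval_C, pow_add]
  ring

theorem prod_sq_dvd {ι : Type*} [Fintype ι] {p : ι → ℂ} (hp : Function.Injective p) {F : ℂ[X]}
    (h : ∀ n, (X - C (p n)) ^ 2 ∣ F) : (∏ n, (X - C (p n)) ^ 2) ∣ F := by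
  refine Fintype.prod_dvd_of_coprime ?_ h
  intro i j hij
  exact (Polynomial.pairwise_coprime_X_sub_C hp hij).pow

/-- Polynomials that grow more slowly than `x ^ n` along the real axis have degree less
than `n`. -/
theorem degree_lt_of_isLittleO {R : ℂ[X]} {n : ℕ}
    (h : (fun x : ℝ => R.eval (x : ℂ)) =o[atTop] fun x : ℝ => (x : ℂ) ^ n) :
    R.degree < n := by
  by_contra hcon
  have hdeg : (X ^ n : ℂ[X]).degree ≤ R.degree := by
    rw [degree_X_pow]; exact not_lt.1 hcon
  have hR : R ≠ 0 := by
    rintro rfl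
    simp at hcon
  have hO := Polynomial.isBigO_cobounded_of_degree_le hdeg
  have ht : Tendsto (fun x : ℝ => (x : ℂ)) atTop (Bornology.cobounded ℂ) :=
    RCLike.tendsto_ofReal_atTop_cobounded ℂ
  have hO' := hO.comp_tendsto ht
  have h2 : (fun x : ℝ => R.eval (x : ℂ)) =o[atTop] fun x : ℝ => R.eval (x : ℂ) := by
    refine h.trans_isBigO ?_
    simpa [Function.comp_def] using hO'
  have h3 : ∀ᶠ x : ℝ in atTop, R.eval (x : ℂ) = 0 := by
    filter_upwards [h2.def (half_pos one_pos)] with x hx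
    exact norm_le_zero_iff.1 (by linarith [norm_nonneg (R.eval (x : ℂ))])
  have h4 := ht.eventually
    ((Polynomial.eventually_cofinite_not_isRoot hR).filter_mono (Bornology.le_cofinite ℂ))
  obtain ⟨x, hx, hx'⟩ := (h3.and h4).exists
  exact hx' hx
/-! ### The discrete spectrum and its symmetries -/

/-- The hypotheses on the free parameters. -/
structure Data.Admissible {N : ℕ} (D : Data N) : Prop where
  qm_ne : D.qm ≠ 0
  norm_lt : ∀ n, ‖D.qm‖ < ‖D.z n‖
  im_neg : ∀ n, (D.z n).im < 0
  inj : Function.Injective D.z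
  b_ne : ∀ n, D.b n ≠ 0

namespace Data

variable {N : ℕ} (D : Data N)

/-- `-q₀²`, so that `z ↦ ρ / z` is the involution exchanging `η_n` and `η̂_n`. -/
noncomputable def rho : ℂ := -(D.q₀ : ℂ) ^ 2

/-- `∏ (z - η_n)²`. -/
noncomputable def polyEta : ℂ[X] := ∏ n, (X - C (D.eta n)) ^ 2

/-- `∏ (z - η̂_n)²`. -/
noncomputable def polyHat : ℂ[X] := ∏ n, (X - C (D.etaHat n)) ^ 2

/-- `∏ η_n`. -/
noncomputable def prodEta : ℂ := ∏ n, D.eta n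

/-- `∏ η̂_n`. -/
noncomputable def prodHat : ℂ := ∏ n, D.etaHat n

/-- The constant `c` in the symmetry `P₂(z) = c z ^ (4N+1) P₁(ρ / z)` of the numerators of a
row of the Jost matrix. -/
noncomputable def symC : ℂ := Complex.I * D.qm / ((D.q₀ : ℂ) ^ 2 * D.prodEta ^ 2)

/-- The constant `c'` in the inverse symmetry `P₁(z) = c' z ^ (4N+1) P₂(ρ / z)`. -/
noncomputable def symC' : ℂ := Complex.I / (D.qm * D.prodHat ^ 2)

theorem conj_qm : D.qm * conj D.qm = (D.q₀ : ℂ) ^ 2 := by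
  rw [Complex.mul_conj, Complex.normSq_eq_norm_sq]; simp [q₀]

@[simp] theorem conj_rho : conj D.rho = D.rho := by simp [rho]

theorem etaHat_eq (n) : D.etaHat n = D.rho / D.eta n := by rw [etaHat, rho, neg_div]

theorem eta_inl (n) : D.eta (Sum.inl n) = D.z n := rfl

theorem eta_inr (n) : D.eta (Sum.inr n) = D.rho / conj (D.z n) := by
  rw [rho, neg_div]; rfl

namespace Admissible

variable {D} (h : D.Admissible)
include h

theorem q₀_pos : 0 < D.q₀ := norm_pos_iff.2 h.qm_ne

theorem q₀_ne : (D.q₀ : ℂ) ≠ 0 := Complex.ofReal_ne_zero.2 h.q₀_pos.ne'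

theorem rho_ne : D.rho ≠ 0 := neg_ne_zero.2 (pow_ne_zero _ h.q₀_ne)

theorem z_ne (n) : D.z n ≠ 0 := by
  intro h0
  have := h.im_neg n
  simp [h0] at this

theorem conj_z_ne (n) : conj (D.z n) ≠ 0 := (_root_.map_ne_zero _).2 (h.z_ne n)

theorem eta_ne (n) : D.eta n ≠ 0 := by
  rcases n with n | n
  · exact h.z_ne n
  · rw [eta_inr]; exact div_ne_zero h.rho_ne (h.conj_z_ne n)

theorem etaHat_ne (n) : D.etaHat n ≠ 0 := by
  rw [etaHat_eq]; exact div_ne_zero h.rho_ne (h.eta_ne n)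

theorem eta_eq (n) : D.eta n = D.rho / D.etaHat n := by
  rw [etaHat_eq]
  have := h.rho_ne
  have := h.eta_ne n
  field_simp

theorem conj_eta (n) : conj (D.eta n) = D.etaHat n.swap := by
  have h1 := h.rho_ne
  rcases n with n | n
  · have := h.conj_z_ne n
    rw [etaHat_eq, Sum.swap_inl, eta_inr, eta_inl]
    field_simp
  · rw [etaHat_eq, Sum.swap_inr, eta_inr, eta_inl]
    simp

theorem conj_etaHat (n) : conj (D.etaHat n) = D.eta n.swap := by
  have := congrArg conj (h.conj_eta n.swap)
  simpa using this.symm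

/-- The orbit `w, w*, ρ / w*, ρ / w` of a point with `|w| > q₀`, `Im w < 0` under the two
symmetries, with the regions in which its members lie. -/
theorem mem_regions_of_norm {w : ℂ} (hw : D.q₀ < ‖w‖) (hi : w.im < 0) :
    w ∈ Dminus D.q₀ ∧ conj w ∈ Dplus D.q₀ ∧ D.rho / conj w ∈ Dminus D.q₀ ∧
      D.rho / w ∈ Dplus D.q₀ := by
  have hq := h.q₀_pos
  have hlt : D.q₀ ^ 2 < ‖w‖ ^ 2 := by gcongr
  have hw0 : 0 < ‖w‖ := hq.trans hw
  have hr : D.rho = ((-D.q₀ ^ 2 : ℝ) : ℂ) := by simp [rho]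
  have hn : ‖D.rho / w‖ ^ 2 < D.q₀ ^ 2 := by
    rw [hr, norm_div, Complex.norm_real, norm_neg, Real.norm_of_nonneg (by positivity)]
    have : D.q₀ ^ 2 / ‖w‖ < D.q₀ := by
      rw [div_lt_iff₀ hw0]; nlinarith
    have h0 : 0 ≤ D.q₀ ^ 2 / ‖w‖ := by positivity
    gcongr
  have hns : 0 < Complex.normSq w := by
    rw [Complex.normSq_eq_norm_sq]; positivity
  have him : (D.rho / w).im < 0 := by
    rw [hr, Complex.div_im]
    simp only [Complex.ofReal_im, Complex.ofReal_re]
    have : 0 * w.re / Complex.normSq w - -D.q₀ ^ 2 * w.im / Complex.normSq w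
      = D.q₀ ^ 2 * w.im / Complex.normSq w := by ring
    rw [this]
    exact div_neg_of_neg_of_pos (mul_neg_of_pos_of_neg (by positivity) hi) hns
  have hcd : D.rho / conj w = conj (D.rho / w) := by simp
  refine ⟨?_, ?_, ?_, ?_⟩
  · exact mul_neg_of_pos_of_neg (by linarith) hi
  · show 0 < (‖conj w‖ ^ 2 - D.q₀ ^ 2) * (conj w).im
    rw [Complex.norm_conj, Complex.conj_im]
    exact mul_pos (by linarith) (by linarith)
  · rw [hcd]
    show (‖conj (D.rho / w)‖ ^ 2 - D.q₀ ^ 2) * (conj (D.rho / w)).im < 0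
    rw [Complex.norm_conj, Complex.conj_im]
    exact mul_neg_of_neg_of_pos (by linarith) (by linarith)
  · exact mul_pos_of_neg_of_neg (by linarith) him

theorem eta_mem (n) : D.eta n ∈ Dminus D.q₀ := by
  rcases n with n | n
  · exact (h.mem_regions_of_norm (h.norm_lt n) (h.im_neg n)).1
  · rw [eta_inr]
    exact (h.mem_regions_of_norm (h.norm_lt n) (h.im_neg n)).2.2.1

theorem etaHat_mem (n) : D.etaHat n ∈ Dplus D.q₀ := by
  rw [etaHat_eq]
  rcases n with n | n
  · exact (h.mem_regions_of_norm (h.norm_lt n) (h.im_neg n)).2.2.2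
  · rw [eta_inr]
    have := h.rho_ne
    have := h.conj_z_ne n
    rw [div_div_cancel₀ h.rho_ne]
    exact (h.mem_regions_of_norm (h.norm_lt n) (h.im_neg n)).2.1

omit h in
theorem ne_of_mem {w v : ℂ} (hw : w ∈ Dminus D.q₀) (hv : v ∈ Dplus D.q₀) : w ≠ v := by
  rintro rfl
  exact lt_asymm (Set.mem_ofPred.1 hw) (Set.mem_ofPred.1 hv)

theorem ne_etaHat_of_mem {w : ℂ} (hw : w ∈ Dminus D.q₀ ∪ contSpec D.q₀) (n) :
    w ≠ D.etaHat n := by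
  rintro rfl
  have hm := h.etaHat_mem n
  rcases hw with hw | ⟨hw | hw, -⟩
  · exact ne_of_mem hw hm rfl
  · simp [Dplus, hw] at hm
  · simp [Dplus, hw] at hm

theorem ne_eta_of_mem {w : ℂ} (hw : w ∈ Dplus D.q₀ ∪ contSpec D.q₀) (n) :
    w ≠ D.eta n := by
  rintro rfl
  have hm := h.eta_mem n
  rcases hw with hw | ⟨hw | hw, -⟩
  · exact ne_of_mem hm hw rfl
  · simp [Dminus, hw] at hm
  · simp [Dminus, hw] at hm

theorem eta_ne_etaHat (n m) : D.eta n ≠ D.etaHat m :=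
  ne_of_mem (h.eta_mem n) (h.etaHat_mem m)

theorem eta_injective : Function.Injective D.eta := by
  have key : ∀ n m, D.z n ≠ D.rho / conj (D.z m) := by
    intro n m hnm
    have h1 := congrArg norm hnm
    rw [norm_div, Complex.norm_conj] at h1
    have hr : ‖D.rho‖ = D.q₀ * D.q₀ := by
      rw [rho, norm_neg, norm_pow, Complex.norm_real, Real.norm_of_nonneg h.q₀_pos.le, pow_two]
    rw [hr] at h1
    have a : D.q₀ < ‖D.z n‖ := h.norm_lt n
    have b : D.q₀ < ‖D.z m‖ := h.norm_lt m
    have hq := h.q₀_pos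
    rw [h1, lt_div_iff₀ (hq.trans b)] at a
    nlinarith
  rintro (n | n) (m | m) hnm
  · exact congrArg _ (h.inj hnm)
  · rw [eta_inl, eta_inr] at hnm
    exact absurd hnm (key n m)
  · rw [eta_inl, eta_inr] at hnm
    exact absurd hnm.symm (key m n)
  · rw [eta_inr, eta_inr] at hnm
    have := h.rho_ne
    have h1 : conj (D.z n) = conj (D.z m) := by
      have := h.conj_z_ne n
      have := h.conj_z_ne m
      field_simp at hnm
      exact hnm.symm
    exact congrArg _ (h.inj ((starRingEnd ℂ).injective h1))

theorem etaHat_injective : Function.Injective D.etaHat := by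
  intro n m hnm
  apply h.eta_injective
  rw [h.eta_eq n, h.eta_eq m, hnm]

theorem prodEta_ne : D.prodEta ≠ 0 := Finset.prod_ne_zero_iff.2 fun n _ => h.eta_ne n

theorem prodHat_ne : D.prodHat ≠ 0 := Finset.prod_ne_zero_iff.2 fun n _ => h.etaHat_ne n

theorem conj_prodEta : conj D.prodEta = D.prodHat := by
  rw [prodEta, map_prod, prodHat, ← (Equiv.sumComm (Fin N) (Fin N)).prod_comp D.etaHat]
  exact Finset.prod_congr rfl fun n _ => h.conj_eta n

theorem prodEta_mul_prodHat : D.prodEta * D.prodHat = (D.q₀ : ℂ) ^ (4 * N) := by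
  rw [prodEta, prodHat, ← Finset.prod_mul_distrib]
  have : ∀ n, D.eta n * D.etaHat n = D.rho := fun n => by
    rw [etaHat_eq, mul_div_cancel₀ _ (h.eta_ne n)]
  simp only [this, Finset.prod_const, Finset.card_univ, Fintype.card_sum, Fintype.card_fin, rho]
  rw [← two_mul, pow_mul, neg_sq, ← pow_mul, ← pow_mul]
  ring_nf

/-- The defining product of `q₊` in terms of the discrete spectrum (the theta condition). -/
theorem qp_mul : D.qp * D.prodEta ^ 2 = D.qm * D.prodHat ^ 2 := by
  rw [qp, prodEta, prodHat, Fintype.prod_sum_type, Fintype.prod_sum_type, mul_assoc]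
  congr 1
  simp only [← Finset.prod_mul_distrib, ← Finset.prod_pow]
  refine Finset.prod_congr rfl fun n _ => ?_
  rw [etaHat_eq, etaHat_eq, eta_inr, eta_inl]
  have := h.rho_ne
  have := h.conj_z_ne n
  have := h.z_ne n
  field_simp

theorem norm_qp : ‖D.qp‖ = D.q₀ := by
  rw [qp, norm_mul, norm_prod, Finset.prod_eq_one, mul_one]; · rfl
  intro n _
  rw [norm_pow, norm_div, Complex.norm_conj, div_self (norm_ne_zero_iff.2 (h.z_ne n)), one_pow]

theorem conj_qp : D.qp * conj D.qp = (D.q₀ : ℂ) ^ 2 := by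
  rw [Complex.mul_conj, Complex.normSq_eq_norm_sq, h.norm_qp]; simp

theorem qp_ne : D.qp ≠ 0 := norm_pos_iff.1 (by rw [h.norm_qp]; exact h.q₀_pos)

theorem conj_qp_ne : conj D.qp ≠ 0 := (_root_.map_ne_zero _).2 h.qp_ne

theorem conj_qm_ne : conj D.qm ≠ 0 := (_root_.map_ne_zero _).2 h.qm_ne

theorem symC'_eq : D.symC' = -conj D.symC := by
  rw [symC', symC, map_div₀, map_mul, map_mul, map_pow, map_pow, h.conj_prodEta,
    Complex.conj_I, Complex.conj_ofReal, ← D.conj_qm]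
  have := h.prodHat_ne
  have := h.qm_ne
  have := h.conj_qm_ne
  field_simp

theorem symC_mul_symC' : D.symC * D.symC' * D.rho ^ (4 * N + 1) = 1 := by
  have e : D.rho ^ (4 * N + 1) = -(D.prodEta * D.prodHat) ^ 2 * (D.q₀ : ℂ) ^ 2 := by
    rw [h.prodEta_mul_prodHat, rho, pow_succ, neg_pow, Even.neg_one_pow (by exact ⟨2 * N, by ring⟩)]
    ring
  rw [e, symC, symC']
  have := h.prodHat_ne
  have := h.prodEta_ne
  have := h.qm_ne
  have := h.q₀_ne
  field_simp
  rw [Complex.I_sq]; ring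

/-- The ratio of the two symmetry constants is the ratio of `b₋(η_n)` to `b₊(η̂_n)`. -/
theorem symC'_mul : D.symC' * (D.qm / conj D.qp) = D.symC := by
  have h1 := h.prodHat_ne
  have h2 := h.prodEta_ne
  have h3 := h.qm_ne
  have h4 := h.q₀_ne
  have h5 := h.conj_qp_ne
  have h6 := h.qp_mul
  have h7 : conj D.qp = (D.q₀ : ℂ) ^ 2 / D.qp := by
    rw [← h.conj_qp, mul_div_cancel_left₀ _ h.qp_ne]
  have h8 := h.qp_ne
  rw [symC, symC', h7]
  field_simp
  linear_combination h6

omit h in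
theorem bPlus_swap (n) : D.bPlus n.swap = -conj (D.bMinus n) := by
  rcases n with n | n
  · rfl
  · simp [bMinus, bPlus]

omit h in
theorem dPlus_swap (n) : D.dPlus n.swap = -conj (D.dMinus n) := by
  rcases n with n | n
  · rfl
  · simp [dMinus, dPlus]

/-- The symmetry `z ↦ ρ / z` of the constants `b`, uniform over both halves of the spectrum. -/
theorem bPlus_eq (n) : D.bPlus n = D.qm / conj D.qp * D.bMinus n := by
  rcases n with n | n
  · rfl
  · have h5 := h.conj_qp_ne
    have h6 := h.qp_ne
    have h7 : D.qm * conj D.qm = D.qp * conj D.qp := by rw [D.conj_qm, h.conj_qp]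
    simp only [bPlus, bMinus, Sum.elim_inl, Sum.elim_inr, map_mul, map_div₀, Complex.conj_conj]
    field_simp
    linear_combination (conj (D.b n)) * h7

/-- The symmetry `z ↦ ρ / z` of the constants `d`, uniform over both halves of the spectrum. -/
theorem dPlus_eq (n) :
    D.dPlus n = D.qm / conj D.qp * (D.eta n ^ 2 / (D.q₀ : ℂ) ^ 2) * D.dMinus n := by
  rcases n with n | n
  · rfl
  · have h5 := h.conj_qp_ne
    have h6 := h.qp_ne
    have h8 := h.q₀_ne
    have h9 := h.conj_z_ne n
    have h7 : D.qm * conj D.qm = D.qp * conj D.qp := by rw [D.conj_qm, h.conj_qp]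
    simp only [dPlus, dMinus, Sum.elim_inl, Sum.elim_inr, map_mul, map_div₀, Complex.conj_conj,
      eta_inr, rho, map_pow, Complex.conj_ofReal]
    field_simp
    linear_combination (conj (D.d n)) * h7

theorem bPlus_ne (n) : D.bPlus n ≠ 0 := by
  rcases n with n | n
  · exact mul_ne_zero (div_ne_zero h.qm_ne h.conj_qp_ne) (h.b_ne n)
  · exact neg_ne_zero.2 ((_root_.map_ne_zero _).2 (h.b_ne n))

theorem bMinus_ne (n) : D.bMinus n ≠ 0 := by
  intro h0
  have := h.bPlus_ne n
  rw [h.bPlus_eq, h0, mul_zero] at this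
  exact this rfl

theorem conjP_polyEta : conjP D.polyEta = D.polyHat := by
  rw [polyEta, polyHat, conjP, Polynomial.map_prod,
    ← (Equiv.sumComm (Fin N) (Fin N)).prod_comp fun n => (X - C (D.etaHat n)) ^ 2]
  refine Finset.prod_congr rfl fun n _ => ?_
  simp [h.conj_eta n]

theorem conjP_polyHat : conjP D.polyHat = D.polyEta := by
  rw [← h.conjP_polyEta, conjP_conjP]

end Admissible

theorem monic_polyEta : D.polyEta.Monic :=
  monic_prod_of_monic _ _ fun _ _ => (monic_X_sub_C _).pow 2

theorem monic_polyHat : D.polyHat.Monic :=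
  monic_prod_of_monic _ _ fun _ _ => (monic_X_sub_C _).pow 2

theorem natDegree_polyEta : D.polyEta.natDegree = 4 * N := by
  rw [polyEta, natDegree_prod_of_monic _ _ fun _ _ => (monic_X_sub_C _).pow 2]
  simp; ring

theorem natDegree_polyHat : D.polyHat.natDegree = 4 * N := by
  rw [polyHat, natDegree_prod_of_monic _ _ fun _ _ => (monic_X_sub_C _).pow 2]
  simp; ring

theorem eval_polyEta (z : ℂ) : D.polyEta.eval z = ∏ n, (z - D.eta n) ^ 2 := by
  simp [polyEta, eval_prod]

theorem eval_polyHat (z : ℂ) : D.polyHat.eval z = ∏ n, (z - D.etaHat n) ^ 2 := by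
  simp [polyHat, eval_prod]

theorem eval_polyEta_ne {z : ℂ} (hz : ∀ n, z ≠ D.eta n) : D.polyEta.eval z ≠ 0 := by
  rw [eval_polyEta]
  exact Finset.prod_ne_zero_iff.2 fun n _ => pow_ne_zero _ (sub_ne_zero.2 (hz n))

theorem eval_polyHat_ne {z : ℂ} (hz : ∀ n, z ≠ D.etaHat n) : D.polyHat.eval z ≠ 0 := by
  rw [eval_polyHat]
  exact Finset.prod_ne_zero_iff.2 fun n _ => pow_ne_zero _ (sub_ne_zero.2 (hz n))

theorem eval_polyEta_zero : D.polyEta.eval 0 = D.prodEta ^ 2 := by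
  simp [eval_polyEta, prodEta, Finset.prod_pow]

theorem eval_polyHat_zero : D.polyHat.eval 0 = D.prodHat ^ 2 := by
  simp [eval_polyHat, prodHat, Finset.prod_pow]

namespace Admissible

variable {D} (h : D.Admissible)
include h

theorem eval_polyEta_inv {z : ℂ} (hz : z ≠ 0) :
    z ^ (4 * N) * D.polyEta.eval (D.rho / z) = D.prodEta ^ 2 * D.polyHat.eval z := by
  have e : z ^ (4 * N) = ∏ _n : Fin N ⊕ Fin N, z ^ 2 := by
    simp only [Finset.prod_const, Finset.card_univ, Fintype.card_sum, Fintype.card_fin,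
      ← pow_mul]
    ring_nf
  rw [e, eval_polyEta, eval_polyHat, prodEta, ← Finset.prod_pow, ← Finset.prod_mul_distrib,
    ← Finset.prod_mul_distrib]
  refine Finset.prod_congr rfl fun n _ => ?_
  have := h.eta_ne n
  rw [etaHat_eq]
  field_simp
  ring

theorem eval_polyHat_inv {z : ℂ} (hz : z ≠ 0) :
    z ^ (4 * N) * D.polyHat.eval (D.rho / z) = D.prodHat ^ 2 * D.polyEta.eval z := by
  have e : z ^ (4 * N) = ∏ _n : Fin N ⊕ Fin N, z ^ 2 := by
    simp only [Finset.prod_const, Finset.card_univ, Fintype.card_sum, Fintype.card_fin,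
      ← pow_mul]
    ring_nf
  rw [e, eval_polyEta, eval_polyHat, prodHat, ← Finset.prod_pow, ← Finset.prod_mul_distrib,
    ← Finset.prod_mul_distrib]
  refine Finset.prod_congr rfl fun n _ => ?_
  have := h.etaHat_ne n
  rw [h.eta_eq]
  field_simp
  ring

theorem s11_eq (z : ℂ) : D.s11 z = D.polyEta.eval z / D.polyHat.eval z := by
  rw [s11, eval_polyEta, eval_polyHat, Fintype.prod_sum_type, Fintype.prod_sum_type,
    ← Finset.prod_mul_distrib, ← Finset.prod_mul_distrib, ← Finset.prod_div_distrib]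
  refine Finset.prod_congr rfl fun n _ => ?_
  have e1 := h.conj_eta (Sum.inl n)
  have e2 := h.conj_eta (Sum.inr n)
  rw [Sum.swap_inl] at e1
  rw [Sum.swap_inr] at e2
  rw [← e1, ← e2, eta_inl, eta_inr]
  simp [rho, neg_div, mul_comm]

theorem s22_eq (z : ℂ) : D.s22 z = D.polyHat.eval z / D.polyEta.eval z := by
  rw [← inv_div, ← h.s11_eq, s22, s11, ← Finset.prod_inv_distrib]
  simp only [inv_div]

theorem s11_eq_zero {z : ℂ} (hz : z ∈ Dminus D.q₀) (hs : D.s11 z = 0) : ∃ n, z = D.eta n := by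
  by_contra! hcon
  rw [h.s11_eq] at hs
  exact div_ne_zero (D.eval_polyEta_ne hcon)
    (D.eval_polyHat_ne (h.ne_etaHat_of_mem (Or.inl hz))) hs

theorem s22_eq_zero {z : ℂ} (hz : z ∈ Dplus D.q₀) (hs : D.s22 z = 0) : ∃ n, z = D.etaHat n := by
  by_contra! hcon
  rw [h.s22_eq] at hs
  exact div_ne_zero (D.eval_polyHat_ne hcon)
    (D.eval_polyEta_ne (h.ne_eta_of_mem (Or.inl hz))) hs

end Admissible

/-! ### The phase -/

theorem phase_eq (x t : ℝ) (z : ℂ) :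
    phase D.q₀ D.ε x t z = x * phase D.q₀ D.ε 1 0 z + t * phase D.q₀ D.ε 0 1 z := by
  simp only [phase, Complex.ofReal_one, Complex.ofReal_zero]
  ring

theorem phase_one_zero (z : ℂ) : phase D.q₀ D.ε 1 0 z = specLam D.q₀ z := by
  simp [phase]

theorem specLam_conj (z : ℂ) : specLam D.q₀ (conj z) = conj (specLam D.q₀ z) := by
  simp [specLam, _root_.map_ofNat]

theorem specK_conj (z : ℂ) : specK D.q₀ (conj z) = conj (specK D.q₀ z) := by
  simp [specK, _root_.map_ofNat]

theorem phase_conj (x t : ℝ) (z : ℂ) :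
    phase D.q₀ D.ε x t (conj z) = conj (phase D.q₀ D.ε x t z) := by
  simp [phase, specLam_conj, specK_conj, Complex.conj_ofReal, _root_.map_ofNat]

theorem differentiableAt_phase (x t : ℝ) {z : ℂ} (hz : z ≠ 0) :
    DifferentiableAt ℂ (phase D.q₀ D.ε x t) z := by
  unfold phase specLam specK
  fun_prop (disch := assumption)

theorem deriv_phase_conj (x t : ℝ) (z : ℂ) :
    deriv (phase D.q₀ D.ε x t) (conj z) = conj (deriv (phase D.q₀ D.ε x t) z) := by
  have e : (phase D.q₀ D.ε x t) = conj ∘ (phase D.q₀ D.ε x t) ∘ conj := by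
    ext w; simp [phase_conj]
  conv_lhs => rw [e]
  rw [deriv_conj_conj]
  simp

theorem deriv_phase_eq (x t : ℝ) {z : ℂ} (hz : z ≠ 0) :
    deriv (phase D.q₀ D.ε x t) z
      = x * deriv (phase D.q₀ D.ε 1 0) z + t * deriv (phase D.q₀ D.ε 0 1) z := by
  have e : phase D.q₀ D.ε x t
      = fun z => x * phase D.q₀ D.ε 1 0 z + t * phase D.q₀ D.ε 0 1 z := by
    ext w; exact D.phase_eq x t w
  rw [e]
  exact (((D.differentiableAt_phase 1 0 hz).hasDerivAt.const_mul _).add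
    ((D.differentiableAt_phase 0 1 hz).hasDerivAt.const_mul _)).deriv

namespace Admissible

variable {D} (h : D.Admissible)
include h

theorem specLam_inv {z : ℂ} (hz : z ≠ 0) : specLam D.q₀ (D.rho / z) = -specLam D.q₀ z := by
  have := h.q₀_ne
  simp only [specLam, rho]
  field_simp
  ring

theorem specK_inv {z : ℂ} (hz : z ≠ 0) : specK D.q₀ (D.rho / z) = specK D.q₀ z := by
  have := h.q₀_ne
  simp only [specK, rho]
  field_simp
  ring

theorem phase_inv (x t : ℝ) {z : ℂ} (hz : z ≠ 0) :
    phase D.q₀ D.ε x t (D.rho / z) = -phase D.q₀ D.ε x t z := by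
  simp only [phase, h.specLam_inv hz, h.specK_inv hz, neg_mul]

theorem deriv_phase_inv (x t : ℝ) {z : ℂ} (hz : z ≠ 0) :
    deriv (phase D.q₀ D.ε x t) (D.rho / z) = z ^ 2 / D.rho * deriv (phase D.q₀ D.ε x t) z := by
  have hr := h.rho_ne
  have h1 : HasDerivAt (fun w => D.rho / w) (-D.rho / z ^ 2) z := by
    simpa [div_eq_mul_inv, neg_mul, mul_neg] using (hasDerivAt_inv hz).const_mul D.rho
  have h2 := (D.differentiableAt_phase x t (div_ne_zero hr hz)).hasDerivAt.comp z h1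
  have h3 : HasDerivAt (phase D.q₀ D.ε x t ∘ fun w => D.rho / w)
      (-deriv (phase D.q₀ D.ε x t) z) z := by
    refine ((D.differentiableAt_phase x t hz).hasDerivAt.neg).congr_of_eventuallyEq ?_
    filter_upwards [isOpen_ne.mem_nhds hz] with w hw
    exact h.phase_inv x t hw
  have := h2.unique h3
  field_simp at this ⊢
  linear_combination -this

end Admissible

end Data
/-! ### Families of polynomials depending on a real parameter -/

/-- The family `P` of polynomials has derivative `D` at `s`, tested against linear functionals. -/
def HasPolyDerivAt (P : ℝ → ℂ[X]) (D : ℂ[X]) (s : ℝ) : Prop :=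
  ∀ L : ℂ[X] →ₗ[ℂ] ℂ, HasDerivAt (fun r => L (P r)) (L D) s

namespace HasPolyDerivAt

variable {P : ℝ → ℂ[X]} {D : ℂ[X]} {s : ℝ}

theorem eval (h : HasPolyDerivAt P D s) (z : ℂ) :
    HasDerivAt (fun r => (P r).eval z) (D.eval z) s := by
  simpa using h (leval z)

theorem eval_derivative (h : HasPolyDerivAt P D s) (z : ℂ) :
    HasDerivAt (fun r => (derivative (P r)).eval z) ((derivative D).eval z) s := by
  simpa using h ((leval z).comp derivative)

theorem map (h : HasPolyDerivAt P D s) (F : ℂ[X] →ₗ[ℂ] ℂ[X]) :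
    HasPolyDerivAt (fun r => F (P r)) (F D) s := fun L => by
  simpa using h (L.comp F)

end HasPolyDerivAt

/-- Differentiation of a first-order relation whose coefficients contain the phase factor
`exp (2 i σ₀)`; here `τ₀`, `τ₁` are the rates of change of the phase and of its `z`-derivative
at `a`, and `T` is `z ^ m` times the rate of change of the phase. -/
theorem JetRel.hasDerivAt {a β δ : ℂ} {R S : ℝ → ℂ[X]} {DR DS T : ℂ[X]} {σ₀ σ₁ : ℝ → ℂ}
    {τ₀ τ₁ : ℂ} {s : ℝ} {m : ℕ}
    (h : ∀ r, JetRel a (β * Complex.exp (2 * Complex.I * σ₀ r))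
      (Complex.exp (2 * Complex.I * σ₀ r) * (δ + 2 * Complex.I * σ₁ r * β)) (R r) (S r))
    (hR : HasPolyDerivAt R DR s) (hS : HasPolyDerivAt S DS s)
    (h0 : HasDerivAt σ₀ τ₀ s) (h1 : HasDerivAt σ₁ τ₁ s)
    (hT : T.eval a = a ^ m * τ₀)
    (hT' : (derivative T).eval a = (derivative (X ^ m : ℂ[X])).eval a * τ₀ + a ^ m * τ₁) :
    JetRel a (β * Complex.exp (2 * Complex.I * σ₀ s))
      (Complex.exp (2 * Complex.I * σ₀ s) * (δ + 2 * Complex.I * σ₁ s * β))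
      (X ^ m * DR - C Complex.I * T * R s) (X ^ m * DS + C Complex.I * T * S s) := by
  have he : HasDerivAt (fun r => Complex.exp (2 * Complex.I * σ₀ r))
      (Complex.exp (2 * Complex.I * σ₀ s) * (2 * Complex.I * τ₀)) s :=
    (h0.const_mul _).cexp
  have e1 := (hR.eval a).unique
    (((he.const_mul β).mul (hS.eval a)).congr_of_eventuallyEq
      (Eventually.of_forall fun r => ((jetRel_iff _ _ _ _ _).1 (h r)).1))
  have e2 := (hR.eval_derivative a).unique
    ((((he.mul (((h1.const_mul (2 * Complex.I)).mul_const β).const_add δ)).mul (hS.eval a)).add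
      ((he.const_mul β).mul (hS.eval_derivative a))).congr_of_eventuallyEq
      (Eventually.of_forall fun r => ((jetRel_iff _ _ _ _ _).1 (h r)).2))
  obtain ⟨e3, e4⟩ := (jetRel_iff _ _ _ _ _).1 (h s)
  rw [jetRel_iff]
  simp only [derivative_sub, derivative_add, derivative_mul, eval_sub, eval_add, eval_mul,
    eval_pow, eval_X, eval_C, derivative_C, hT, hT', zero_mul, zero_add, Pi.mul_apply] at e1 e2 ⊢
  set e := Complex.exp (2 * Complex.I * σ₀ s)
  set μ := (derivative (X ^ m : ℂ[X])).eval a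
  constructor
  · linear_combination a ^ m * e1 - Complex.I * a ^ m * τ₀ * e3
  · linear_combination μ * e1 + a ^ m * e2 - Complex.I * (μ * τ₀ + a ^ m * τ₁) * e3 -
      Complex.I * a ^ m * τ₀ * e4

namespace Data

variable {N : ℕ} (D : Data N)

/-! ### Rows of the Jost matrix -/

/-- The numerators `R`, `S` of the two entries of a row `(R e^{-iθ}, S e^{iθ})` satisfy the
relations that the constants `b`, `d` impose at the discrete spectrum. -/
structure IsRow (x t : ℝ) (R S : ℂ[X]) : Prop where
  at_eta : ∀ n, JetRel (D.eta n)
    (D.bMinus n * Complex.exp (2 * Complex.I * phase D.q₀ D.ε x t (D.eta n)))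
    (Complex.exp (2 * Complex.I * phase D.q₀ D.ε x t (D.eta n)) *
      (D.dMinus n + 2 * Complex.I * deriv (phase D.q₀ D.ε x t) (D.eta n) * D.bMinus n)) R S
  at_etaHat : ∀ n, JetRel (D.etaHat n)
    (D.bPlus n * Complex.exp (2 * Complex.I * -phase D.q₀ D.ε x t (D.etaHat n)))
    (Complex.exp (2 * Complex.I * -phase D.q₀ D.ε x t (D.etaHat n)) *
      (D.dPlus n + 2 * Complex.I * -deriv (phase D.q₀ D.ε x t) (D.etaHat n) * D.bPlus n)) S R

/-- The symmetry under `z ↦ ρ / z` of a row whose entries have the numerators `R / z ^ m` and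
`S / z ^ m`. -/
def IsSym (m : ℕ) (R S : ℂ[X]) : Prop :=
  ∀ z : ℂ, z ≠ 0 →
    D.rho ^ m * S.eval z = D.symC * z ^ (4 * N + 1 + 2 * m) * R.eval (D.rho / z)

variable {D}

theorem IsRow.add {x t : ℝ} {R S R' S' : ℂ[X]} (h : D.IsRow x t R S) (h' : D.IsRow x t R' S') :
    D.IsRow x t (R + R') (S + S') :=
  ⟨fun n => (h.at_eta n).add (h'.at_eta n), fun n => (h.at_etaHat n).add (h'.at_etaHat n)⟩

theorem IsRow.mul_left {x t : ℝ} {R S : ℂ[X]} (F : ℂ[X]) (h : D.IsRow x t R S) :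
    D.IsRow x t (F * R) (F * S) :=
  ⟨fun n => (h.at_eta n).mul_left F, fun n => (h.at_etaHat n).mul_left F⟩

theorem IsSym.add {m : ℕ} {R S R' S' : ℂ[X]} (h : D.IsSym m R S) (h' : D.IsSym m R' S') :
    D.IsSym m (R + R') (S + S') := fun z hz => by
  rw [eval_add, eval_add, mul_add, mul_add, h z hz, h' z hz]

/-- Multiplication of a row by a Laurent polynomial `F / z ^ l` invariant under `z ↦ ρ / z`. -/
theorem IsSym.mul_left {m l : ℕ} {R S F : ℂ[X]} (h : D.IsSym m R S)
    (hF : ∀ z : ℂ, z ≠ 0 → D.rho ^ l * F.eval z = z ^ (2 * l) * F.eval (D.rho / z)) :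
    D.IsSym (l + m) (F * R) (F * S) := fun z hz => by
  have h1 := h z hz
  have h2 := hF z hz
  rw [eval_mul, eval_mul]
  have e : z ^ (4 * N + 1 + 2 * (l + m)) = z ^ (4 * N + 1 + 2 * m) * z ^ (2 * l) := by
    rw [← pow_add]; ring_nf
  rw [e, pow_add]
  linear_combination D.rho ^ m * S.eval z * h2 + z ^ (2 * l) * F.eval (D.rho / z) * h1

namespace Admissible

variable (h : D.Admissible)
include h

/-- The quaternionic symmetry `(R, S) ↦ (-S^*, R^*)` of the relations at the discrete
spectrum: it produces the second row of the Jost matrix from the first. -/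
theorem isRow_conj {x t : ℝ} {R S : ℂ[X]} (hr : D.IsRow x t R S) :
    D.IsRow x t (-conjP S) (conjP R) := by
  constructor
  · intro n
    have := (hr.at_etaHat n.swap).conj
    rw [h.conj_etaHat, Sum.swap_swap, JetRel] at this
    rw [JetRel]
    convert this.neg_right using 1
    simp only [map_mul, map_add, map_neg, Complex.conj_I, _root_.map_ofNat, ← Complex.exp_conj,
      ← phase_conj, ← deriv_phase_conj, h.conj_etaHat, Sum.swap_swap, bPlus_swap, dPlus_swap,
      Complex.conj_conj, neg_neg, mul_neg, neg_mul]
    ring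
  · intro n
    have := (hr.at_eta n.swap).conj
    rw [h.conj_eta, Sum.swap_swap, JetRel] at this
    rw [JetRel]
    convert this using 1
    have hb := bPlus_swap (D := D) n.swap
    have hd := dPlus_swap (D := D) n.swap
    rw [Sum.swap_swap] at hb hd
    simp only [map_mul, map_add, map_neg, Complex.conj_I, _root_.map_ofNat, ← Complex.exp_conj,
      ← phase_conj, ← deriv_phase_conj, h.conj_eta, Sum.swap_swap, hb, hd,
      neg_neg, mul_neg, neg_mul]
    ring

/-- The symmetry relation solved for the first numerator. -/
theorem isSym_inv {m : ℕ} {R S : ℂ[X]} (hs : D.IsSym m R S) {z : ℂ} (hz : z ≠ 0) :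
    D.rho ^ m * R.eval z = D.symC' * z ^ (4 * N + 1 + 2 * m) * S.eval (D.rho / z) := by
  have h1 := hs (D.rho / z) (div_ne_zero h.rho_ne hz)
  have hr := h.rho_ne
  rw [div_div_cancel₀ hr, div_pow, pow_add D.rho, two_mul m, pow_add D.rho m m] at h1
  have h2 := h.symC_mul_symC'
  have hz' : z ^ (4 * N + 1 + 2 * m) ≠ 0 := pow_ne_zero _ hz
  rw [two_mul] at hz'
  rw [two_mul]
  have h3 : D.rho ^ m ≠ 0 := pow_ne_zero _ hr
  field_simp at h1
  linear_combination -D.rho ^ m * eval z R * h2 - D.symC' * h1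

theorem isSym_conj {m : ℕ} {R S : ℂ[X]} (hs : D.IsSym m R S) :
    D.IsSym m (-conjP S) (conjP R) := fun z hz => by
  have h1 := congrArg conj (h.isSym_inv hs ((_root_.map_ne_zero (starRingEnd ℂ)).2 hz))
  simp only [map_mul, map_pow, conj_rho, Complex.conj_conj, h.symC'_eq, map_neg] at h1
  rw [eval_neg, eval_conjP, eval_conjP, h1, map_div₀, conj_rho]
  ring

/-- For a row `(R, S)`, the polynomial `R R^* + S S^*` vanishes doubly at the discrete
spectrum. -/
theorem dvd_of_isRow {x t : ℝ} {R S : ℂ[X]} (hr : D.IsRow x t R S) :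
    D.polyEta * D.polyHat ∣ R * conjP R + S * conjP S := by
  have hhat : ∀ n, (X - C (D.etaHat n)) ^ 2 ∣ R * conjP R + S * conjP S := by
    intro n
    have h1 := hr.at_etaHat n
    have h2 := (h.isRow_conj hr).at_etaHat n
    rw [JetRel] at h1 h2
    convert dvd_add (h1.mul_right (conjP S)) (h2.mul_left R) using 1
    ring
  have heta : ∀ n, (X - C (D.eta n)) ^ 2 ∣ R * conjP R + S * conjP S := by
    intro n
    have h1 := hr.at_eta n
    have h2 := (h.isRow_conj hr).at_eta n
    rw [JetRel] at h1 h2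
    convert dvd_sub (h1.mul_right (conjP R)) (h2.mul_left S) using 1
    ring
  refine IsCoprime.mul_dvd ?_ (prod_sq_dvd h.eta_injective heta)
    (prod_sq_dvd h.etaHat_injective hhat)
  refine IsCoprime.prod_left fun i _ => IsCoprime.prod_right fun j _ => IsCoprime.pow ?_
  exact isCoprime_X_sub_C_of_isUnit_sub (sub_ne_zero.2 (h.eta_ne_etaHat i j)).isUnit

/-- A symmetric row that decays at infinity vanishes: by symmetry it vanishes also at `0`, and then
`R R^* + S S^*` has more zeros than its degree allows. -/
theorem isRow_unique {x t : ℝ} {R S : ℂ[X]} {m : ℕ} (hr : D.IsRow x t R S) (hs : D.IsSym m R S)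
    (hR : R.degree < ((4 * N + 1 + m : ℕ) : WithBot ℕ))
    (hS : S.degree < ((4 * N + 1 + m : ℕ) : WithBot ℕ)) : R = 0 ∧ S = 0 := by
  have hle : ∀ F : ℂ[X], F.degree < ((4 * N + 1 + m : ℕ) : WithBot ℕ) →
      F.natDegree ≤ 4 * N + m := by
    intro F hF
    by_cases h0 : F = 0
    · simp [h0]
    · have := (natDegree_lt_iff_degree_lt h0).2 hF
      omega
  have hrm : D.rho ^ m ≠ 0 := pow_ne_zero _ h.rho_ne
  -- the symmetry turns the decay at infinity into vanishing of order `m + 1` at `0`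
  have dR : X ^ (m + 1) ∣ R := by
    refine X_pow_dvd_of_eval_eq (κ := D.symC' / D.rho ^ m) (a := D.rho) (hle S hS) fun z hz => ?_
    have := h.isSym_inv hs hz
    have e : 4 * N + m + (m + 1) = 4 * N + 1 + 2 * m := by ring
    rw [e]
    field_simp
    linear_combination this
  have dS : X ^ (m + 1) ∣ S := by
    refine X_pow_dvd_of_eval_eq (κ := D.symC / D.rho ^ m) (a := D.rho) (hle R hR) fun z hz => ?_
    have := hs z hz
    have e : 4 * N + m + (m + 1) = 4 * N + 1 + 2 * m := by ring
    rw [e]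
    field_simp
    linear_combination this
  have hX : (conjP (X ^ (m + 1) : ℂ[X])) = X ^ (m + 1) := by simp [conjP]
  have dconj : ∀ F : ℂ[X], X ^ (m + 1) ∣ F → X ^ (2 * (m + 1)) ∣ F * conjP F := by
    rintro F ⟨G, rfl⟩
    rw [conjP_mul, hX, two_mul, pow_add]
    exact ⟨G * conjP G, by ring⟩
  have dH : X ^ (2 * (m + 1)) * (D.polyEta * D.polyHat) ∣ R * conjP R + S * conjP S := by
    refine IsCoprime.mul_dvd ?_ (dvd_add (dconj R dR) (dconj S dS)) (h.dvd_of_isRow hr)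
    refine IsCoprime.pow_left (IsCoprime.mul_right ?_ ?_)
    · refine IsCoprime.prod_right fun j _ => IsCoprime.pow_right ?_
      have := isCoprime_X_sub_C_of_isUnit_sub (sub_ne_zero.2 (h.eta_ne j).symm).isUnit
      simpa using this
    · refine IsCoprime.prod_right fun j _ => IsCoprime.pow_right ?_
      have := isCoprime_X_sub_C_of_isUnit_sub (sub_ne_zero.2 (h.etaHat_ne j).symm).isUnit
      simpa using this
  -- the divisor has degree `2 (m + 1) + 8 N`, the sum has degree at most `2 (4 N + m)`
  refine eq_zero_of_sum_conjP_eq_zero (by_contra fun hne => ?_)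
  have hd := natDegree_le_of_dvd dH hne
  have hle2 : (R * conjP R + S * conjP S).natDegree ≤ 2 * (4 * N + m) := by
    refine (natDegree_add_le _ _).trans (max_le ?_ ?_)
    · refine natDegree_mul_le.trans ?_
      rw [natDegree_conjP]
      linarith [hle R hR]
    · refine natDegree_mul_le.trans ?_
      rw [natDegree_conjP]
      linarith [hle S hS]
  rw [Monic.natDegree_mul (monic_X_pow _) (D.monic_polyEta.mul D.monic_polyHat),
    D.monic_polyEta.natDegree_mul D.monic_polyHat, natDegree_X_pow, natDegree_polyEta,
    natDegree_polyHat] at hd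
  omega

omit h in
/-- The derivative of the relation `R(z) = κ z ^ n S(a / z)`. -/
theorem eval_derivative_of_eval_eq {R S : ℂ[X]} {κ a : ℂ} {n : ℕ}
    (hRS : ∀ z : ℂ, z ≠ 0 → R.eval z = κ * z ^ n * S.eval (a / z)) {z : ℂ} (hz : z ≠ 0) :
    (derivative R).eval z = κ * (n * z ^ (n - 1)) * S.eval (a / z)
      + κ * z ^ n * ((derivative S).eval (a / z) * (-a / z ^ 2)) := by
  have h1 : HasDerivAt (fun w => a / w) (-a / z ^ 2) z := by
    simpa [div_eq_mul_inv, neg_mul, mul_neg] using (hasDerivAt_inv hz).const_mul a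
  have h2 := ((hasDerivAt_pow n z).const_mul κ).mul ((S.hasDerivAt (a / z)).comp z h1)
  refine (R.hasDerivAt z).unique (h2.congr_of_eventuallyEq ?_)
  filter_upwards [isOpen_ne.mem_nhds hz] with w hw
  exact hRS w hw

/-- For a symmetric row, the relations at the points `η̂_n` imply those at the points `η_n`. -/
theorem isRow_of_isSym {x t : ℝ} {R S : ℂ[X]} (hs : D.IsSym 0 R S)
    (hh : ∀ n, JetRel (D.etaHat n)
      (D.bPlus n * Complex.exp (2 * Complex.I * -phase D.q₀ D.ε x t (D.etaHat n)))
      (Complex.exp (2 * Complex.I * -phase D.q₀ D.ε x t (D.etaHat n)) *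
        (D.dPlus n + 2 * Complex.I * -deriv (phase D.q₀ D.ε x t) (D.etaHat n) * D.bPlus n))
      S R) : D.IsRow x t R S := by
  refine ⟨fun n => ?_, hh⟩
  have he := h.eta_ne n
  have s1 : ∀ z : ℂ, z ≠ 0 → R.eval z = D.symC' * z ^ (4 * N + 1) * S.eval (D.rho / z) :=
    fun z hz => by simpa using h.isSym_inv hs hz
  have s2 : ∀ z : ℂ, z ≠ 0 → S.eval z = D.symC * z ^ (4 * N + 1) * R.eval (D.rho / z) :=
    fun z hz => by simpa using hs z hz
  have s1' := eval_derivative_of_eval_eq s1 he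
  have s2' := eval_derivative_of_eval_eq s2 he
  have s1 := s1 _ he
  have s2 := s2 _ he
  rw [← etaHat_eq] at s1 s2 s1' s2'
  obtain ⟨j1, j2⟩ := (jetRel_iff _ _ _ _ _).1 (hh n)
  have p1 : phase D.q₀ D.ε x t (D.etaHat n) = -phase D.q₀ D.ε x t (D.eta n) := by
    rw [etaHat_eq, h.phase_inv x t he]
  have p2 : deriv (phase D.q₀ D.ε x t) (D.etaHat n)
      = D.eta n ^ 2 / D.rho * deriv (phase D.q₀ D.ε x t) (D.eta n) := by
    rw [etaHat_eq, h.deriv_phase_inv x t he]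
  rw [p1, neg_neg, p2, h.bPlus_eq, h.dPlus_eq] at j2
  rw [p1, neg_neg, h.bPlus_eq] at j1
  have hc := h.symC'_mul
  have hr : (D.q₀ : ℂ) ^ 2 = -D.rho := by rw [rho, neg_neg]
  have hrn := h.rho_ne
  rw [jetRel_iff]
  rw [hr] at j2
  set e := Complex.exp (2 * Complex.I * phase D.q₀ D.ε x t (D.eta n))
  set κ := D.qm / conj D.qp
  set θ' := deriv (phase D.q₀ D.ε x t) (D.eta n)
  set η := D.eta n
  constructor
  · rw [s1, s2, j1, ← hc]; ring
  · rw [s1', s2', s2, j1, j2, ← hc]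
    field_simp
    ring

/-- The determinant of the Jost matrix with first row `(P, Q)` is `γ`: both sides are monic of
degree `8 N + 2`, and the right side divides the left one. -/
theorem det_identity {x t : ℝ} {P Q : ℂ[X]} (hr : D.IsRow x t P Q) (hs : D.IsSym 0 P Q)
    (hP : P.Monic) (hPd : P.natDegree = 4 * N + 1) (hQ : Q.natDegree ≤ 4 * N) :
    P * conjP P + Q * conjP Q = (X ^ 2 + C ((D.q₀ : ℂ) ^ 2)) * (D.polyEta * D.polyHat) := by
  set a : ℂ := Complex.I * D.q₀ with ha
  have hq := h.q₀_ne
  have ha0 : a ≠ 0 := mul_ne_zero Complex.I_ne_zero hq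
  have ha2 : a * a = D.rho := by
    rw [ha, rho]; linear_combination (D.q₀ : ℂ) ^ 2 * Complex.I_mul_I
  -- the two branch points are the fixed points of `z ↦ ρ / z`
  have hfix : ∀ b : ℂ, b * b = D.rho → b ≠ 0 → (P * conjP P + Q * conjP Q).eval b = 0 := by
    intro b hb hb0
    have hb' : D.rho / b = b := by rw [← hb, mul_div_cancel_left₀ _ hb0]
    have e1 := hs b hb0
    have e2 := h.isSym_inv (h.isSym_conj hs) hb0
    rw [hb'] at e1 e2
    simp only [pow_zero, one_mul, mul_zero, add_zero] at e1 e2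
    rw [eval_neg] at e2
    have e3 := h.symC_mul_symC'
    rw [← hb, ← pow_two, ← pow_mul, mul_comm, pow_mul] at e3
    rw [eval_add, eval_mul, eval_mul, e1]
    have e4 : (conjP Q).eval b = -(D.symC' * b ^ (4 * N + 1) * (conjP P).eval b) := by
      rw [← e2, neg_neg]
    rw [e4]
    linear_combination -P.eval b * (conjP P).eval b * e3
  have hconja : -a ≠ a := by
    intro hne
    apply ha0
    linear_combination -(1 / 2 : ℂ) * hne
  have him : ∀ b : ℂ, b * b = D.rho → b ≠ 0 → ‖b‖ = D.q₀ := by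
    intro b hb _
    have := congrArg norm hb
    rw [norm_mul, rho, norm_neg, norm_pow, Complex.norm_real, Real.norm_of_nonneg h.q₀_pos.le]
      at this
    nlinarith [norm_nonneg b, h.q₀_pos]
  have hfac : (X ^ 2 + C ((D.q₀ : ℂ) ^ 2) : ℂ[X]) = (X - C a) * (X - C (-a)) := by
    have : C ((D.q₀ : ℂ) ^ 2) = -(C a * C a) := by
      rw [← C_mul, ha2, rho, ← C_neg, neg_neg]
    rw [this, C_neg]; ring
  have hnaa : -a * -a = D.rho := by rw [neg_mul_neg, ha2]
  have hcop : ∀ b : ℂ, b * b = D.rho → b ≠ 0 → IsCoprime (X - C b) (D.polyEta * D.polyHat) := by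
    intro b hb hb0
    have hn := him b hb hb0
    refine IsCoprime.mul_right ?_ ?_
    · refine IsCoprime.prod_right fun j _ => IsCoprime.pow_right ?_
      refine isCoprime_X_sub_C_of_isUnit_sub (sub_ne_zero.2 ?_).isUnit
      rintro rfl
      have := h.eta_mem j
      simp [Dminus, hn] at this
    · refine IsCoprime.prod_right fun j _ => IsCoprime.pow_right ?_
      refine isCoprime_X_sub_C_of_isUnit_sub (sub_ne_zero.2 ?_).isUnit
      rintro rfl
      have := h.etaHat_mem j
      simp [Dplus, hn] at this
  have hdvd : (X ^ 2 + C ((D.q₀ : ℂ) ^ 2)) * (D.polyEta * D.polyHat) ∣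
      P * conjP P + Q * conjP Q := by
    rw [hfac]
    refine IsCoprime.mul_dvd (IsCoprime.mul_left (hcop a ha2 ha0)
      (hcop (-a) hnaa (neg_ne_zero.2 ha0))) ?_ (h.dvd_of_isRow hr)
    refine IsCoprime.mul_dvd ?_ (dvd_iff_isRoot.2 (hfix a ha2 ha0))
      (dvd_iff_isRoot.2 (hfix (-a) hnaa (neg_ne_zero.2 ha0)))
    exact isCoprime_X_sub_C_of_isUnit_sub (sub_ne_zero.2 hconja.symm).isUnit
  have hPP : (P * conjP P).Monic := hP.mul (hP.map _)
  have hPPd : (P * conjP P).natDegree = 8 * N + 2 := by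
    rw [Monic.natDegree_mul (q := conjP P) hP (hP.map _), natDegree_conjP, hPd]; ring
  have hQQ : (Q * conjP Q).degree < (P * conjP P).degree := by
    rw [degree_eq_natDegree hPP.ne_zero, hPPd]
    refine lt_of_le_of_lt degree_le_natDegree ?_
    have : (Q * conjP Q).natDegree ≤ 8 * N := by
      refine natDegree_mul_le.trans ?_
      rw [natDegree_conjP]; omega
    exact_mod_cast (by omega : (Q * conjP Q).natDegree < 8 * N + 2)
  have hH : (P * conjP P + Q * conjP Q).Monic := hPP.add_of_left hQQ
  have hHd : (P * conjP P + Q * conjP Q).natDegree = 8 * N + 2 := by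
    rw [natDegree_add_eq_left_of_degree_lt hQQ, hPPd]
  have hm2 : (X ^ 2 + C ((D.q₀ : ℂ) ^ 2) : ℂ[X]).Monic := by
    rw [hfac]; exact (monic_X_sub_C _).mul (monic_X_sub_C _)
  have hm := hm2.mul (D.monic_polyEta.mul D.monic_polyHat)
  refine (eq_of_monic_of_dvd_of_natDegree_le hm hH hdvd ?_)
  rw [hHd, hm2.natDegree_mul (D.monic_polyEta.mul D.monic_polyHat),
    D.monic_polyEta.natDegree_mul D.monic_polyHat, natDegree_polyEta, natDegree_polyHat,
    natDegree_X_pow_add_C]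
  omega

/-- The derivative of a family of rows in a direction `(ξ, τ)` of the `(x, t)`-plane; `T` is
`z ^ m` times the rate of change of the phase in that direction. -/
theorem isRow_deriv {ξ τ : ℝ} {xs ts : ℝ → ℝ} {P Q : ℝ → ℂ[X]} {DP DQ T : ℂ[X]} {s : ℝ} {m : ℕ}
    (hr : ∀ r, D.IsRow (xs r) (ts r) (P r) (Q r))
    (hx : HasDerivAt xs ξ s) (ht : HasDerivAt ts τ s)
    (hP : HasPolyDerivAt P DP s) (hQ : HasPolyDerivAt Q DQ s)
    (hT : ∀ z : ℂ, z ≠ 0 → T.eval z = z ^ m * phase D.q₀ D.ε ξ τ z) :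
    D.IsRow (xs s) (ts s) (X ^ m * DP - C Complex.I * T * P s)
      (X ^ m * DQ + C Complex.I * T * Q s) := by
  have hph : ∀ z : ℂ, HasDerivAt (fun r => phase D.q₀ D.ε (xs r) (ts r) z)
      (phase D.q₀ D.ε ξ τ z) s := by
    intro z
    simp only [D.phase_eq (xs _) (ts _), D.phase_eq ξ τ]
    exact (hx.ofReal_comp.mul_const _).add (ht.ofReal_comp.mul_const _)
  have hdph : ∀ z : ℂ, z ≠ 0 → HasDerivAt (fun r => deriv (phase D.q₀ D.ε (xs r) (ts r)) z)
      (deriv (phase D.q₀ D.ε ξ τ) z) s := by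
    intro z hz
    simp only [D.deriv_phase_eq (xs _) (ts _) hz, D.deriv_phase_eq ξ τ hz]
    exact (hx.ofReal_comp.mul_const _).add (ht.ofReal_comp.mul_const _)
  have hT' : ∀ z : ℂ, z ≠ 0 → (derivative T).eval z = (derivative (X ^ m : ℂ[X])).eval z *
      phase D.q₀ D.ε ξ τ z + z ^ m * deriv (phase D.q₀ D.ε ξ τ) z := by
    intro z hz
    have h1 := ((X ^ m : ℂ[X]).hasDerivAt z).mul (D.differentiableAt_phase ξ τ hz).hasDerivAt
    have h2 := (T.hasDerivAt z).unique (h1.congr_of_eventuallyEq (by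
      filter_upwards [isOpen_ne.mem_nhds hz] with w hw
      rw [hT w hw]; simp))
    rw [h2]; simp
  constructor
  · intro n
    have hn := h.eta_ne n
    exact JetRel.hasDerivAt (β := D.bMinus n) (δ := D.dMinus n) (R := P) (S := Q)
      (σ₀ := fun r => phase D.q₀ D.ε (xs r) (ts r) (D.eta n))
      (σ₁ := fun r => deriv (phase D.q₀ D.ε (xs r) (ts r)) (D.eta n))
      (fun r => (hr r).at_eta n) hP hQ (hph _) (hdph _ hn) (hT _ hn) (hT' _ hn)
  · intro n
    have hn := h.etaHat_ne n
    have := JetRel.hasDerivAt (β := D.bPlus n) (δ := D.dPlus n) (R := Q) (S := P)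
      (σ₀ := fun r => -phase D.q₀ D.ε (xs r) (ts r) (D.etaHat n))
      (σ₁ := fun r => -deriv (phase D.q₀ D.ε (xs r) (ts r)) (D.etaHat n)) (T := -T) (m := m)
      (fun r => (hr r).at_etaHat n) hQ hP (hph _).neg
      (hdph _ hn).neg (by rw [eval_neg, hT _ hn]; ring)
      (by rw [derivative_neg, eval_neg, hT' _ hn]; ring)
    have e1 : X ^ m * DQ - C Complex.I * -T * Q s = X ^ m * DQ + C Complex.I * T * Q s := by ring
    have e2 : X ^ m * DP + C Complex.I * -T * P s = X ^ m * DP - C Complex.I * T * P s := by ring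
    rwa [e1, e2] at this

end Admissible

end Data
/-! ### Functions with a double zero -/

/-- The derivatives that enter the norming constants `A₊`, `B₊`, at a double zero of
`f = (z - a)² u`. -/
theorem iteratedDeriv_of_sq_mul {f u : ℂ → ℂ} {a : ℂ} (hu : AnalyticAt ℂ u a)
    (hf : f =ᶠ[𝓝 a] fun z => (z - a) ^ 2 * u z) :
    AnalyticAt ℂ f a ∧ f a = 0 ∧ deriv f a = 0 ∧ iteratedDeriv 2 f a = 2 * u a ∧
      iteratedDeriv 3 f a = 6 * deriv u a := by
  have hp : ∀ n : ℕ, ContDiffAt ℂ n (fun z : ℂ => (z - a) ^ 2) a := fun n => by fun_prop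
  have hp1 : deriv (fun z : ℂ => (z - a) ^ 2) = fun z => 2 * (z - a) := by
    ext z
    simp
  have hp2 : deriv (fun z : ℂ => 2 * (z - a)) = fun _ => 2 := by
    ext z
    simp
  have hp3 : deriv (fun _ : ℂ => (2 : ℂ)) = fun _ => 0 := by ext z; simp
  have h0 : f a = 0 := by rw [hf.eq_of_nhds]; simp
  refine ⟨?_, h0, ?_, ?_, ?_⟩
  · exact (((analyticAt_id.sub analyticAt_const).pow 2).mul hu).congr hf.symm
  · rw [hf.deriv_eq, deriv_fun_mul (by fun_prop) hu.differentiableAt, hp1]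
    simp
  · rw [hf.iteratedDeriv_eq, iteratedDeriv_fun_mul (hp 2) hu.contDiffAt]
    simp only [Finset.sum_range_succ, Finset.sum_range_zero, iteratedDeriv_succ,
      iteratedDeriv_zero, hp1, hp2]
    simp
  · rw [hf.iteratedDeriv_eq, iteratedDeriv_fun_mul (hp 3) hu.contDiffAt]
    simp only [Finset.sum_range_succ, Finset.sum_range_zero, iteratedDeriv_succ,
      iteratedDeriv_zero, hp1, hp2, hp3]
    norm_num [Nat.choose]

theorem HasPolyDerivAt.const_add_sum_smul {ι : Type*} [Fintype ι] {B₀ : ℂ[X]} {B : ι → ℂ[X]}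
    {c : ℝ → ι → ℂ} {c' : ι → ℂ} {s : ℝ} (hc : ∀ i, HasDerivAt (fun r => c r i) (c' i) s) :
    HasPolyDerivAt (fun r => B₀ + ∑ i, c r i • B i) (∑ i, c' i • B i) s := fun L => by
  simp only [map_add, map_sum, map_smul, smul_eq_mul]
  refine HasDerivAt.const_add _ (HasDerivAt.fun_sum fun i _ => (hc i).mul_const _)

namespace Data

variable {N : ℕ} (D : Data N)

/-! ### The linear system and the numerators of the Jost row -/

/-- `∏_{m ≠ n} (z - η̂_m)²`. -/
noncomputable def cofHat (n : Fin N ⊕ Fin N) : ℂ[X] :=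
  ∏ m ∈ Finset.univ.erase n, (X - C (D.etaHat m)) ^ 2

theorem polyHat_eq (n) : D.polyHat = (X - C (D.etaHat n)) ^ 2 * D.cofHat n := by
  rw [polyHat, cofHat, Finset.mul_prod_erase _ (fun m => (X - C (D.etaHat m)) ^ 2)
    (Finset.mem_univ n)]

theorem sq_dvd_cofHat {n m : Fin N ⊕ Fin N} (hnm : n ≠ m) :
    (X - C (D.etaHat m)) ^ 2 ∣ D.cofHat n :=
  Finset.dvd_prod_of_mem (fun m => (X - C (D.etaHat m)) ^ 2)
    (Finset.mem_erase.2 ⟨hnm.symm, Finset.mem_univ _⟩)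

/-- The numerators, over the common denominator `z ∏ (z - η̂_n)²`, of the partial fractions
`1 / (z - η̂_n)²` and `1 / (z - η̂_n)`. -/
noncomputable def fracBasis : (Fin N ⊕ Fin N) ⊕ (Fin N ⊕ Fin N) → ℂ[X] :=
  Sum.elim (fun n => X * D.cofHat n) fun n => X * D.cofHat n * (X - C (D.etaHat n))

/-- The numerator of `-i q₋ w / z + ∑ (α_n / (z - η̂_n)² + β_n / (z - η̂_n))`. -/
noncomputable def sndNum (w : ℂ) (c : (Fin N ⊕ Fin N) ⊕ (Fin N ⊕ Fin N) → ℂ) : ℂ[X] :=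
  C (-(Complex.I * D.qm * w)) * D.polyHat + ∑ i, c i • D.fracBasis i

/-- The numerator of the first entry of a symmetric row whose second entry has numerator `S`. -/
noncomputable def fstNum (S : ℂ[X]) : ℂ[X] := D.symC' • invert D.rho (4 * N + 1) S

/-- `A₊[η̂_n] e^{-2iθ(η̂_n)}`. -/
noncomputable def expo (x t : ℝ) (n : Fin N ⊕ Fin N) : ℂ :=
  D.Aplus n * Complex.exp (-(2 * Complex.I * phase D.q₀ D.ε x t (D.etaHat n)))

/-- The coefficients of the partial fractions, in terms of the values `v (inl n)` and the
derivatives `v (inr n)` of the first entry of the row at `η̂_n`. -/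
noncomputable def coefOf (x t : ℝ) (v : (Fin N ⊕ Fin N) ⊕ (Fin N ⊕ Fin N) → ℂ) :
    (Fin N ⊕ Fin N) ⊕ (Fin N ⊕ Fin N) → ℂ :=
  Sum.elim (fun n => D.expo x t n * v (Sum.inl n))
    fun n => D.expo x t n * (D.deltaPlus x t n * v (Sum.inl n) + v (Sum.inr n))

/-- The value at `z` of `-i q₋ w / z + ∑ (α_n / (z - η̂_n)² + β_n / (z - η̂_n))`. -/
noncomputable def sndVal (w : ℂ) (c : (Fin N ⊕ Fin N) ⊕ (Fin N ⊕ Fin N) → ℂ) (z : ℂ) : ℂ :=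
  -(Complex.I * D.qm * w) / z + ∑ n, (c (Sum.inl n) / (z - D.etaHat n) ^ 2
    + c (Sum.inr n) / (z - D.etaHat n))

variable {D}

theorem eval_sndNum {w : ℂ} {c : (Fin N ⊕ Fin N) ⊕ (Fin N ⊕ Fin N) → ℂ} {z : ℂ} (hz : z ≠ 0)
    (hz' : ∀ n, z ≠ D.etaHat n) :
    (D.sndNum w c).eval z = z * D.polyHat.eval z * D.sndVal w c z := by
  rw [sndNum, sndVal, Fintype.sum_sum_type, eval_add, eval_mul, eval_C, eval_add,
    eval_finsetSum, eval_finsetSum, Finset.sum_add_distrib, mul_add, mul_add, Finset.mul_sum,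
    Finset.mul_sum]
  have hn : ∀ n, z - D.etaHat n ≠ 0 := fun n => sub_ne_zero.2 (hz' n)
  congr 1
  · field_simp
  · congr 1
    · refine Finset.sum_congr rfl fun n _ => ?_
      have := hn n
      rw [D.polyHat_eq n]
      simp only [fracBasis, Sum.elim_inl, eval_smul, eval_mul, eval_X, eval_pow, eval_sub, eval_C,
        smul_eq_mul]
      field_simp
    · refine Finset.sum_congr rfl fun n _ => ?_
      have := hn n
      rw [D.polyHat_eq n]
      simp only [fracBasis, Sum.elim_inr, eval_smul, eval_mul, eval_X, eval_pow, eval_sub, eval_C,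
        smul_eq_mul]
      field_simp

theorem hasDerivAt_sndVal {w : ℂ} {c : (Fin N ⊕ Fin N) ⊕ (Fin N ⊕ Fin N) → ℂ} {z : ℂ}
    (hz : z ≠ 0) (hz' : ∀ n, z ≠ D.etaHat n) :
    HasDerivAt (D.sndVal w c) (Complex.I * D.qm * w / z ^ 2 -
      ∑ n, (2 * c (Sum.inl n) / (z - D.etaHat n) ^ 3
        + c (Sum.inr n) / (z - D.etaHat n) ^ 2)) z := by
  have hn : ∀ n, z - D.etaHat n ≠ 0 := fun n => sub_ne_zero.2 (hz' n)
  have h1 : HasDerivAt (fun z => -(Complex.I * D.qm * w) / z) (Complex.I * D.qm * w / z ^ 2) z := by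
    have := (hasDerivAt_inv hz).const_mul (-(Complex.I * D.qm * w))
    simpa [div_eq_mul_inv] using this
  have h2 : ∀ n ∈ (Finset.univ : Finset (Fin N ⊕ Fin N)),
      HasDerivAt (fun z => c (Sum.inl n) / (z - D.etaHat n) ^ 2
        + c (Sum.inr n) / (z - D.etaHat n))
      (-(2 * c (Sum.inl n) / (z - D.etaHat n) ^ 3
        + c (Sum.inr n) / (z - D.etaHat n) ^ 2)) z := by
    intro n _
    have hs := (hasDerivAt_id z).sub_const (D.etaHat n)
    have h3 := ((hs.pow 2).inv (pow_ne_zero 2 (hn n))).const_mul (c (Sum.inl n))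
    have h4 := (hs.inv (hn n)).const_mul (c (Sum.inr n))
    have h5 := h3.add h4
    simp only [id] at h5
    refine h5.congr_deriv ?_
    have := hn n
    simp
    field_simp
    ring
  have := h1.add (HasDerivAt.fun_sum h2)
  rw [Finset.sum_neg_distrib, ← sub_eq_add_neg] at this
  exact this

/-- The first block row of the linear system prescribes the value at `η_k` of the second entry of
the row in terms of `v`. -/
theorem mulVec_G_inl (x t : ℝ) (v : (Fin N ⊕ Fin N) ⊕ (Fin N ⊕ Fin N) → ℂ) (k) :
    (D.G x t *ᵥ v) (Sum.inl k) =
      (∑ n, (D.coefOf x t v (Sum.inl n) / (D.eta k - D.etaHat n) ^ 2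
        + D.coefOf x t v (Sum.inr n) / (D.eta k - D.etaHat n)))
      + Complex.I * D.qm / D.eta k * v (Sum.inl k) := by
  have e : ∀ a : Fin N ⊕ Fin N → ℂ, (∑ n, (if k = n then Complex.I * D.qm / D.eta k else 0) * a n)
      = Complex.I * D.qm / D.eta k * a k := by
    intro a; simp
  rw [mulVec, dotProduct, Fintype.sum_sum_type]
  simp only [G, fromBlocks_apply₁₁, fromBlocks_apply₁₂, G11, G12, of_apply]
  rw [← e fun n => v (Sum.inl n), ← Finset.sum_add_distrib, ← Finset.sum_add_distrib]
  refine Finset.sum_congr rfl fun n _ => ?_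
  simp only [coefOf, Sum.elim_inl, Sum.elim_inr, nablaPlus, expo]
  generalize D.eta k - D.etaHat n = y
  ring

/-- The second block row of the linear system prescribes the derivative at `η_k` of the second
entry of the row in terms of `v`. -/
theorem mulVec_G_inr (x t : ℝ) (v : (Fin N ⊕ Fin N) ⊕ (Fin N ⊕ Fin N) → ℂ) (k) :
    (D.G x t *ᵥ v) (Sum.inr k) =
      (∑ n, (2 * D.coefOf x t v (Sum.inl n) / (D.eta k - D.etaHat n) ^ 3
        + D.coefOf x t v (Sum.inr n) / (D.eta k - D.etaHat n) ^ 2))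
      + Complex.I * D.qm / D.eta k ^ 2 * v (Sum.inl k)
      - Complex.I * D.qm * (D.q₀ : ℂ) ^ 2 / D.eta k ^ 3 * v (Sum.inr k) := by
  have e : ∀ (a : Fin N ⊕ Fin N → ℂ) (r : ℂ), (∑ n, (if k = n then r else 0) * a n)
      = r * a k := by
    intro a r; simp
  rw [mulVec, dotProduct, Fintype.sum_sum_type]
  simp only [G, fromBlocks_apply₂₁, fromBlocks_apply₂₂, G21, G22, of_apply]
  rw [← e fun n => v (Sum.inl n), ← e fun n => v (Sum.inr n), ← Finset.sum_add_distrib,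
    ← Finset.sum_add_distrib, ← Finset.sum_sub_distrib]
  refine Finset.sum_congr rfl fun n _ => ?_
  simp only [coefOf, Sum.elim_inl, Sum.elim_inr, nablaPlus, expo]
  generalize D.eta k - D.etaHat n = y
  ring

theorem natDegree_cofHat (n) : (D.cofHat n).natDegree + 2 = 4 * N := by
  have := congrArg natDegree (D.polyHat_eq n)
  have hm : (D.cofHat n).Monic := monic_prod_of_monic _ _ fun _ _ => (monic_X_sub_C _).pow 2
  rw [natDegree_polyHat, ((monic_X_sub_C _).pow 2).natDegree_mul hm] at this
  rw [this]; simp; ring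

theorem monic_cofHat (n) : (D.cofHat n).Monic :=
  monic_prod_of_monic _ _ fun _ _ => (monic_X_sub_C _).pow 2

theorem natDegree_fracBasis_le (i) : (D.fracBasis i).natDegree ≤ 4 * N := by
  rcases i with n | n
  · have := D.natDegree_cofHat n
    simp only [fracBasis, Sum.elim_inl]
    rw [monic_X.natDegree_mul (D.monic_cofHat n), natDegree_X]
    omega
  · have := D.natDegree_cofHat n
    simp only [fracBasis, Sum.elim_inr]
    rw [(monic_X.mul (D.monic_cofHat n)).natDegree_mul (monic_X_sub_C _),
      monic_X.natDegree_mul (D.monic_cofHat n), natDegree_X, natDegree_X_sub_C]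
    omega

theorem coeff_fracBasis_inl (n) : (D.fracBasis (Sum.inl n)).coeff (4 * N) = 0 := by
  refine coeff_eq_zero_of_natDegree_lt ?_
  have := D.natDegree_cofHat n
  simp only [fracBasis, Sum.elim_inl]
  rw [monic_X.natDegree_mul (D.monic_cofHat n), natDegree_X]
  omega

theorem coeff_fracBasis_inr (n) : (D.fracBasis (Sum.inr n)).coeff (4 * N) = 1 := by
  have hm : (D.fracBasis (Sum.inr n)).Monic := by
    simp only [fracBasis, Sum.elim_inr]
    exact (monic_X.mul (D.monic_cofHat n)).mul (monic_X_sub_C _)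
  have hd : (D.fracBasis (Sum.inr n)).natDegree = 4 * N := by
    have := D.natDegree_cofHat n
    simp only [fracBasis, Sum.elim_inr]
    rw [(monic_X.mul (D.monic_cofHat n)).natDegree_mul (monic_X_sub_C _),
      monic_X.natDegree_mul (D.monic_cofHat n), natDegree_X, natDegree_X_sub_C]
    omega
  rw [← hd]; exact hm

theorem eval_zero_fracBasis (i) : (D.fracBasis i).eval 0 = 0 := by
  rcases i with n | n <;> simp [fracBasis]

theorem natDegree_sndNum_le (w : ℂ) (c) : (D.sndNum w c).natDegree ≤ 4 * N := by
  refine (natDegree_add_le _ _).trans (max_le ?_ ?_)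
  · exact (natDegree_C_mul_le _ _).trans D.natDegree_polyHat.le
  · refine natDegree_sum_le_of_forall_le _ _ fun i _ => ?_
    exact (natDegree_smul_le _ _).trans (D.natDegree_fracBasis_le i)

theorem coeff_sndNum (w : ℂ) (c) : (D.sndNum w c).coeff (4 * N)
    = -(Complex.I * D.qm * w) + ∑ n, c (Sum.inr n) := by
  have hm : D.polyHat.coeff (4 * N) = 1 := by
    rw [← D.natDegree_polyHat]; exact D.monic_polyHat
  rw [sndNum, coeff_add, coeff_C_mul, hm, Fintype.sum_sum_type, coeff_add, finsetSum_coeff,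
    finsetSum_coeff]
  simp [coeff_fracBasis_inl, coeff_fracBasis_inr]

theorem eval_zero_sndNum (w : ℂ) (c) :
    (D.sndNum w c).eval 0 = -(Complex.I * D.qm * w) * D.prodHat ^ 2 := by
  simp [sndNum, eval_finsetSum, eval_zero_fracBasis, eval_polyHat_zero]

theorem natDegree_fstNum_le (S : ℂ[X]) : (D.fstNum S).natDegree ≤ 4 * N + 1 :=
  (natDegree_smul_le _ _).trans (natDegree_invert_le _ _ _)

theorem coeff_fstNum (S : ℂ[X]) : (D.fstNum S).coeff (4 * N + 1) = D.symC' * S.eval 0 := by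
  have := coeff_invert (a := D.rho) (R := S) (Nat.zero_le (4 * N + 1))
  rw [Nat.sub_zero] at this
  rw [fstNum, coeff_smul, this, ← coeff_zero_eq_eval_zero]
  simp

theorem eval_fstNum {S : ℂ[X]} (hS : S.natDegree ≤ 4 * N) {z : ℂ} (hz : z ≠ 0) :
    (D.fstNum S).eval z = D.symC' * z ^ (4 * N + 1) * S.eval (D.rho / z) := by
  rw [fstNum, eval_smul, eval_invert (by omega) hz, smul_eq_mul, mul_assoc]

namespace Admissible

variable (h : D.Admissible)
include h

theorem isSym_fstNum {S : ℂ[X]} (hS : S.natDegree ≤ 4 * N) : D.IsSym 0 (D.fstNum S) S := by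
  intro z hz
  have hr := h.rho_ne
  rw [eval_fstNum hS (div_ne_zero hr hz), div_div_cancel₀ hr, div_pow]
  have h1 := h.symC_mul_symC'
  have hz' : z ^ (4 * N + 1) ≠ 0 := pow_ne_zero _ hz
  rw [mul_zero, add_zero, pow_zero, one_mul]
  field_simp
  linear_combination -S.eval z * h1

/-- Near `η̂_k` one has `s₂₂(z) = (z - η̂_k)² u(z)` with `u = cofHat k / polyEta`. -/
theorem s22_expansion (k) : AnalyticAt ℂ D.s22 (D.etaHat k) ∧ D.s22 (D.etaHat k) = 0 ∧
    deriv D.s22 (D.etaHat k) = 0 ∧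
    iteratedDeriv 2 D.s22 (D.etaHat k)
      = 2 * ((D.cofHat k).eval (D.etaHat k) / D.polyEta.eval (D.etaHat k)) ∧
    iteratedDeriv 3 D.s22 (D.etaHat k)
      = 6 * (((derivative (D.cofHat k)).eval (D.etaHat k) * D.polyEta.eval (D.etaHat k) -
          (D.cofHat k).eval (D.etaHat k) * (derivative D.polyEta).eval (D.etaHat k))
          / D.polyEta.eval (D.etaHat k) ^ 2) := by
  have hne := D.eval_polyEta_ne fun n => (h.eta_ne_etaHat n k).symm
  have hd := ((D.cofHat k).hasDerivAt (D.etaHat k)).div (D.polyEta.hasDerivAt (D.etaHat k)) hne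
  have hu : AnalyticAt ℂ (fun z => (D.cofHat k).eval z / D.polyEta.eval z) (D.etaHat k) := by
    refine AnalyticAt.div ?_ ?_ hne
    · simpa using (analyticAt_id (𝕜 := ℂ) (z := D.etaHat k)).aeval_polynomial (D.cofHat k)
    · simpa using (analyticAt_id (𝕜 := ℂ) (z := D.etaHat k)).aeval_polynomial D.polyEta
  have := iteratedDeriv_of_sq_mul (f := D.s22) hu (Eventually.of_forall fun z => by
    rw [h.s22_eq, D.polyHat_eq k]
    simp only [eval_mul, eval_pow, eval_sub, eval_X, eval_C]
    ring)
  rw [show deriv (fun z => (D.cofHat k).eval z / D.polyEta.eval z) (D.etaHat k) = _ from hd.deriv]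
    at this
  exact this

theorem eval_cofHat_ne (k) : (D.cofHat k).eval (D.etaHat k) ≠ 0 := by
  rw [cofHat, eval_prod]
  refine Finset.prod_ne_zero_iff.2 fun n hn => ?_
  rw [eval_pow, eval_sub, eval_X, eval_C]
  exact pow_ne_zero _ (sub_ne_zero.2 fun he => (Finset.mem_erase.1 hn).1 (h.etaHat_injective he.symm))

/-- If `v` solves the linear system, then `v (inl k)` and `v (inr k)` are the value and the
derivative at `η̂_k` of the first entry of the row. -/
theorem fstNum_jet {x t : ℝ} {w : ℂ} {v : (Fin N ⊕ Fin N) ⊕ (Fin N ⊕ Fin N) → ℂ}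
    (hv : D.G x t *ᵥ v = w • D.nuVec) (k) :
    (D.fstNum (D.sndNum w (D.coefOf x t v))).eval (D.etaHat k)
      = D.polyEta.eval (D.etaHat k) * (D.etaHat k * v (Sum.inl k)) ∧
    (derivative (D.fstNum (D.sndNum w (D.coefOf x t v)))).eval (D.etaHat k)
      = (derivative D.polyEta).eval (D.etaHat k) * (D.etaHat k * v (Sum.inl k))
        + D.polyEta.eval (D.etaHat k) * (v (Sum.inl k) + D.etaHat k * v (Sum.inr k)) := by
  set c := D.coefOf x t v with hc
  have he := h.eta_ne k
  have hh := h.etaHat_ne k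
  have hr := h.rho_ne
  have hq := h.qm_ne
  have e0 := congrFun hv (Sum.inl k)
  have e1 := congrFun hv (Sum.inr k)
  rw [mulVec_G_inl, ← hc] at e0
  rw [mulVec_G_inr, ← hc] at e1
  simp only [Pi.smul_apply, smul_eq_mul, nuVec, Sum.elim_inl, Sum.elim_inr] at e0 e1
  have hne : ∀ n, D.eta k ≠ D.etaHat n := fun n => h.eta_ne_etaHat k n
  have f0 : D.sndVal w c (D.eta k) = -(Complex.I * D.qm / D.eta k) * v (Sum.inl k) := by
    rw [sndVal]
    linear_combination e0
  have f1 : HasDerivAt (D.sndVal w c) (Complex.I * D.qm / D.eta k ^ 2 * v (Sum.inl k)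
      - Complex.I * D.qm * (D.q₀ : ℂ) ^ 2 / D.eta k ^ 3 * v (Sum.inr k)) (D.eta k) := by
    refine (hasDerivAt_sndVal he hne).congr_deriv ?_
    linear_combination -e1
  have hP : ∀ᶠ z in 𝓝 (D.etaHat k), (D.fstNum (D.sndNum w c)).eval z
      = D.polyEta.eval z * (Complex.I * D.rho / D.qm * D.sndVal w c (D.rho / z)) := by
    have hcont : Tendsto (fun z => D.rho / z) (𝓝 (D.etaHat k)) (𝓝 (D.eta k)) := by
      rw [h.eta_eq]
      exact tendsto_const_nhds.div tendsto_id hh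
    have hev : ∀ᶠ z in 𝓝 (D.etaHat k), ∀ n, D.rho / z ≠ D.etaHat n :=
      eventually_all.2 fun n => hcont.eventually (isOpen_ne.mem_nhds (hne n))
    filter_upwards [hev, isOpen_ne.mem_nhds hh] with z hz hz0
    have hz0 : z ≠ 0 := hz0
    rw [eval_fstNum (natDegree_sndNum_le _ _) hz0, eval_sndNum (div_ne_zero hr hz0) hz]
    have e2 := h.eval_polyHat_inv hz0
    have e3 : D.symC' * D.prodHat ^ 2 = Complex.I / D.qm := by
      rw [symC']
      have := h.prodHat_ne
      field_simp
    rw [pow_succ]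
    field_simp
    have e4 : D.symC' * D.prodHat ^ 2 * D.qm = Complex.I := by rw [e3]; field_simp
    linear_combination D.symC' * D.sndVal w c (D.rho / z) * D.qm * e2
      + D.polyEta.eval z * D.sndVal w c (D.rho / z) * e4
  have h1 : HasDerivAt (fun w => D.rho / w) (-D.rho / D.etaHat k ^ 2) (D.etaHat k) := by
    simpa [div_eq_mul_inv, neg_mul, mul_neg] using (hasDerivAt_inv hh).const_mul D.rho
  have hee : D.rho / D.etaHat k = D.eta k := (h.eta_eq k).symm
  have hq2 : (D.q₀ : ℂ) ^ 2 = -D.rho := by rw [rho, neg_neg]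
  constructor
  · rw [hP.self_of_nhds, hee, f0, etaHat_eq]
    field_simp
    rw [Complex.I_sq]; ring
  · rw [← hee] at f1
    have h2 := (D.polyEta.hasDerivAt (D.etaHat k)).mul
      ((f1.comp (D.etaHat k) h1).const_mul (Complex.I * D.rho / D.qm))
    have h3 := ((D.fstNum (D.sndNum w c)).hasDerivAt (D.etaHat k)).unique
      (h2.congr_of_eventuallyEq hP)
    rw [h3]
    simp only [Function.comp, hee, f0, hq2]
    rw [etaHat_eq]
    field_simp
    rw [Complex.I_sq]; ring

/-- A solution of the linear system yields a row of the Jost matrix. -/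
theorem isRow_of_mulVec {x t : ℝ} {w : ℂ} {v : (Fin N ⊕ Fin N) ⊕ (Fin N ⊕ Fin N) → ℂ}
    (hv : D.G x t *ᵥ v = w • D.nuVec) :
    D.IsRow x t (D.fstNum (D.sndNum w (D.coefOf x t v))) (D.sndNum w (D.coefOf x t v)) := by
  refine h.isRow_of_isSym (h.isSym_fstNum (natDegree_sndNum_le _ _)) fun k => ?_
  obtain ⟨j0, j1⟩ := h.fstNum_jet hv k
  set c := D.coefOf x t v with hc
  have hd : (X - C (D.etaHat k)) ^ 2 ∣ D.sndNum w c - X * D.cofHat k *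
      (C (c (Sum.inl k)) + C (c (Sum.inr k)) * (X - C (D.etaHat k))) := by
    rw [sndNum, Fintype.sum_sum_type, ← Finset.sum_add_distrib,
      ← Finset.add_sum_erase _ _ (Finset.mem_univ k)]
    have e : c (Sum.inl k) • D.fracBasis (Sum.inl k) + c (Sum.inr k) • D.fracBasis (Sum.inr k)
      = X * D.cofHat k * (C (c (Sum.inl k)) + C (c (Sum.inr k)) * (X - C (D.etaHat k))) := by
      simp only [fracBasis, Sum.elim_inl, Sum.elim_inr, smul_eq_C_mul]
      ring
    rw [e, add_left_comm, add_sub_cancel_left]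
    refine dvd_add (Dvd.dvd.mul_left ⟨_, D.polyHat_eq k⟩ _) (Finset.dvd_sum fun n hn => ?_)
    have hnk := D.sq_dvd_cofHat (Finset.mem_erase.1 hn).1
    refine dvd_add ?_ ?_
    · simp only [fracBasis, Sum.elim_inl, smul_eq_C_mul]
      exact Dvd.dvd.mul_left (Dvd.dvd.mul_left hnk _) _
    · simp only [fracBasis, Sum.elim_inr, smul_eq_C_mul]
      exact Dvd.dvd.mul_left (Dvd.dvd.mul_right (Dvd.dvd.mul_left hnk _) _) _
  obtain ⟨d0, d1⟩ := (sq_dvd_iff_eval _ _).1 hd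
  simp only [derivative_sub, derivative_add, derivative_mul, derivative_X, derivative_C, eval_sub,
    eval_add, eval_mul, eval_X, eval_C, sub_self, mul_zero, add_zero,
    zero_mul, zero_add, mul_one, one_mul, sub_zero] at d0 d1
  obtain ⟨-, -, -, s2, s3⟩ := h.s22_expansion k
  have hne := D.eval_polyEta_ne fun n => (h.eta_ne_etaHat n k).symm
  have hcf := h.eval_cofHat_ne k
  have hb := h.bPlus_ne k
  have ca : c (Sum.inl k) = D.bPlus k * D.polyEta.eval (D.etaHat k) / (D.cofHat k).eval (D.etaHat k)
      * Complex.exp (-(2 * Complex.I * phase D.q₀ D.ε x t (D.etaHat k))) * v (Sum.inl k) := by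
    simp only [hc, coefOf, Sum.elim_inl, expo, Aplus, s2]
    field_simp
  have cb : c (Sum.inr k) = D.bPlus k * D.polyEta.eval (D.etaHat k) / (D.cofHat k).eval (D.etaHat k)
      * Complex.exp (-(2 * Complex.I * phase D.q₀ D.ε x t (D.etaHat k))) *
      ((D.dPlus k / D.bPlus k
        - ((derivative (D.cofHat k)).eval (D.etaHat k) * D.polyEta.eval (D.etaHat k) -
          (D.cofHat k).eval (D.etaHat k) * (derivative D.polyEta).eval (D.etaHat k))
          / (D.polyEta.eval (D.etaHat k) * (D.cofHat k).eval (D.etaHat k))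
        - 2 * Complex.I * deriv (phase D.q₀ D.ε x t) (D.etaHat k)) * v (Sum.inl k)
        + v (Sum.inr k)) := by
    simp only [hc, coefOf, Sum.elim_inr, expo, Aplus, deltaPlus, Bplus, s2, s3]
    field_simp
    ring
  rw [jetRel_iff, j0, j1]
  have e2 : 2 * Complex.I * -phase D.q₀ D.ε x t (D.etaHat k)
    = -(2 * Complex.I * phase D.q₀ D.ε x t (D.etaHat k)) := by ring
  rw [e2]
  set E := Complex.exp (-(2 * Complex.I * phase D.q₀ D.ε x t (D.etaHat k)))
  constructor
  · rw [sub_eq_zero.1 d0, ca]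
    field_simp
  · rw [sub_eq_zero.1 d1, ca, cb]
    field_simp
    ring

/-- A null vector of the linear system yields a symmetric row that decays at infinity, which
vanishes; so does then the vector. -/
theorem det_G_ne (x t : ℝ) : (D.G x t).det ≠ 0 := by
  intro h0
  obtain ⟨v, hv0, hv⟩ := exists_mulVec_eq_zero_iff.2 h0
  have hv' : D.G x t *ᵥ v = (0 : ℂ) • D.nuVec := by rw [hv, zero_smul]
  have hQ := D.natDegree_sndNum_le 0 (D.coefOf x t v)
  have hP : (D.fstNum (D.sndNum 0 (D.coefOf x t v))).degree
      < ((4 * N + 1 + 0 : ℕ) : WithBot ℕ) := by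
    refine lt_of_le_of_ne (degree_le_of_natDegree_le (natDegree_fstNum_le _)) fun he => ?_
    have h1 : (D.fstNum (D.sndNum 0 (D.coefOf x t v))).coeff (4 * N + 1) = 0 := by
      rw [coeff_fstNum, eval_zero_sndNum]; simp
    have h2 : D.fstNum (D.sndNum 0 (D.coefOf x t v)) ≠ 0 := by
      intro hz
      rw [hz, degree_zero] at he
      exact WithBot.natCast_ne_bot _ he.symm
    have h3 := natDegree_eq_of_degree_eq_some he
    apply h2
    rw [← leadingCoeff_eq_zero, leadingCoeff, h3]
    exact h1
  -- `w = 0` removes the leading coefficient of the first numerator, so uniqueness applies with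
  -- `m = 0`
  obtain ⟨u1, u2⟩ := h.isRow_unique (h.isRow_of_mulVec hv') (h.isSym_fstNum hQ) hP
    (lt_of_le_of_lt (degree_le_of_natDegree_le hQ) (by exact_mod_cast (by omega)))
  apply hv0
  have hX : ∀ k, v (Sum.inl k) = 0 := by
    intro k
    have hne := D.eval_polyEta_ne fun n => (h.eta_ne_etaHat n k).symm
    have := (h.fstNum_jet hv' k).1
    rw [u1, eval_zero] at this
    simpa [hne, h.etaHat_ne k] using this.symm
  funext i
  rcases i with k | k
  · exact hX k
  · have hne := D.eval_polyEta_ne fun n => (h.eta_ne_etaHat n k).symm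
    have := (h.fstNum_jet hv' k).2
    rw [u1, hX k] at this
    simpa [hne, h.etaHat_ne k] using this.symm

end Admissible

variable (D)

/-- The solution of the linear system. -/
noncomputable def sol (x t : ℝ) : (Fin N ⊕ Fin N) ⊕ (Fin N ⊕ Fin N) → ℂ :=
  (D.G x t)⁻¹ *ᵥ D.nuVec

/-- The numerator of the second entry of the first row of the Jost matrix. -/
noncomputable def numQ (x t : ℝ) : ℂ[X] := D.sndNum 1 (D.coefOf x t (D.sol x t))

/-- The numerator of the first entry of the first row of the Jost matrix. -/
noncomputable def numP (x t : ℝ) : ℂ[X] := D.fstNum (D.numQ x t)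

namespace Admissible

variable {D} (h : D.Admissible)
include h

theorem G_mulVec_sol (x t : ℝ) : D.G x t *ᵥ D.sol x t = (1 : ℂ) • D.nuVec := by
  rw [sol, mulVec_mulVec, mul_nonsing_inv _ (h.det_G_ne x t).isUnit, one_mulVec, one_smul]

theorem isRow_num (x t : ℝ) : D.IsRow x t (D.numP x t) (D.numQ x t) :=
  h.isRow_of_mulVec (h.G_mulVec_sol x t)

theorem isSym_num (x t : ℝ) : D.IsSym 0 (D.numP x t) (D.numQ x t) :=
  h.isSym_fstNum (natDegree_sndNum_le _ _)

omit h in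
theorem natDegree_numQ (x t : ℝ) : (D.numQ x t).natDegree ≤ 4 * N := natDegree_sndNum_le _ _

theorem coeff_numP (x t : ℝ) : (D.numP x t).coeff (4 * N + 1) = 1 := by
  rw [numP, coeff_fstNum, numQ, eval_zero_sndNum, symC']
  have := h.qm_ne
  have := h.prodHat_ne
  field_simp
  rw [Complex.I_sq]; ring

theorem natDegree_numP (x t : ℝ) : (D.numP x t).natDegree = 4 * N + 1 :=
  natDegree_eq_of_le_of_coeff_ne_zero (natDegree_fstNum_le _)
    (by rw [h.coeff_numP]; exact one_ne_zero)

theorem monic_numP (x t : ℝ) : (D.numP x t).Monic := by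
  rw [Monic, leadingCoeff, h.natDegree_numP, h.coeff_numP]

/-- The determinant of the Jost matrix, for the numerators. -/
theorem det_num (x t : ℝ) :
    D.numP x t * conjP (D.numP x t) + D.numQ x t * conjP (D.numQ x t)
      = (X ^ 2 + C ((D.q₀ : ℂ) ^ 2)) * (D.polyEta * D.polyHat) :=
  h.det_identity (h.isRow_num x t) (h.isSym_num x t) (h.monic_numP x t) (h.natDegree_numP x t)
    (natDegree_numQ x t)

/-- The quotient of determinants is a Schur complement, hence linear in the solution of the
system. -/
theorem q_eq (x t : ℝ) :
    D.q x t = D.qm + Complex.I * ∑ n, D.coefOf x t (D.sol x t) (Sum.inr n) := by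
  have hdet := h.det_G_ne x t
  let _ : Invertible (D.G x t) := invertibleOfIsUnitDet _ hdet.isUnit
  rw [q, borderedG, det_fromBlocks₁₁, mul_comm (det _), ← mul_assoc, mul_div_cancel_right₀ _ hdet]
  have e : (0 - replicateRow Unit (D.omegaVec x t) * ⅟(D.G x t) * replicateCol Unit D.nuVec).det
      = -∑ n, D.coefOf x t (D.sol x t) (Sum.inr n) := by
    rw [det_unique, zero_sub, neg_apply, invOf_eq_nonsing_inv, Matrix.mul_assoc]
    congr 1
    have e2 : (D.G x t)⁻¹ * replicateCol Unit D.nuVec = replicateCol Unit (D.sol x t) := by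
      ext i j
      simp [sol, mul_apply, mulVec, dotProduct]
    rw [e2, mul_apply, Fintype.sum_sum_type, ← Finset.sum_add_distrib]
    refine Finset.sum_congr rfl fun n _ => ?_
    simp only [replicateRow_apply, replicateCol_apply, omegaVec, coefOf, Sum.elim_inl,
      Sum.elim_inr, expo]
    ring
  rw [e]
  ring

/-- The potential is read off from the coefficient of `1 / z` of the second entry. -/
theorem coeff_numQ (x t : ℝ) : (D.numQ x t).coeff (4 * N) = -(Complex.I * D.q x t) := by
  rw [numQ, coeff_sndNum, h.q_eq]
  linear_combination (∑ n, D.coefOf x t (D.sol x t) (Sum.inr n)) * Complex.I_sq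

end Admissible

end Data
/-! ### Smoothness in `(x, t)` -/

theorem contDiff_det {E ι : Type*} [NormedAddCommGroup E] [NormedSpace ℝ E] [Fintype ι]
    [DecidableEq ι] {A : E → Matrix ι ι ℂ} (hA : ∀ i j, ContDiff ℝ ∞ fun p => A p i j) :
    ContDiff ℝ ∞ fun p => (A p).det := by
  simp only [det_apply]
  refine ContDiff.sum fun σ _ => ContDiff.const_smul _ ?_
  exact contDiff_prod fun i _ => hA _ _

namespace Data

variable {N : ℕ} (D : Data N)

theorem contDiff_phase (z : ℂ) :
    ContDiff ℝ ∞ fun p : ℝ × ℝ => phase D.q₀ D.ε p.1 p.2 z := by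
  rw [funext fun p : ℝ × ℝ => D.phase_eq p.1 p.2 z]
  exact ((Complex.ofRealCLM.contDiff.comp contDiff_fst).mul contDiff_const).add
    ((Complex.ofRealCLM.contDiff.comp contDiff_snd).mul contDiff_const)

theorem contDiff_expo (n) : ContDiff ℝ ∞ fun p : ℝ × ℝ => D.expo p.1 p.2 n :=
  contDiff_const.mul (contDiff_const.mul (D.contDiff_phase _)).neg.cexp

theorem nablaPlus_eq (x t : ℝ) (n) (z : ℂ) :
    D.nablaPlus x t n z = D.expo x t n / (z - D.etaHat n) := by
  simp only [nablaPlus, expo]; ring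

theorem contDiff_nablaPlus (n) (z : ℂ) : ContDiff ℝ ∞ fun p : ℝ × ℝ => D.nablaPlus p.1 p.2 n z := by
  simp only [nablaPlus_eq]
  exact (D.contDiff_expo n).div_const _

variable {D}

theorem fstNum_sum_smul {ι : Type*} [Fintype ι] (c : ι → ℂ) (B : ι → ℂ[X]) :
    D.fstNum (∑ i, c i • B i) = ∑ i, c i • D.fstNum (B i) := by
  have := map_sum (D.symC' • invertₗ D.rho (4 * N + 1)) (fun i => c i • B i) Finset.univ
  refine this.trans (Finset.sum_congr rfl fun i _ => ?_)
  exact map_smul (D.symC' • invertₗ D.rho (4 * N + 1)) (c i) (B i)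

namespace Admissible

variable (h : D.Admissible)
include h

theorem contDiff_deltaPlus (n) : ContDiff ℝ ∞ fun p : ℝ × ℝ => D.deltaPlus p.1 p.2 n := by
  simp only [deltaPlus]
  rw [funext fun p : ℝ × ℝ => congrArg (fun w => D.Bplus n - 2 * Complex.I * w)
    (D.deriv_phase_eq p.1 p.2 (h.etaHat_ne n))]
  exact contDiff_const.sub (contDiff_const.mul
    (((Complex.ofRealCLM.contDiff.comp contDiff_fst).mul contDiff_const).add
      ((Complex.ofRealCLM.contDiff.comp contDiff_snd).mul contDiff_const)))

theorem contDiff_G (i j) : ContDiff ℝ ∞ fun p : ℝ × ℝ => D.G p.1 p.2 i j := by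
  rcases i with i | i <;> rcases j with j | j
  · exact ((D.contDiff_nablaPlus j _).mul ((h.contDiff_deltaPlus j).add contDiff_const)).add
      contDiff_const
  · exact D.contDiff_nablaPlus j _
  · exact (((D.contDiff_nablaPlus j _).div_const _).mul
      ((h.contDiff_deltaPlus j).add contDiff_const)).add contDiff_const
  · exact ((D.contDiff_nablaPlus j _).div_const _).sub contDiff_const

theorem contDiff_sol (i) : ContDiff ℝ ∞ fun p : ℝ × ℝ => D.sol p.1 p.2 i := by
  have e : (fun p : ℝ × ℝ => D.sol p.1 p.2 i) = fun p : ℝ × ℝ =>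
      ∑ j, (D.G p.1 p.2).det⁻¹ * ((D.G p.1 p.2).updateRow j (Pi.single i 1)).det * D.nuVec j := by
    ext p
    simp only [sol, mulVec, dotProduct, Matrix.inv_def, Matrix.smul_apply, adjugate_apply,
      Ring.inverse_eq_inv', smul_eq_mul]
  rw [e]
  refine ContDiff.sum fun j _ => ContDiff.mul (ContDiff.mul ?_ ?_) contDiff_const
  · exact (contDiff_det h.contDiff_G).inv fun p => h.det_G_ne p.1 p.2
  · refine contDiff_det fun k l => ?_
    by_cases hk : k = j
    · subst hk
      simp only [updateRow_self]
      exact contDiff_const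
    · simp only [updateRow_ne hk]
      exact h.contDiff_G k l

theorem contDiff_coefOf (i) :
    ContDiff ℝ ∞ fun p : ℝ × ℝ => D.coefOf p.1 p.2 (D.sol p.1 p.2) i := by
  rcases i with n | n
  · exact (D.contDiff_expo n).mul (h.contDiff_sol _)
  · exact (D.contDiff_expo n).mul (((h.contDiff_deltaPlus n).mul (h.contDiff_sol _)).add
      (h.contDiff_sol _))

theorem contDiff_q : ContDiff ℝ ∞ fun p : ℝ × ℝ => D.q p.1 p.2 := by
  simp only [h.q_eq]
  exact contDiff_const.add (contDiff_const.mul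
    (ContDiff.sum fun n _ => h.contDiff_coefOf (Sum.inr n)))

end Admissible

variable (D)

/-- The derivative of `numQ` when the coefficients of its partial fractions have the
derivatives `c`. -/
noncomputable def sndVar (c : (Fin N ⊕ Fin N) ⊕ (Fin N ⊕ Fin N) → ℂ) : ℂ[X] :=
  ∑ i, c i • D.fracBasis i

/-- The `x`-derivatives of the coefficients of the partial fractions. -/
noncomputable def coefX (x t : ℝ) (i : (Fin N ⊕ Fin N) ⊕ (Fin N ⊕ Fin N)) : ℂ :=
  deriv (fun y => D.coefOf y t (D.sol y t) i) x

/-- The `t`-derivatives of the coefficients of the partial fractions. -/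
noncomputable def coefT (x t : ℝ) (i : (Fin N ⊕ Fin N) ⊕ (Fin N ⊕ Fin N)) : ℂ :=
  deriv (fun s => D.coefOf x s (D.sol x s) i) t

variable {D}

theorem natDegree_sndVar_le (c) : (D.sndVar c).natDegree ≤ 4 * N :=
  natDegree_sum_le_of_forall_le _ _ fun i _ =>
    (natDegree_smul_le _ _).trans (D.natDegree_fracBasis_le i)

theorem natDegree_fstNum_sndVar_le (c) : (D.fstNum (D.sndVar c)).natDegree ≤ 4 * N := by
  refine natDegree_le_pred (natDegree_fstNum_le _) ?_
  rw [coeff_fstNum]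
  simp [sndVar, eval_finsetSum, eval_zero_fracBasis]

theorem hasPolyDerivAt_numQ {xs ts : ℝ → ℝ} {c : (Fin N ⊕ Fin N) ⊕ (Fin N ⊕ Fin N) → ℂ} {s : ℝ}
    (hc : ∀ i, HasDerivAt (fun r => D.coefOf (xs r) (ts r) (D.sol (xs r) (ts r)) i) (c i) s) :
    HasPolyDerivAt (fun r => D.numQ (xs r) (ts r)) (D.sndVar c) s :=
  HasPolyDerivAt.const_add_sum_smul hc

theorem hasPolyDerivAt_numP {xs ts : ℝ → ℝ} {c : (Fin N ⊕ Fin N) ⊕ (Fin N ⊕ Fin N) → ℂ} {s : ℝ}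
    (hc : ∀ i, HasDerivAt (fun r => D.coefOf (xs r) (ts r) (D.sol (xs r) (ts r)) i) (c i) s) :
    HasPolyDerivAt (fun r => D.numP (xs r) (ts r)) (D.fstNum (D.sndVar c)) s :=
  (hasPolyDerivAt_numQ hc).map (D.symC' • invertₗ D.rho (4 * N + 1))

namespace Admissible

variable (h : D.Admissible)
include h

theorem hasDerivAt_coefX (x t : ℝ) (i) :
    HasDerivAt (fun y => D.coefOf y t (D.sol y t) i) (D.coefX x t i) x := by
  have : ContDiff ℝ ∞ fun y : ℝ => D.coefOf y t (D.sol y t) i :=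
    ContDiff.comp (g := fun p : ℝ × ℝ => D.coefOf p.1 p.2 (D.sol p.1 p.2) i)
      (f := fun y : ℝ => (y, t)) (h.contDiff_coefOf i) (contDiff_id.prodMk contDiff_const)
  exact (this.differentiable (by simp) x).hasDerivAt

theorem hasDerivAt_coefT (x t : ℝ) (i) :
    HasDerivAt (fun s => D.coefOf x s (D.sol x s) i) (D.coefT x t i) t := by
  have : ContDiff ℝ ∞ fun s : ℝ => D.coefOf x s (D.sol x s) i :=
    ContDiff.comp (g := fun p : ℝ × ℝ => D.coefOf p.1 p.2 (D.sol p.1 p.2) i)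
      (f := fun s : ℝ => (x, s)) (h.contDiff_coefOf i) (contDiff_const.prodMk contDiff_id)
  exact (this.differentiable (by simp) t).hasDerivAt

/-! ### The Lax pair from uniqueness -/

omit h in
/-- Differentiation of a symmetric row along the flow preserves the symmetry, since the phase is
odd under `z ↦ ρ / z`. -/
theorem isSym_deriv {m : ℕ} {P Q DP DQ T : ℂ[X]} {τ : ℂ → ℂ} (hρ : D.rho ≠ 0)
    (hs : D.IsSym 0 P Q) (hd : D.IsSym 0 DP DQ)
    (hT : ∀ z : ℂ, z ≠ 0 → T.eval z = z ^ m * τ z) (hτ : ∀ z : ℂ, z ≠ 0 → τ (D.rho / z) = -τ z) :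
    D.IsSym m (X ^ m * DP - C Complex.I * T * P) (X ^ m * DQ + C Complex.I * T * Q) := by
  intro z hz
  have h1 := hs z hz
  have h2 := hd z hz
  have hzi : D.rho / z ≠ 0 := div_ne_zero hρ hz
  simp only [pow_zero, one_mul, mul_zero, add_zero] at h1 h2
  simp only [eval_add, eval_sub, eval_mul, eval_pow, eval_X, eval_C, hT z hz, hT _ hzi, hτ z hz]
  rw [h1, h2, div_pow, pow_add _ (4 * N + 1), two_mul, pow_add z m m]
  have : z ^ m ≠ 0 := pow_ne_zero _ hz
  field_simp
  ring

/-- A linear combination of the derivative of the row and of the two rows of the Jost matrix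
vanishes as soon as it decays at infinity. Here `F₁`, `F₂` are `z ^ m` times functions that are
invariant under `z ↦ ρ / z`. -/
theorem deriv_eq_of_degree_lt {ξ τ : ℝ} {xs ts : ℝ → ℝ} {s : ℝ} {m : ℕ}
    {c : (Fin N ⊕ Fin N) ⊕ (Fin N ⊕ Fin N) → ℂ} {T F₁ F₂ : ℂ[X]} {g₁ g₂ : ℂ → ℂ}
    (hc : ∀ i, HasDerivAt (fun r => D.coefOf (xs r) (ts r) (D.sol (xs r) (ts r)) i) (c i) s)
    (hx : HasDerivAt xs ξ s) (ht : HasDerivAt ts τ s)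
    (hT : ∀ z : ℂ, z ≠ 0 → T.eval z = z ^ m * phase D.q₀ D.ε ξ τ z)
    (hF₁ : ∀ z : ℂ, z ≠ 0 → F₁.eval z = z ^ m * g₁ z)
    (hg₁ : ∀ z : ℂ, z ≠ 0 → g₁ (D.rho / z) = g₁ z)
    (hF₂ : ∀ z : ℂ, z ≠ 0 → F₂.eval z = z ^ m * g₂ z)
    (hg₂ : ∀ z : ℂ, z ≠ 0 → g₂ (D.rho / z) = g₂ z)
    (d₁ : (X ^ m * D.fstNum (D.sndVar c) - C Complex.I * T * D.numP (xs s) (ts s)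
      + F₁ * D.numP (xs s) (ts s) + F₂ * -conjP (D.numQ (xs s) (ts s))).degree
        < ((4 * N + 1 + m : ℕ) : WithBot ℕ))
    (d₂ : (X ^ m * D.sndVar c + C Complex.I * T * D.numQ (xs s) (ts s)
      + F₁ * D.numQ (xs s) (ts s) + F₂ * conjP (D.numP (xs s) (ts s))).degree
        < ((4 * N + 1 + m : ℕ) : WithBot ℕ)) :
    (X ^ m * D.fstNum (D.sndVar c) - C Complex.I * T * D.numP (xs s) (ts s)
      + F₁ * D.numP (xs s) (ts s) + F₂ * -conjP (D.numQ (xs s) (ts s))) = 0 ∧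
    (X ^ m * D.sndVar c + C Complex.I * T * D.numQ (xs s) (ts s)
      + F₁ * D.numQ (xs s) (ts s) + F₂ * conjP (D.numP (xs s) (ts s))) = 0 := by
  have hrow := h.isRow_num (xs s) (ts s)
  have hsym := h.isSym_num (xs s) (ts s)
  have hinv : ∀ {F : ℂ[X]} {g : ℂ → ℂ}, (∀ z : ℂ, z ≠ 0 → F.eval z = z ^ m * g z) →
      (∀ z : ℂ, z ≠ 0 → g (D.rho / z) = g z) →
      ∀ z : ℂ, z ≠ 0 → D.rho ^ m * F.eval z = z ^ (2 * m) * F.eval (D.rho / z) := by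
    intro F g hF hg z hz
    rw [hF z hz, hF _ (div_ne_zero h.rho_ne hz), hg z hz, div_pow, two_mul, pow_add]
    have : z ^ m ≠ 0 := pow_ne_zero _ hz
    field_simp
  refine h.isRow_unique (x := xs s) (t := ts s) ?_ ?_ d₁ d₂
  · exact ((h.isRow_deriv (fun r => h.isRow_num (xs r) (ts r)) hx ht (hasPolyDerivAt_numP hc)
      (hasPolyDerivAt_numQ hc) hT).add (hrow.mul_left F₁)).add ((h.isRow_conj hrow).mul_left F₂)
  · refine ((isSym_deriv h.rho_ne hsym (h.isSym_fstNum (natDegree_sndVar_le c)) hT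
      fun z hz => h.phase_inv ξ τ hz).add ?_).add ?_
    · exact hsym.mul_left (hinv hF₁ hg₁)
    · exact (h.isSym_conj hsym).mul_left (hinv hF₂ hg₂)

/-- The `x`-part of the Lax pair, for the numerators: `∂ₓ` of the row plus `i k` times the row minus
`q` times the other row decays at infinity. -/
theorem lax_x (x t : ℝ) :
    X * D.fstNum (D.sndVar (D.coefX x t)) = C (Complex.I * (D.q₀ : ℂ) ^ 2) * D.numP x t
      - C (D.q x t) * X * conjP (D.numQ x t) ∧
    D.sndVar (D.coefX x t) = -(C Complex.I * X * D.numQ x t) + C (D.q x t) * conjP (D.numP x t) := by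
  have hP := h.natDegree_numP x t
  have hQ := natDegree_numQ (D := D) x t
  have hdP := natDegree_fstNum_sndVar_le (D := D) (D.coefX x t)
  have hdQ := natDegree_sndVar_le (D := D) (D.coefX x t)
  have cQ := h.coeff_numQ x t
  have cP := h.coeff_numP x t
  set P := D.numP x t
  set Q := D.numQ x t
  set dP := D.fstNum (D.sndVar (D.coefX x t))
  set dQ := D.sndVar (D.coefX x t)
  set T : ℂ[X] := C (1 / 2) * (X ^ 2 + C ((D.q₀ : ℂ) ^ 2)) with hT
  set K : ℂ[X] := C (1 / 2) * (X ^ 2 - C ((D.q₀ : ℂ) ^ 2)) with hK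
  have hTK : T - K = C ((D.q₀ : ℂ) ^ 2) := by
    have : (C (1 / 2) * 2 : ℂ[X]) = 1 := by
      rw [show (2 : ℂ[X]) = C 2 from (C_ofNat 2).symm, ← C_mul]; norm_num
    rw [hT, hK]; linear_combination C ((D.q₀ : ℂ) ^ 2) * this
  have hTK' : T + K = X ^ 2 := by
    have : (C (1 / 2) * 2 : ℂ[X]) = 1 := by
      rw [show (2 : ℂ[X]) = C 2 from (C_ofNat 2).symm, ← C_mul]; norm_num
    rw [hT, hK]; linear_combination X ^ 2 * this
  have e1 : X ^ 1 * dP - C Complex.I * T * P + C Complex.I * K * P + -C (D.q x t) * X * -conjP Q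
      = X * dP - C (Complex.I * (D.q₀ : ℂ) ^ 2) * P + C (D.q x t) * X * conjP Q := by
    rw [C_mul]; linear_combination -C Complex.I * P * hTK
  have e2 : X ^ 1 * dQ + C Complex.I * T * Q + C Complex.I * K * Q + -C (D.q x t) * X * conjP P
      = X * (dQ + C Complex.I * X * Q - C (D.q x t) * conjP P) := by
    linear_combination C Complex.I * Q * hTK'
  have d1 : (X ^ 1 * dP - C Complex.I * T * P + C Complex.I * K * P
      + -C (D.q x t) * X * -conjP Q).degree < ((4 * N + 1 + 1 : ℕ) : WithBot ℕ) := by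
    rw [e1]
    refine lt_of_le_of_lt degree_le_natDegree (Nat.cast_lt.2 (Nat.lt_succ_of_le ?_))
    refine (natDegree_add_le _ _).trans (max_le ((natDegree_sub_le _ _).trans (max_le ?_ ?_)) ?_)
    · refine natDegree_mul_le.trans ?_
      rw [natDegree_X]; omega
    · exact (natDegree_C_mul_le _ _).trans hP.le
    · refine natDegree_mul_le.trans ?_
      have := natDegree_C_mul_le (D.q x t) (X : ℂ[X])
      rw [natDegree_X] at this
      rw [natDegree_conjP]; omega
  have d2 : (X ^ 1 * dQ + C Complex.I * T * Q + C Complex.I * K * Q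
      + -C (D.q x t) * X * conjP P).degree < ((4 * N + 1 + 1 : ℕ) : WithBot ℕ) := by
    rw [e2, degree_lt_iff_coeff_zero]
    intro j hj
    obtain ⟨k, rfl⟩ := Nat.exists_eq_add_of_le hj
    rw [show 4 * N + 1 + 1 + k = (4 * N + 1 + k) + 1 by ring, coeff_X_mul, coeff_sub, coeff_add,
      coeff_eq_zero_of_natDegree_lt (p := dQ) (by omega), mul_assoc, coeff_C_mul, coeff_C_mul,
      show 4 * N + 1 + k = (4 * N + k) + 1 by ring, coeff_X_mul, coeff_conjP]
    rcases Nat.eq_zero_or_pos k with rfl | hk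
    · rw [add_zero, cQ, cP, map_one]
      linear_combination -D.q x t * Complex.I_sq
    · rw [coeff_eq_zero_of_natDegree_lt (p := Q) (by omega),
        coeff_eq_zero_of_natDegree_lt (p := P) (by omega)]
      simp
  have key := h.deriv_eq_of_degree_lt (ξ := 1) (τ := 0) (xs := fun y => y) (ts := fun _ => t)
    (s := x) (m := 1) (c := D.coefX x t) (T := T) (F₁ := C Complex.I * K)
    (F₂ := -C (D.q x t) * X) (g₁ := fun z => Complex.I * specK D.q₀ z) (g₂ := fun _ => -D.q x t)
    (h.hasDerivAt_coefX x t) (hasDerivAt_id x) (hasDerivAt_const x t)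
    (fun z hz => by
      rw [phase_one_zero, specLam, hT]
      simp only [eval_mul, eval_add, eval_pow, eval_X, eval_C]
      field_simp)
    (fun z hz => by
      rw [specK, hK]
      simp only [eval_mul, eval_sub, eval_pow, eval_X, eval_C]
      field_simp)
    (fun z hz => by rw [h.specK_inv hz])
    (fun z hz => by
      simp only [eval_mul, eval_neg, eval_X, eval_C]; ring)
    (fun z hz => rfl) d1 d2
  obtain ⟨k1, k2⟩ := key
  rw [e1] at k1
  rw [e2] at k2
  constructor
  · linear_combination k1
  · have := (mul_eq_zero.1 k2).resolve_left X_ne_zero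
    linear_combination this

end Admissible

end Data
/-! ### Functions decaying together with their `x`-derivatives -/

/-- `F x z` is smooth in `x`, and each of its `x`-derivatives is `O(z ^ (-n))` as `z → ∞`. -/
def Decay (n : ℕ) (F : ℝ → ℝ → ℂ) : Prop :=
  (∀ z, ContDiff ℝ ∞ fun x => F x z) ∧
    ∀ (m : ℕ) (x : ℝ), (fun z => iteratedDeriv m (fun y => F y z) x) =O[atTop] fun z => (z⁻¹) ^ n

namespace Decay

variable {n m : ℕ} {F G : ℝ → ℝ → ℂ}

theorem contDiffAt (h : Decay n F) (z x : ℝ) (j : ℕ) : ContDiffAt ℝ j (fun y => F y z) x :=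
  ((h.1 z).of_le (by exact_mod_cast le_top)).contDiffAt

theorem isBigO (h : Decay n F) (x : ℝ) : (fun z => F x z) =O[atTop] fun z => (z⁻¹) ^ n := by
  simpa using h.2 0 x

theorem const_mul {c : ℝ → ℂ} {r : ℝ → ℂ} (hc : ContDiff ℝ ∞ c)
    (hr : r =O[atTop] fun z : ℝ => (z⁻¹) ^ n) : Decay n fun x z => c x * r z := by
  refine ⟨fun z => hc.mul contDiff_const, fun j x => ?_⟩
  have : (fun z => iteratedDeriv j (fun y => c y * r z) x)
      = fun z => iteratedDeriv j c x * r z := by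
    ext z
    simp [mul_comm _ (r z)]
  rw [this]
  exact hr.const_mul_left _

theorem mono (h : Decay m F) (hnm : n ≤ m) : Decay n F := by
  refine ⟨h.1, fun j x => (h.2 j x).trans ?_⟩
  refine Asymptotics.IsBigO.of_bound 1 ?_
  filter_upwards [eventually_ge_atTop 1] with z hz
  have h0 : 0 ≤ z⁻¹ := by positivity
  rw [one_mul, norm_pow, norm_pow, Real.norm_of_nonneg h0]
  exact pow_le_pow_of_le_one h0 (inv_le_one_of_one_le₀ hz) hnm

theorem add (h : Decay n F) (h' : Decay n G) : Decay n fun x z => F x z + G x z := by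
  refine ⟨fun z => (h.1 z).add (h'.1 z), fun j x => ?_⟩
  have : (fun z => iteratedDeriv j (fun y => F y z + G y z) x)
      = fun z => iteratedDeriv j (fun y => F y z) x + iteratedDeriv j (fun y => G y z) x := by
    ext z
    exact iteratedDeriv_fun_add (h.contDiffAt z x j) (h'.contDiffAt z x j)
  rw [this]
  exact (h.2 j x).add (h'.2 j x)

theorem mul (h : Decay n F) (h' : Decay m G) : Decay (n + m) fun x z => F x z * G x z := by
  refine ⟨fun z => (h.1 z).mul (h'.1 z), fun j x => ?_⟩
  have : (fun z => iteratedDeriv j (fun y => F y z * G y z) x)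
      = fun z => ∑ i ∈ Finset.range (j + 1), j.choose i * iteratedDeriv i (fun y => F y z) x *
        iteratedDeriv (j - i) (fun y => G y z) x := by
    ext z
    exact iteratedDeriv_fun_mul (h.contDiffAt z x j) (h'.contDiffAt z x j)
  rw [this]
  refine Asymptotics.IsBigO.fun_sum fun i _ => ?_
  simp only [mul_assoc, pow_add]
  exact ((h.2 i x).mul (h'.2 (j - i) x)).const_mul_left _

theorem smooth_mul {c : ℝ → ℂ} (hc : ContDiff ℝ ∞ c) (h : Decay n F) :
    Decay n fun x z => c x * F x z := by
  have h1 : Decay 0 fun x (_ : ℝ) => c x * (1 : ℂ) :=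
    const_mul (r := fun _ => 1) hc (by
      simpa using Asymptotics.isBigO_const_const (1 : ℂ) (one_ne_zero (α := ℝ)) atTop)
  simpa using h1.mul h

theorem fun_mul {r : ℝ → ℂ} (hr : r =O[atTop] fun z : ℝ => (z⁻¹) ^ m) (h : Decay n F) :
    Decay (m + n) fun x z => r z * F x z := by
  have h1 : Decay m fun (_ : ℝ) z => (1 : ℂ) * r z := const_mul contDiff_const hr
  simpa using h1.mul h

theorem neg (h : Decay n F) : Decay n fun x z => -F x z := by
  simpa using smooth_mul (c := fun _ => -1) contDiff_const h

theorem sub (h : Decay n F) (h' : Decay n G) : Decay n fun x z => F x z - G x z := by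
  simpa [sub_eq_add_neg] using h.add h'.neg

theorem deriv (h : Decay n F) : Decay n fun x z => deriv (fun y => F y z) x := by
  refine ⟨fun z => ?_, fun j x => ?_⟩
  · exact ((contDiff_infty_iff_deriv (f := fun y => F y z)).1 (h.1 z)).2
  · have := h.2 (j + 1) x
    simp only [iteratedDeriv_succ'] at this
    exact this

theorem conjugate (h : Decay n F) : Decay n fun x z => conj (F x z) := by
  refine ⟨fun z => Complex.conjCLE.contDiff.comp (h.1 z), fun j x => ?_⟩
  have e : ∀ (j : ℕ) (f : ℝ → ℂ), iteratedDeriv j (fun y => (starRingEnd ℂ) (f y))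
      = fun y => (starRingEnd ℂ) (iteratedDeriv j f y) := by
    intro j
    induction j with
    | zero => intro f; simp
    | succ j ih =>
      intro f
      rw [iteratedDeriv_succ, ih, iteratedDeriv_succ]
      ext y
      exact deriv.star (f := iteratedDeriv j f) (x := y)
  simp only [e]
  refine ((h.2 j x).norm_left.congr_left fun z => ?_).of_norm_left
  rw [Complex.norm_conj]

theorem congr (h : Decay n F) (hG : ∀ z, ContDiff ℝ ∞ fun x => G x z)
    (he : ∀ᶠ z in atTop, ∀ x, F x z = G x z) : Decay n G := by
  refine ⟨hG, fun j x => (h.2 j x).congr' ?_ EventuallyEq.rfl⟩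
  filter_upwards [he] with z hz
  rw [funext hz]

theorem finsetSum {ι : Type*} {s : Finset ι} {F : ι → ℝ → ℝ → ℂ} (h : ∀ i ∈ s, Decay n (F i)) :
    Decay n fun x z => ∑ i ∈ s, F i x z := by
  classical
  induction s using Finset.induction_on with
  | empty =>
    have : Decay n fun (_ : ℝ) (_ : ℝ) => (0 : ℂ) * 0 :=
      const_mul (r := fun _ => 0) contDiff_const (Asymptotics.isBigO_zero _ _)
    simpa using this
  | insert a s ha ih =>
    simp only [Finset.sum_insert ha]
    exact (h a (Finset.mem_insert_self _ _)).add
      (ih fun i hi => h i (Finset.mem_insert_of_mem hi))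

end Decay

theorem contDiff_conj {f : ℝ → ℂ} (hf : ContDiff ℝ ∞ f) : ContDiff ℝ ∞ fun x => conj (f x) :=
  Complex.conjCLE.contDiff.comp hf

theorem contDiff_deriv {f : ℝ → ℂ} (hf : ContDiff ℝ ∞ f) : ContDiff ℝ ∞ (deriv f) :=
  (contDiff_infty_iff_deriv.1 hf).2

/-! ### The expansion of the generator of the hierarchy at `k = ∞` -/

/-- The coefficients of the expansion `α = k + ∑ a_j k ^ (-j)`, `β = ∑ b_j k ^ (-j)` of the
solution of `β_x = -2 i k β - 2 q α`, `α² + |β|² = k² + c`: the first equation determines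
`b_{j+1}`, the second `a_{j+1}`. -/
structure IsExpansion (c : ℝ) (q : ℝ → ℂ) (a b : ℕ → ℝ → ℂ) : Prop where
  smooth_a : ∀ j, ContDiff ℝ ∞ (a j)
  smooth_b : ∀ j, ContDiff ℝ ∞ (b j)
  smooth_q : ContDiff ℝ ∞ q
  b0 : ∀ x, b 0 x = Complex.I * q x
  b1 : ∀ x, b 1 x = Complex.I / 2 * deriv (b 0) x
  b2 : ∀ x, b 2 x = Complex.I / 2 * deriv (b 1) x + Complex.I * q x * a 1 x
  b3 : ∀ x, b 3 x = Complex.I / 2 * deriv (b 2) x + Complex.I * q x * a 2 x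
  b4 : ∀ x, b 4 x = Complex.I / 2 * deriv (b 3) x + Complex.I * q x * a 3 x
  a1 : ∀ x, 2 * a 1 x = c - b 0 x * conj (b 0 x)
  a2 : ∀ x, 2 * a 2 x = -(b 0 x * conj (b 1 x) + b 1 x * conj (b 0 x))
  a3 : ∀ x, 2 * a 3 x = -(a 1 x ^ 2 + b 0 x * conj (b 2 x) + b 1 x * conj (b 1 x)
    + b 2 x * conj (b 0 x))
  a4 : ∀ x, 2 * a 4 x = -(2 * a 1 x * a 2 x + b 0 x * conj (b 3 x) + b 1 x * conj (b 2 x)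
    + b 2 x * conj (b 1 x) + b 3 x * conj (b 0 x))

/-- A solution `α = k + δ`, `β` of the two equations that is bounded at `k = ∞`, together with
its `x`-derivatives, has the formal expansion up to order five. Each step gains one order, because
`β` and `δ` are multiplied by `k` in the first and in the second equation. -/
theorem IsExpansion.decay {c : ℝ} {q : ℝ → ℂ} {a b : ℕ → ℝ → ℂ} (he : IsExpansion c q a b)
    {k κ : ℝ → ℝ} (hk : ∀ᶠ z in atTop, k z * κ z = 1)
    (hκ : κ =O[atTop] fun z : ℝ => z⁻¹) {β δ : ℝ → ℝ → ℂ} (hβ : Decay 0 β) (hδ : Decay 0 δ)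
    (h1 : ∀ᶠ z in atTop, ∀ x, deriv (fun y => β y z) x
      = -2 * Complex.I * k z * β x z - 2 * q x * (k z + δ x z))
    (h2 : ∀ᶠ z in atTop, ∀ x, (k z + δ x z) ^ 2 + β x z * conj (β x z) = (k z : ℂ) ^ 2 + c) :
    (Decay 5 fun x z => β x z - (b 0 x + b 1 x * κ z + b 2 x * (κ z : ℂ) ^ 2
      + b 3 x * (κ z : ℂ) ^ 3 + b 4 x * (κ z : ℂ) ^ 4)) ∧
    (Decay 5 fun x z => δ x z - (a 1 x * κ z + a 2 x * (κ z : ℂ) ^ 2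
      + a 3 x * (κ z : ℂ) ^ 3 + a 4 x * (κ z : ℂ) ^ 4)) := by
  have sa := he.smooth_a
  have sb := he.smooth_b
  have sq := he.smooth_q
  have sb' := fun j => contDiff_conj (sb j)
  have hκc : (fun z => (κ z : ℂ)) =O[atTop] fun z : ℝ => (z⁻¹) ^ 1 := by
    refine Asymptotics.IsBigO.of_norm_left ?_
    simpa using hκ
  have hκp : ∀ j : ℕ, (fun z => (κ z : ℂ) ^ j) =O[atTop] fun z : ℝ => (z⁻¹) ^ j := by
    intro j
    simpa using hκc.pow j
  have hterm : ∀ {f : ℝ → ℂ} (j : ℕ), ContDiff ℝ ∞ f →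
      Decay 0 fun x z => f x * (κ z : ℂ) ^ j := fun j hf =>
    (Decay.const_mul hf (hκp j)).mono (Nat.zero_le _)
  set B : ℝ → ℝ → ℂ := fun x z => b 0 x + b 1 x * κ z + b 2 x * (κ z : ℂ) ^ 2
      + b 3 x * (κ z : ℂ) ^ 3 + b 4 x * (κ z : ℂ) ^ 4 with hB
  set A : ℝ → ℝ → ℂ := fun x z => a 1 x * κ z + a 2 x * (κ z : ℂ) ^ 2
      + a 3 x * (κ z : ℂ) ^ 3 + a 4 x * (κ z : ℂ) ^ 4 with hA
  have hBd : Decay 0 B := by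
    have := ((((hterm 0 (sb 0)).add (hterm 1 (sb 1))).add (hterm 2 (sb 2))).add
      (hterm 3 (sb 3))).add (hterm 4 (sb 4))
    simpa [hB] using this
  have hAd : Decay 0 A := by
    have := (((hterm 1 (sa 1))).add (hterm 2 (sa 2))).add (hterm 3 (sa 3)) |>.add (hterm 4 (sa 4))
    simpa [hA] using this
  set E : ℝ → ℝ → ℂ := fun x z => β x z - B x z with hE
  set F : ℝ → ℝ → ℂ := fun x z => δ x z - A x z with hF
  have hEd : Decay 0 E := hβ.sub hBd
  have hFd : Decay 0 F := hδ.sub hAd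
  -- the part of `2 k A + A² + |B|² - c` of order at least four in `κ`
  set ρ : ℝ → ℝ → ℂ := fun x z =>
    (2 * a 1 x * a 3 x + a 2 x ^ 2 + (b 0 x * conj (b 4 x) + b 1 x * conj (b 3 x)
      + b 2 x * conj (b 2 x) + b 3 x * conj (b 1 x) + b 4 x * conj (b 0 x))) * (κ z : ℂ) ^ 0
    + (2 * a 1 x * a 4 x + 2 * a 2 x * a 3 x + (b 1 x * conj (b 4 x) + b 2 x * conj (b 3 x)
      + b 3 x * conj (b 2 x) + b 4 x * conj (b 1 x))) * (κ z : ℂ) ^ 1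
    + (2 * a 2 x * a 4 x + a 3 x ^ 2 + (b 2 x * conj (b 4 x) + b 3 x * conj (b 3 x)
      + b 4 x * conj (b 2 x))) * (κ z : ℂ) ^ 2
    + (2 * a 3 x * a 4 x + (b 3 x * conj (b 4 x) + b 4 x * conj (b 3 x))) * (κ z : ℂ) ^ 3
    + (a 4 x ^ 2 + b 4 x * conj (b 4 x)) * (κ z : ℂ) ^ 4 with hρ
  have hρd : Decay 0 ρ := by
    refine ((((hterm 0 ?_).add (hterm 1 ?_)).add (hterm 2 ?_)).add (hterm 3 ?_)).add (hterm 4 ?_)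
      <;> fun_prop
  have hEx : ∀ z x, deriv (fun y => E y z) x = deriv (fun y => β y z) x
      - (deriv (b 0) x + deriv (b 1) x * κ z + deriv (b 2) x * (κ z : ℂ) ^ 2
      + deriv (b 3) x * (κ z : ℂ) ^ 3 + deriv (b 4) x * (κ z : ℂ) ^ 4) := by
    intro z x
    have hd : ∀ j, HasDerivAt (b j) (deriv (b j) x) x := fun j =>
      ((sb j).differentiable (by simp) x).hasDerivAt
    have hdβ : HasDerivAt (fun y => β y z) (deriv (fun y => β y z) x) x :=
      ((hβ.1 z).differentiable (by simp) x).hasDerivAt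
    exact (hdβ.sub (((((hd 0).add ((hd 1).mul_const _)).add ((hd 2).mul_const _)).add
      ((hd 3).mul_const _)).add ((hd 4).mul_const _))).deriv
  have step : ∀ n ≤ 4, Decay n E → Decay n F → Decay (n + 1) E ∧ Decay (n + 1) F := by
    intro n hn dE dF
    have h4 : ∀ {f : ℝ → ℂ}, ContDiff ℝ ∞ f → Decay n fun x z => f x * (κ z : ℂ) ^ 4 :=
      fun hf => (Decay.const_mul hf (hκp 4)).mono hn
    have dρ : Decay n fun x z => (κ z : ℂ) ^ 4 * ρ x z :=
      (Decay.fun_mul (hκp 4) hρd).mono (by omega)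
    constructor
    · have e1 : Decay (1 + n) fun x z => (κ z : ℂ) * (Complex.I / 2 * deriv (fun y => E y z) x
          + Complex.I * q x * F x z
          + (Complex.I / 2 * deriv (b 4) x + Complex.I * q x * a 4 x) * (κ z : ℂ) ^ 4) := by
        refine Decay.fun_mul hκc ((Decay.add ?_ ?_).add (h4 ?_))
        · exact Decay.smooth_mul contDiff_const dE.deriv
        · exact Decay.smooth_mul (contDiff_const.mul sq) dF
        · have := contDiff_deriv (sb 4)
          fun_prop
      rw [add_comm]
      refine e1.congr hEd.1 ?_
      filter_upwards [hk, h1] with z hkz h1z x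
      have hkz' : (k z : ℂ) * κ z = 1 := by exact_mod_cast hkz
      rw [hEx, h1z x]
      simp only [hE, hF, hB, hA, he.b4 x, he.b3 x, he.b2 x, he.b1 x, he.b0 x]
      linear_combination (β x z - Complex.I * q x) * hkz'
        - κ z * k z * β x z * Complex.I_sq
    · have e2 : Decay (1 + n) fun x z => (κ z : ℂ) * (-1 / 2 * ((δ x z + A x z) * F x z
          + β x z * conj (E x z) + E x z * conj (B x z) + (κ z : ℂ) ^ 4 * ρ x z)) := by
        refine Decay.fun_mul hκc (Decay.smooth_mul contDiff_const
          (((Decay.add ?_ ?_).add ?_).add dρ))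
        · simpa using (hδ.add hAd).mul dF
        · simpa using hβ.mul dE.conjugate
        · simpa using dE.mul hBd.conjugate
      rw [add_comm]
      refine e2.congr hFd.1 ?_
      filter_upwards [hk, h2] with z hkz h2z x
      have hkz' : (k z : ℂ) * κ z = 1 := by exact_mod_cast hkz
      have h2x := h2z x
      have i1 := he.a1 x
      have i2 := he.a2 x
      have i3 := he.a3 x
      have i4 := he.a4 x
      simp only [hE, hF, hB, hA, hρ, map_sub, map_add, map_mul, map_pow, Complex.conj_ofReal]
      linear_combination -(κ z : ℂ) / 2 * h2x + (κ z : ℂ) / 2 * (i1 + κ z * i2 + (κ z : ℂ) ^ 2 * i3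
        + (κ z : ℂ) ^ 3 * i4) + (δ x z - (a 1 x * κ z + a 2 x * (κ z : ℂ) ^ 2
        + a 3 x * (κ z : ℂ) ^ 3 + a 4 x * (κ z : ℂ) ^ 4) + (κ z : ℂ) / 2 * (2 * a 1 x
        + 2 * a 2 x * κ z + 2 * a 3 x * (κ z : ℂ) ^ 2 + 2 * a 4 x * (κ z : ℂ) ^ 3)) * hkz'
  have s1 := step 0 (by norm_num) hEd hFd
  have s2 := step 1 (by norm_num) s1.1 s1.2
  have s3 := step 2 (by norm_num) s2.1 s2.2
  have s4 := step 3 (by norm_num) s3.1 s3.2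
  exact step 4 (by norm_num) s4.1 s4.2

/-! ### Rational functions at infinity -/

/-- If `f` has an expansion in powers of `κ = 1 / k`, then its product with a polynomial in `k` is,
up to a term that tends to zero, the polynomial part of the product of the expansions. -/
theorem tendsto_trunc {k κ f : ℝ → ℂ} (hkκ : ∀ᶠ z in atTop, k z * κ z = 1)
    (hκ : Tendsto κ atTop (𝓝 0)) (c₄ c₂ c₁ c₀ s₀ s₁ s₂ s₃ s₄ : ℂ)
    (hf : Tendsto (fun z => k z ^ 4 * (f z - (s₀ + s₁ * κ z + s₂ * κ z ^ 2 + s₃ * κ z ^ 3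
      + s₄ * κ z ^ 4))) atTop (𝓝 0)) :
    Tendsto (fun z => (c₄ * k z ^ 4 + c₂ * k z ^ 2 + c₁ * k z + c₀) * f z
      - (c₄ * (s₀ * k z ^ 4 + s₁ * k z ^ 3 + s₂ * k z ^ 2 + s₃ * k z + s₄)
        + c₂ * (s₀ * k z ^ 2 + s₁ * k z + s₂) + c₁ * (s₀ * k z + s₁) + c₀ * s₀)) atTop (𝓝 0) := by
  have h1 := hf.mul (((hκ.pow 2).const_mul c₂).add ((hκ.pow 3).const_mul c₁) |>.add
    ((hκ.pow 4).const_mul c₀) |>.const_add c₄)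
  have h2 := hκ.mul (((hκ.const_mul s₄).const_add s₃).const_mul c₂ |>.add
    (((hκ.const_mul s₃).const_add s₂ |>.add ((hκ.pow 2).const_mul s₄)).const_mul c₁) |>.add
    (((hκ.const_mul s₂).const_add s₁ |>.add ((hκ.pow 2).const_mul s₃) |>.add
      ((hκ.pow 3).const_mul s₄)).const_mul c₀))
  have h3 := h1.add h2
  rw [zero_mul, zero_mul, add_zero] at h3
  refine h3.congr' ?_
  filter_upwards [hkκ] with z hz
  have hz2 : k z ^ 2 * κ z ^ 2 = 1 := by rw [← mul_pow, hz, one_pow]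
  have hz3 : k z ^ 3 * κ z ^ 3 = 1 := by rw [← mul_pow, hz, one_pow]
  have hz4 : k z ^ 4 * κ z ^ 4 = 1 := by rw [← mul_pow, hz, one_pow]
  set S := s₀ + s₁ * κ z + s₂ * κ z ^ 2 + s₃ * κ z ^ 3 + s₄ * κ z ^ 4 with hS
  have e1 : c₄ * (k z ^ 4 * S) = c₄ * (s₀ * k z ^ 4 + s₁ * k z ^ 3 + s₂ * k z ^ 2 + s₃ * k z + s₄) := by
    rw [hS]
    linear_combination c₄ * (s₁ * k z ^ 3 * hz + s₂ * k z ^ 2 * hz2 + s₃ * k z * hz3 + s₄ * hz4)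
  have e2 : k z ^ 2 * S = s₀ * k z ^ 2 + s₁ * k z + s₂ + κ z * (s₃ + s₄ * κ z) := by
    rw [hS]
    linear_combination s₁ * k z * hz + (s₂ + s₃ * κ z + s₄ * κ z ^ 2) * hz2
  have e3 : k z * S = s₀ * k z + s₁ + κ z * (s₂ + s₃ * κ z + s₄ * κ z ^ 2) := by
    rw [hS]
    linear_combination (s₁ + s₂ * κ z + s₃ * κ z ^ 2 + s₄ * κ z ^ 3) * hz
  have m2 : k z ^ 4 * κ z ^ 2 = k z ^ 2 := by linear_combination k z ^ 2 * hz2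
  have m3 : k z ^ 4 * κ z ^ 3 = k z := by linear_combination k z * hz3
  linear_combination c₂ * (f z - S) * m2 + c₁ * (f z - S) * m3 + c₀ * (f z - S) * hz4 - e1
    - c₂ * e2 - c₁ * e3 + c₀ * hS

/-- The decay of a rational function along the real axis, from the degrees. -/
theorem isBigO_eval_div {R W : ℂ[X]} {n : ℕ} (h : R.natDegree + n ≤ W.natDegree) (hW : W ≠ 0) :
    (fun z : ℝ => R.eval (z : ℂ) / W.eval (z : ℂ)) =O[atTop] fun z : ℝ => (z⁻¹) ^ n := by
  have ht := RCLike.tendsto_ofReal_atTop_cobounded ℂ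
  have hdeg : (R * X ^ n).degree ≤ W.degree := by
    rw [degree_eq_natDegree hW]
    refine degree_le_of_natDegree_le (natDegree_mul_le.trans ?_)
    rwa [natDegree_X_pow]
  have h1 := (Polynomial.isBigO_cobounded_of_degree_le hdeg).comp_tendsto ht
  have hz := ht.eventually
    ((Polynomial.eventually_cofinite_not_isRoot hW).filter_mono (Bornology.le_cofinite ℂ))
  obtain ⟨c, hc⟩ := h1.bound
  refine Asymptotics.IsBigO.of_bound c ?_
  filter_upwards [hc, hz, eventually_gt_atTop 0] with z h2 h3 h4
  have h3' : W.eval (z : ℂ) ≠ 0 := h3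
  have h5 : 0 < ‖W.eval (z : ℂ)‖ := norm_pos_iff.2 h3'
  simp only [Function.comp, eval_mul, eval_pow, eval_X, norm_mul, norm_pow] at h2
  rw [norm_div, div_le_iff₀ h5, norm_pow, norm_inv, inv_pow, mul_assoc, mul_comm _ (‖W.eval _‖),
    ← mul_assoc, ← div_eq_mul_inv, le_div_iff₀ (pow_pos (norm_pos_iff.2 h4.ne') _)]
  simpa using h2

/-- The decay of a rational function whose numerator depends on `x` through finitely many smooth
coefficients. -/
theorem Decay.of_polynomial {ι : Type*} [Fintype ι] {B₀ W : ℂ[X]} {B : ι → ℂ[X]} {c : ℝ → ι → ℂ}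
    {n d : ℕ} (hc : ∀ i, ContDiff ℝ ∞ fun x => c x i) (h0 : B₀.natDegree ≤ d)
    (hB : ∀ i, (B i).natDegree ≤ d) (hW : W ≠ 0) (hd : d + n ≤ W.natDegree) :
    Decay n fun x z => (B₀ + ∑ i, c x i • B i).eval (z : ℂ) / W.eval (z : ℂ) := by
  have e : (fun (x z : ℝ) => (B₀ + ∑ i, c x i • B i).eval (z : ℂ) / W.eval (z : ℂ))
      = fun (x z : ℝ) => 1 * (B₀.eval (z : ℂ) / W.eval (z : ℂ))
        + ∑ i, c x i * ((B i).eval (z : ℂ) / W.eval (z : ℂ)) := by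
    funext x z
    rw [eval_add, eval_finsetSum, add_div, Finset.sum_div, one_mul]
    simp only [eval_smul, smul_eq_mul, mul_div_assoc]
  rw [e]
  refine Decay.add (F := fun x (z : ℝ) => 1 * (B₀.eval (z : ℂ) / W.eval (z : ℂ))) ?_
    (Decay.finsetSum fun i _ => ?_)
  · exact Decay.const_mul contDiff_const (isBigO_eval_div (by omega) hW)
  · exact Decay.const_mul (hc i) (isBigO_eval_div (by have := hB i; omega) hW)

namespace Data

variable {N : ℕ} {D : Data N}

/-! ### Entries of the Jost matrix at real points -/

variable (D) in
/-- The first entry `f₁` of the first row of the Jost matrix, without exponential factor, at a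
real point. -/
noncomputable def entryOne (t x z : ℝ) : ℂ :=
  (D.numP x t).eval (z : ℂ) / (X * D.polyEta).eval (z : ℂ)

variable (D) in
/-- The second entry of the first row of the Jost matrix, without exponential factor and
multiplied by `z`, at a real point. -/
noncomputable def entryTwo (t x z : ℝ) : ℂ :=
  (D.numQ x t).eval (z : ℂ) / D.polyHat.eval (z : ℂ)

variable (D) in
/-- The spectral variable `k` at a real point. -/
noncomputable def realK (z : ℝ) : ℝ := (z - D.q₀ ^ 2 / z) / 2

theorem numP_eq_add_sum (x t : ℝ) :
    D.numP x t = D.fstNum (C (-(Complex.I * D.qm * 1)) * D.polyHat)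
      + ∑ i, D.coefOf x t (D.sol x t) i • D.fstNum (D.fracBasis i) := by
  rw [← fstNum_sum_smul, numP, numQ, sndNum]
  exact map_add (D.symC' • invertₗ D.rho (4 * N + 1)) _ _

theorem ofReal_realK (z : ℝ) : (D.realK z : ℂ) = specK D.q₀ z := by
  simp [realK, specK]

namespace Admissible

variable (h : D.Admissible)
include h

theorem eval_polyEta_ofReal_ne (z : ℝ) : D.polyEta.eval (z : ℂ) ≠ 0 := by
  refine D.eval_polyEta_ne fun n hn => ?_
  have := h.eta_mem n
  rw [← hn] at this
  simp [Dminus] at this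

theorem eval_polyHat_ofReal_ne (z : ℝ) : D.polyHat.eval (z : ℂ) ≠ 0 := by
  refine D.eval_polyHat_ne fun n hn => ?_
  have := h.etaHat_mem n
  rw [← hn] at this
  simp [Dplus] at this

theorem conj_eval_polyEta (z : ℝ) : conj (D.polyEta.eval (z : ℂ)) = D.polyHat.eval (z : ℂ) := by
  rw [← h.conjP_polyEta, eval_conjP, Complex.conj_ofReal]

theorem conj_eval_polyHat (z : ℝ) : conj (D.polyHat.eval (z : ℂ)) = D.polyEta.eval (z : ℂ) := by
  rw [← h.conjP_polyHat, eval_conjP, Complex.conj_ofReal]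

theorem contDiff_coef_x (t : ℝ) (i) :
    ContDiff ℝ ∞ fun y : ℝ => D.coefOf y t (D.sol y t) i :=
  ContDiff.comp (g := fun p : ℝ × ℝ => D.coefOf p.1 p.2 (D.sol p.1 p.2) i)
    (f := fun y : ℝ => (y, t)) (h.contDiff_coefOf i) (contDiff_id.prodMk contDiff_const)

theorem contDiff_q_x (t : ℝ) : ContDiff ℝ ∞ fun y : ℝ => D.q y t :=
  ContDiff.comp (g := fun p : ℝ × ℝ => D.q p.1 p.2)
    (f := fun y : ℝ => (y, t)) h.contDiff_q (contDiff_id.prodMk contDiff_const)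

theorem decay_entryTwo (t : ℝ) : Decay 0 (D.entryTwo t) := by
  refine Decay.of_polynomial (d := 4 * N) (h.contDiff_coef_x t) ?_ D.natDegree_fracBasis_le
    D.monic_polyHat.ne_zero ?_
  · exact (natDegree_C_mul_le _ _).trans D.natDegree_polyHat.le
  · rw [natDegree_polyHat]; omega

theorem decay_entryOne (t : ℝ) : Decay 0 (D.entryOne t) := by
  have e : D.entryOne t = fun (x z : ℝ) =>
      (D.fstNum (C (-(Complex.I * D.qm * 1)) * D.polyHat)
        + ∑ i, D.coefOf x t (D.sol x t) i • D.fstNum (D.fracBasis i)).eval (z : ℂ)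
        / (X * D.polyEta).eval (z : ℂ) := by
    funext x z
    rw [entryOne, numP_eq_add_sum]
  rw [e]
  refine Decay.of_polynomial (d := 4 * N + 1) (h.contDiff_coef_x t) (natDegree_fstNum_le _)
    (fun i => natDegree_fstNum_le _) (mul_ne_zero X_ne_zero D.monic_polyEta.ne_zero) ?_
  rw [monic_X.natDegree_mul D.monic_polyEta, natDegree_X, natDegree_polyEta]
  omega

/-- The determinant of the Jost matrix at real points, where conjugation is complex
conjugation of the values. -/
theorem det_entries (t x : ℝ) {z : ℝ} (hz : z ≠ 0) :
    (z : ℂ) ^ 2 * (D.entryOne t x z * conj (D.entryOne t x z))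
      + D.entryTwo t x z * conj (D.entryTwo t x z) = (z : ℂ) ^ 2 + (D.q₀ : ℂ) ^ 2 := by
  have h1 := congrArg (Polynomial.eval (z : ℂ)) (h.det_num x t)
  simp only [eval_add, eval_mul, eval_conjP, Complex.conj_ofReal, eval_pow, eval_X, eval_C] at h1
  have hz' : (z : ℂ) ≠ 0 := Complex.ofReal_ne_zero.2 hz
  have h2 := h.eval_polyEta_ofReal_ne z
  have h3 := h.eval_polyHat_ofReal_ne z
  simp only [entryOne, entryTwo, map_div₀, eval_mul, eval_X, map_mul, Complex.conj_ofReal,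
    h.conj_eval_polyEta, h.conj_eval_polyHat]
  field_simp
  linear_combination h1

/-- The `x`-part of the Lax pair at real points. -/
theorem deriv_entries (t x : ℝ) {z : ℝ} (hz : z ≠ 0) :
    HasDerivAt (fun y => D.entryOne t y z) (Complex.I * (D.q₀ : ℂ) ^ 2 / z * D.entryOne t x z
      - D.q x t / z * conj (D.entryTwo t x z)) x ∧
    HasDerivAt (fun y => D.entryTwo t y z) (-(Complex.I * z * D.entryTwo t x z)
      + D.q x t * z * conj (D.entryOne t x z)) x := by
  obtain ⟨l1, l2⟩ := h.lax_x x t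
  have l1 := congrArg (Polynomial.eval (z : ℂ)) l1
  have l2 := congrArg (Polynomial.eval (z : ℂ)) l2
  simp only [eval_add, eval_sub, eval_neg, eval_mul, eval_conjP, Complex.conj_ofReal, eval_X,
    eval_C] at l1 l2
  have hz' : (z : ℂ) ≠ 0 := Complex.ofReal_ne_zero.2 hz
  have h2 := h.eval_polyEta_ofReal_ne z
  have h3 := h.eval_polyHat_ofReal_ne z
  have d1 := ((hasPolyDerivAt_numP (xs := fun y => y) (ts := fun _ => t)
    (h.hasDerivAt_coefX x t)).eval (z : ℂ)).div_const ((X * D.polyEta).eval (z : ℂ))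
  have d2 := ((hasPolyDerivAt_numQ (xs := fun y => y) (ts := fun _ => t)
    (h.hasDerivAt_coefX x t)).eval (z : ℂ)).div_const (D.polyHat.eval (z : ℂ))
  constructor
  · refine d1.congr_deriv ?_
    simp only [entryOne, entryTwo, map_div₀, eval_mul, eval_X, h.conj_eval_polyHat]
    field_simp
    linear_combination l1
  · refine d2.congr_deriv ?_
    simp only [entryOne, entryTwo, map_div₀, eval_mul, eval_X, map_mul, Complex.conj_ofReal,
      h.conj_eval_polyEta]
    field_simp
    linear_combination l2

/-- `k(z)` is invertible and comparable with `z` for large real `z`. -/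
theorem realK_bounds : (∀ᶠ z in atTop, D.realK z * (D.realK z)⁻¹ = 1) ∧
    ((fun z => (D.realK z)⁻¹) =O[atTop] fun z : ℝ => z⁻¹) ∧
    (D.realK =O[atTop] fun z : ℝ => z) := by
  have hb : ∀ᶠ z in atTop, 0 < z ∧ z / 4 ≤ D.realK z ∧ D.realK z ≤ z := by
    filter_upwards [eventually_ge_atTop (2 * D.q₀)] with z hz
    have hq := h.q₀_pos
    have hz0 : 0 < z := by linarith
    have h1 : 0 ≤ D.q₀ ^ 2 / z := by positivity
    have h2 : D.q₀ ^ 2 / z ≤ z / 4 := by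
      rw [div_le_iff₀ hz0]; nlinarith
    refine ⟨hz0, ?_, ?_⟩ <;> unfold realK <;> linarith
  refine ⟨?_, ?_, ?_⟩
  · filter_upwards [hb] with z hz
    exact mul_inv_cancel₀ (by linarith [hz.1, hz.2.1] : (0 : ℝ) < _).ne'
  · refine Asymptotics.IsBigO.of_bound 4 ?_
    filter_upwards [hb] with z hz
    have hk : 0 < D.realK z := by linarith [hz.1, hz.2.1]
    rw [norm_inv, norm_inv, Real.norm_of_nonneg hk.le, Real.norm_of_nonneg hz.1.le,
      ← div_eq_mul_inv, inv_eq_one_div, div_le_div_iff₀ hk hz.1]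
    linarith [hz.2.1]
  · refine Asymptotics.IsBigO.of_bound 1 ?_
    filter_upwards [hb] with z hz
    have hk : 0 < D.realK z := by linarith [hz.1, hz.2.1]
    rw [Real.norm_of_nonneg hk.le, Real.norm_of_nonneg hz.1.le, one_mul]
    exact hz.2.2

/-- The matrix `λ ψ σ₃ ψ⁻¹` has the entries `k + δ` and `β`, where `δ = q₀² / z - |z f₂|² / z`
and `β = -z f₁ f₂`; its expansion at `k = ∞` is the one of the hierarchy. -/
theorem decay_expansion (t : ℝ) {a b : ℕ → ℝ → ℂ}
    (he : IsExpansion (D.q₀ ^ 2) (fun x => D.q x t) a b) :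
    (Decay 5 fun x z => -(D.entryOne t x z * D.entryTwo t x z)
      - (b 0 x + b 1 x * ((D.realK z)⁻¹ : ℝ) + b 2 x * (((D.realK z)⁻¹ : ℝ) : ℂ) ^ 2
      + b 3 x * (((D.realK z)⁻¹ : ℝ) : ℂ) ^ 3 + b 4 x * (((D.realK z)⁻¹ : ℝ) : ℂ) ^ 4)) ∧
    (Decay 5 fun x z => ((D.q₀ : ℂ) ^ 2 / z
        - (z : ℂ)⁻¹ * (D.entryTwo t x z * conj (D.entryTwo t x z)))
      - (a 1 x * ((D.realK z)⁻¹ : ℝ) + a 2 x * (((D.realK z)⁻¹ : ℝ) : ℂ) ^ 2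
      + a 3 x * (((D.realK z)⁻¹ : ℝ) : ℂ) ^ 3 + a 4 x * (((D.realK z)⁻¹ : ℝ) : ℂ) ^ 4)) := by
  obtain ⟨k1, k2, -⟩ := h.realK_bounds
  have hinv : (fun z : ℝ => (z : ℂ)⁻¹) =O[atTop] fun z : ℝ => (z⁻¹) ^ 1 := by
    refine Asymptotics.IsBigO.of_norm_left ?_
    simpa using (Asymptotics.isBigO_refl (fun z : ℝ => z⁻¹) atTop).norm_left
  have dβ : Decay 0 fun x z => -(D.entryOne t x z * D.entryTwo t x z) :=
    ((h.decay_entryOne t).mul (h.decay_entryTwo t)).neg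
  have dδ : Decay 0 fun x z => (D.q₀ : ℂ) ^ 2 / z
      - (z : ℂ)⁻¹ * (D.entryTwo t x z * conj (D.entryTwo t x z)) := by
    have d1 : Decay 1 fun (_ : ℝ) (z : ℝ) => (D.q₀ : ℂ) ^ 2 * (z : ℂ)⁻¹ :=
      Decay.const_mul contDiff_const hinv
    have d2 : Decay 1 fun x z => (z : ℂ)⁻¹ * (D.entryTwo t x z * conj (D.entryTwo t x z)) :=
      Decay.fun_mul hinv ((h.decay_entryTwo t).mul (h.decay_entryTwo t).conjugate)
    simpa [div_eq_mul_inv] using (d1.sub d2).mono zero_le_one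
  refine he.decay k1 k2 dβ dδ ?_ ?_
  · filter_upwards [eventually_gt_atTop 0] with z hz x
    obtain ⟨e1, e2⟩ := h.deriv_entries t x hz.ne'
    have hdet := h.det_entries t x hz.ne'
    have e3 : HasDerivAt (fun y => -(D.entryOne t y z * D.entryTwo t y z)) _ x := (e1.mul e2).neg
    rw [e3.deriv, ofReal_realK, specK]
    have hz' : (z : ℂ) ≠ 0 := Complex.ofReal_ne_zero.2 hz.ne'
    field_simp
    linear_combination -D.q x t * hdet
  · filter_upwards [eventually_gt_atTop 0] with z hz x
    have hdet := h.det_entries t x hz.ne'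
    rw [ofReal_realK, specK]
    have hz' : (z : ℂ) ≠ 0 := Complex.ofReal_ne_zero.2 hz.ne'
    simp only [map_neg, map_mul]
    push_cast
    field_simp
    linear_combination 4 * D.entryTwo t x z * conj (D.entryTwo t x z) * hdet

end Admissible

end Data
/-! ### The `t`-part of the Lax pair -/

/-- A polynomial that is negligible along the real axis compared with one of degree at most `n`
has degree less than `n`. -/
theorem degree_lt_of_tendsto_div {R W : ℂ[X]} {n : ℕ} (hW : W.natDegree ≤ n)
    (hne : ∀ᶠ z : ℝ in atTop, W.eval (z : ℂ) ≠ 0)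
    (h : Tendsto (fun z : ℝ => R.eval (z : ℂ) / W.eval (z : ℂ)) atTop (𝓝 0)) :
    R.degree < n := by
  have ht := RCLike.tendsto_ofReal_atTop_cobounded ℂ
  have hdeg : W.degree ≤ (X ^ n : ℂ[X]).degree := by
    rw [degree_X_pow]; exact degree_le_of_natDegree_le hW
  have h1 := (Polynomial.isBigO_cobounded_of_degree_le hdeg).comp_tendsto ht
  have h2 := ((Asymptotics.isLittleO_one_iff ℂ).2 h).mul_isBigO h1
  refine degree_lt_of_isLittleO ((h2.congr' ?_ ?_))
  · filter_upwards [hne] with z hz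
    exact div_mul_cancel₀ _ hz
  · exact Eventually.of_forall fun z => by simp

namespace Data

variable {N : ℕ} {D : Data N}

namespace Admissible

variable (h : D.Admissible)
include h

/-- The `t`-part of the Lax pair for the numerators, at the point `z = q₀`, where `k = 0`. With
`p(k) = c₄ k⁴ + c₂ k² + c₁ k + c₀` the dispersion polynomial, the coefficients of the Lax matrix
are the polynomial parts of `i p α` and `i p β`, where `α`, `β` are the entries of
`λ ψ σ₃ ψ⁻¹`. -/
theorem lax_t_k_zero (x t : ℝ) {a b : ℕ → ℝ → ℂ}
    (he : IsExpansion (D.q₀ ^ 2) (fun x => D.q x t) a b) {c₄ c₂ c₁ c₀ A₀ B₀ : ℂ}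
    (h₄ : c₄ = 16 * D.ε) (h₂ : c₂ = -8 * D.ε * (D.q₀ : ℂ) ^ 2) (h₁ : c₁ = 2)
    (h₀ : c₀ = 6 * D.ε * (D.q₀ : ℂ) ^ 4 + 1)
    (hA₀ : A₀ = c₄ * a 4 x + c₂ * a 2 x + c₁ * a 1 x)
    (hB₀ : B₀ = c₄ * b 4 x + c₂ * b 2 x + c₁ * b 1 x + c₀ * b 0 x) :
    (D.fstNum (D.sndVar (D.coefT x t))).eval (D.q₀ : ℂ)
      = Complex.I * (D.q₀ * c₀ - A₀) * (D.numP x t).eval (D.q₀ : ℂ)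
        + Complex.I * B₀ * conj ((D.numQ x t).eval (D.q₀ : ℂ)) ∧
    (D.sndVar (D.coefT x t)).eval (D.q₀ : ℂ)
      = -(Complex.I * (D.q₀ * c₀ + A₀)) * (D.numQ x t).eval (D.q₀ : ℂ)
        - Complex.I * B₀ * conj ((D.numP x t).eval (D.q₀ : ℂ)) := by
  have hdP := natDegree_fstNum_sndVar_le (D := D) (D.coefT x t)
  have hdQ := natDegree_sndVar_le (D := D) (D.coefT x t)
  obtain ⟨Eβ, Eδ⟩ := h.decay_expansion t he
  obtain ⟨k1, k2, k3⟩ := h.realK_bounds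
  replace Eβ := Eβ.isBigO x
  replace Eδ := Eδ.isBigO x
  have bf := (h.decay_entryOne t).isBigO x
  have bu := (h.decay_entryTwo t).isBigO x
  have det := fun z hz => h.det_entries t x (z := z) hz
  have ef : ∀ z : ℝ, z ≠ 0 → (D.numP x t).eval (z : ℂ)
      = z * D.polyEta.eval (z : ℂ) * D.entryOne t x z := by
    intro z hz
    have := h.eval_polyEta_ofReal_ne z
    have hz' : (z : ℂ) ≠ 0 := Complex.ofReal_ne_zero.2 hz
    rw [entryOne, eval_mul, eval_X]
    field_simp
  have eu : ∀ z : ℝ, (D.numQ x t).eval (z : ℂ) = D.polyHat.eval (z : ℂ) * D.entryTwo t x z := by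
    intro z
    have := h.eval_polyHat_ofReal_ne z
    rw [entryTwo]
    field_simp
  have hinv0 : Tendsto (fun z : ℝ => z⁻¹) atTop (𝓝 0) := tendsto_inv_atTop_zero
  have hκ : Tendsto (fun z : ℝ => (((D.realK z)⁻¹ : ℝ) : ℂ)) atTop (𝓝 0) := by
    have := (k2.trans_tendsto hinv0)
    exact_mod_cast (Complex.continuous_ofReal.tendsto 0).comp this
  have hk1 : ∀ᶠ z in atTop, (D.realK z : ℂ) * (((D.realK z)⁻¹ : ℝ) : ℂ) = 1 := by
    filter_upwards [k1] with z hz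
    exact_mod_cast hz
  have htail : ∀ {E : ℝ → ℂ}, (E =O[atTop] fun z : ℝ => (z⁻¹) ^ 5) →
      Tendsto (fun z : ℝ => (D.realK z : ℂ) ^ 4 * E z) atTop (𝓝 0) := by
    intro E hE
    have hk4 : (fun z : ℝ => (D.realK z : ℂ) ^ 4) =O[atTop] fun z : ℝ => z ^ 4 := by
      refine Asymptotics.IsBigO.of_norm_left ?_
      simpa using (k3.pow 4).norm_left
    refine ((hk4.mul hE).trans ?_).trans_tendsto hinv0
    refine Asymptotics.IsBigO.of_bound 1 ?_
    filter_upwards [eventually_gt_atTop 0] with z hz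
    rw [one_mul, show z ^ 4 * z⁻¹ ^ 5 = z⁻¹ by field_simp]
  have tβ := tendsto_trunc (k := fun z => (D.realK z : ℂ))
    (κ := fun z => (((D.realK z)⁻¹ : ℝ) : ℂ)) hk1 hκ c₄ c₂ c₁ c₀ _ _ _ _ _ (htail Eβ)
  have tδ := tendsto_trunc (k := fun z => (D.realK z : ℂ))
    (κ := fun z => (((D.realK z)⁻¹ : ℝ) : ℂ)) (s₀ := 0) hk1 hκ c₄ c₂ c₁ c₀ _ _ _ _
    (by simpa only [zero_add] using htail Eδ)
  simp only [pow_zero] at bf bu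
  generalize hdPd : D.fstNum (D.sndVar (D.coefT x t)) = dP at *
  generalize hdQd : D.sndVar (D.coefT x t) = dQ at *
  set Λ : ℂ[X] := C (1 / 2) * (X ^ 2 + C ((D.q₀ : ℂ) ^ 2)) with hΛ
  set K : ℂ[X] := C (1 / 2) * (X ^ 2 - C ((D.q₀ : ℂ) ^ 2)) with hK
  have eΛ : ∀ z : ℂ, z ≠ 0 → Λ.eval z = z * specLam D.q₀ z := by
    intro z hz
    simp only [hΛ, specLam, eval_mul, eval_add, eval_pow, eval_X, eval_C]
    field_simp
  have eK : ∀ z : ℂ, z ≠ 0 → K.eval z = z * specK D.q₀ z := by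
    intro z hz
    simp only [hK, specK, eval_mul, eval_sub, eval_pow, eval_X, eval_C]
    field_simp
  clear_value Λ K
  -- `z⁵` times `λ p(k)` and times the polynomial parts in `k` of `i p α` and `i p β`; the factor
  -- clears the denominators, as `k` has a simple pole at `z = 0`
  set T : ℂ[X] := Λ * (C c₄ * K ^ 4 + C c₂ * K ^ 2 * X ^ 2 + C c₁ * K * X ^ 3 + C c₀ * X ^ 4)
    with hT
  set F₁ : ℂ[X] := C Complex.I * (C c₄ * (K ^ 5 + C (a 1 x) * K ^ 3 * X ^ 2
      + C (a 2 x) * K ^ 2 * X ^ 3 + C (a 3 x) * K * X ^ 4 + C (a 4 x) * X ^ 5)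
    + C c₂ * (K ^ 3 * X ^ 2 + C (a 1 x) * K * X ^ 4 + C (a 2 x) * X ^ 5)
    + C c₁ * (K ^ 2 * X ^ 3 + C (a 1 x) * X ^ 5) + C c₀ * K * X ^ 4) with hF₁
  set F₂ : ℂ[X] := C Complex.I * (C c₄ * (C (b 0 x) * K ^ 4 * X + C (b 1 x) * K ^ 3 * X ^ 2
      + C (b 2 x) * K ^ 2 * X ^ 3 + C (b 3 x) * K * X ^ 4 + C (b 4 x) * X ^ 5)
    + C c₂ * (C (b 0 x) * K ^ 2 * X ^ 3 + C (b 1 x) * K * X ^ 4 + C (b 2 x) * X ^ 5)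
    + C c₁ * (C (b 0 x) * K * X ^ 4 + C (b 1 x) * X ^ 5) + C c₀ * C (b 0 x) * X ^ 5) with hF₂
  let g₁ : ℂ → ℂ := fun k => Complex.I * (c₄ * (k ^ 5 + a 1 x * k ^ 3 + a 2 x * k ^ 2 + a 3 x * k
      + a 4 x) + c₂ * (k ^ 3 + a 1 x * k + a 2 x) + c₁ * (k ^ 2 + a 1 x) + c₀ * k)
  let g₂ : ℂ → ℂ := fun k => Complex.I * (c₄ * (b 0 x * k ^ 4 + b 1 x * k ^ 3 + b 2 x * k ^ 2
      + b 3 x * k + b 4 x) + c₂ * (b 0 x * k ^ 2 + b 1 x * k + b 2 x) + c₁ * (b 0 x * k + b 1 x)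
      + c₀ * b 0 x)
  have eT : ∀ z : ℂ, z ≠ 0 → T.eval z = z ^ 5 * (specLam D.q₀ z * (c₄ * specK D.q₀ z ^ 4
      + c₂ * specK D.q₀ z ^ 2 + c₁ * specK D.q₀ z + c₀)) := by
    intro z hz
    simp only [hT, eval_mul, eval_add, eval_pow, eval_X, eval_C, eΛ z hz, eK z hz]
    ring
  have eF₁ : ∀ z : ℂ, z ≠ 0 → F₁.eval z = z ^ 5 * g₁ (specK D.q₀ z) := by
    intro z hz
    simp only [hF₁, g₁, eval_mul, eval_add, eval_pow, eval_X, eval_C, eK z hz]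
    ring
  have eF₂ : ∀ z : ℂ, z ≠ 0 → F₂.eval z = z ^ 5 * g₂ (specK D.q₀ z) := by
    intro z hz
    simp only [hF₂, g₂, eval_mul, eval_add, eval_pow, eval_X, eval_C, eK z hz]
    ring
  clear_value T F₁ F₂
  have hWdeg : (X ^ 6 * D.polyEta).natDegree ≤ 4 * N + 1 + 5 := by
    refine natDegree_mul_le.trans ?_
    rw [natDegree_X_pow, natDegree_polyEta]; omega
  have hWdeg' : (X ^ 6 * D.polyHat).natDegree ≤ 4 * N + 1 + 5 := by
    refine natDegree_mul_le.trans ?_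
    rw [natDegree_X_pow, natDegree_polyHat]; omega
  have hsmall : ∀ {R W : ℂ[X]}, R.natDegree ≤ 4 * N → W.Monic → W.natDegree = 4 * N →
      Tendsto (fun z : ℝ => R.eval (z : ℂ) / (X * W).eval (z : ℂ)) atTop (𝓝 0) := by
    intro R W hR hW hWn
    have := isBigO_eval_div (R := R) (W := X * W) (n := 1)
      (by rw [monic_X.natDegree_mul hW, natDegree_X]; omega) (mul_ne_zero X_ne_zero hW.ne_zero)
    simp only [pow_one] at this
    exact this.trans_tendsto hinv0
  have limP := hsmall hdP D.monic_polyEta D.natDegree_polyEta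
  have limQ := hsmall hdQ D.monic_polyHat D.natDegree_polyHat
  have hzinv : Tendsto (fun z : ℝ => (z : ℂ)⁻¹) atTop (𝓝 0) := by
    simpa [Function.comp_def] using (Complex.continuous_ofReal.tendsto 0).comp hinv0
  have bfc : (fun z => conj (D.entryOne t x z)) =O[atTop] fun _ : ℝ => (1 : ℝ) :=
    (bf.norm_left.congr_left fun z => (Complex.norm_conj _).symm).of_norm_left
  have buc : (fun z => conj (D.entryTwo t x z)) =O[atTop] fun _ : ℝ => (1 : ℝ) :=
    (bu.norm_left.congr_left fun z => (Complex.norm_conj _).symm).of_norm_left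
  have hmul : ∀ {f g : ℝ → ℂ}, Tendsto f atTop (𝓝 0) → (g =O[atTop] fun _ : ℝ => (1 : ℝ)) →
      Tendsto (fun z => f z * g z) atTop (𝓝 0) := by
    intro f g hf hg
    have := ((Asymptotics.isLittleO_one_iff ℝ).2 hf).mul_isBigO hg
    exact (Asymptotics.isLittleO_one_iff ℝ).1 (by simpa using this)
  have key := h.deriv_eq_of_degree_lt (ξ := 0) (τ := 1) (xs := fun _ => x) (ts := fun s => s)
    (s := t) (m := 5) (c := D.coefT x t) (T := T) (F₁ := F₁) (F₂ := F₂)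
    (g₁ := fun z => g₁ (specK D.q₀ z)) (g₂ := fun z => g₂ (specK D.q₀ z))
    (h.hasDerivAt_coefT x t) (hasDerivAt_const t x) (hasDerivAt_id t)
    (fun z hz => by
      rw [eT z hz, phase, h₄, h₂, h₁, h₀]
      push_cast
      ring)
    eF₁ (fun z hz => by simp only [h.specK_inv hz]) eF₂ (fun z hz => by simp only [h.specK_inv hz])
  simp only [hdPd, hdQd] at key
  have key := key ?_ ?_
  · obtain ⟨r1, r2⟩ := key
    have r1 := congrArg (Polynomial.eval (D.q₀ : ℂ)) r1
    have r2 := congrArg (Polynomial.eval (D.q₀ : ℂ)) r2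
    have hq := h.q₀_ne
    have hl : specLam D.q₀ (D.q₀ : ℂ) = D.q₀ := by
      rw [specLam]; field_simp; norm_num
    have hk0 : specK D.q₀ (D.q₀ : ℂ) = 0 := by
      rw [specK]; field_simp; norm_num
    have hq5 : (D.q₀ : ℂ) ^ 5 ≠ 0 := pow_ne_zero _ hq
    simp only [eval_add, eval_sub, eval_mul, eval_pow, eval_X, eval_C, eval_neg, eval_conjP,
      Complex.conj_ofReal, eT _ hq, eF₁ _ hq, eF₂ _ hq, hl, hk0, g₁, g₂, eval_zero] at r1 r2
    constructor
    · refine mul_left_cancel₀ hq5 ?_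
      rw [hA₀, hB₀]
      linear_combination r1
    · refine mul_left_cancel₀ hq5 ?_
      rw [hA₀, hB₀]
      linear_combination r2
  · refine degree_lt_of_tendsto_div hWdeg ?_ ?_
    · filter_upwards [eventually_gt_atTop 0] with z hz
      simpa [hz.ne'] using h.eval_polyEta_ofReal_ne z
    -- `ψ (λ σ₃) = (λ ψ σ₃ ψ⁻¹) ψ` cancels the growing terms and leaves the truncation errors
    have lim := (limP.sub ((hmul tδ bf).const_mul Complex.I)).add
      ((hzinv.mul (hmul tβ buc)).const_mul Complex.I)
    simp only [mul_zero, sub_zero, add_zero] at lim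
    refine lim.congr' ?_
    filter_upwards [eventually_gt_atTop 0] with z hz
    have hz' : (z : ℂ) ≠ 0 := Complex.ofReal_ne_zero.2 hz.ne'
    have hη := h.eval_polyEta_ofReal_ne z
    have hl : specLam D.q₀ z = specK D.q₀ z + (D.q₀ : ℂ) ^ 2 / z := by
      simp only [specLam, specK]; ring
    simp only [eval_add, eval_sub, eval_mul, eval_pow, eval_X, eval_C, eval_neg, eval_conjP,
      Complex.conj_ofReal, eT _ hz', eF₁ _ hz', eF₂ _ hz', eu, ef _ hz.ne', map_mul,
      h.conj_eval_polyHat, g₁, g₂, hl, ofReal_realK]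
    field_simp
    ring
  · refine degree_lt_of_tendsto_div hWdeg' ?_ ?_
    · filter_upwards [eventually_gt_atTop 0] with z hz
      simpa [hz.ne'] using h.eval_polyHat_ofReal_ne z
    have lim := (limQ.sub ((hzinv.mul (hmul tδ bu)).const_mul Complex.I)).sub
      ((hmul tβ bfc).const_mul Complex.I)
    simp only [mul_zero, sub_zero] at lim
    refine lim.congr' ?_
    filter_upwards [eventually_gt_atTop 0] with z hz
    have hz' : (z : ℂ) ≠ 0 := Complex.ofReal_ne_zero.2 hz.ne'
    have hη := h.eval_polyHat_ofReal_ne z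
    have hl : specLam D.q₀ z = z - specK D.q₀ z := by
      simp only [specLam, specK]; ring
    have hd : (D.q₀ : ℂ) ^ 2 = (z : ℂ) ^ 2 * (D.entryOne t x z * conj (D.entryOne t x z))
      + D.entryTwo t x z * conj (D.entryTwo t x z) - (z : ℂ) ^ 2 := by
      rw [det z hz.ne']; ring
    simp only [eval_add, eval_mul, eval_pow, eval_X, eval_C, eval_conjP,
      Complex.conj_ofReal, eT _ hz', eF₁ _ hz', eF₂ _ hz', eu, ef _ hz.ne', map_mul,
      h.conj_eval_polyEta, g₁, g₂, hl, ofReal_realK, hd]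
    field_simp
    ring

end Admissible

end Data
/-! ### The equation from the compatibility of the Lax pair -/

/-- The recursion for the coefficients of the expansion has a solution for every smooth `q`. -/
theorem exists_isExpansion {c : ℝ} {q : ℝ → ℂ} (hq : ContDiff ℝ ∞ q) :
    ∃ a b, IsExpansion c q a b := by
  let b0 : ℝ → ℂ := fun x => Complex.I * q x
  let a1 : ℝ → ℂ := fun x => 1 / 2 * (c - b0 x * conj (b0 x))
  let b1 : ℝ → ℂ := fun x => Complex.I / 2 * deriv b0 x
  let a2 : ℝ → ℂ := fun x => 1 / 2 * -(b0 x * conj (b1 x) + b1 x * conj (b0 x))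
  let b2 : ℝ → ℂ := fun x => Complex.I / 2 * deriv b1 x + Complex.I * q x * a1 x
  let a3 : ℝ → ℂ := fun x => 1 / 2 * -(a1 x ^ 2 + b0 x * conj (b2 x) + b1 x * conj (b1 x)
    + b2 x * conj (b0 x))
  let b3 : ℝ → ℂ := fun x => Complex.I / 2 * deriv b2 x + Complex.I * q x * a2 x
  let a4 : ℝ → ℂ := fun x => 1 / 2 * -(2 * a1 x * a2 x + b0 x * conj (b3 x) + b1 x * conj (b2 x)
    + b2 x * conj (b1 x) + b3 x * conj (b0 x))
  let b4 : ℝ → ℂ := fun x => Complex.I / 2 * deriv b3 x + Complex.I * q x * a3 x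
  have s0 : ContDiff ℝ ∞ b0 := contDiff_const.mul hq
  have s0' := contDiff_conj s0
  have r1 : ContDiff ℝ ∞ a1 := by fun_prop
  have s1 : ContDiff ℝ ∞ b1 := contDiff_const.mul (contDiff_deriv s0)
  have s1' := contDiff_conj s1
  have r2 : ContDiff ℝ ∞ a2 := by fun_prop
  have s2 : ContDiff ℝ ∞ b2 := by have := contDiff_deriv s1; fun_prop
  have s2' := contDiff_conj s2
  have r3 : ContDiff ℝ ∞ a3 := by fun_prop
  have s3 : ContDiff ℝ ∞ b3 := by have := contDiff_deriv s2; fun_prop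
  have s3' := contDiff_conj s3
  have r4 : ContDiff ℝ ∞ a4 := by fun_prop
  have s4 : ContDiff ℝ ∞ b4 := by have := contDiff_deriv s3; fun_prop
  let a : ℕ → ℝ → ℂ
    | 1 => a1
    | 2 => a2
    | 3 => a3
    | 4 => a4
    | _ => fun _ => 0
  let b : ℕ → ℝ → ℂ
    | 0 => b0
    | 1 => b1
    | 2 => b2
    | 3 => b3
    | 4 => b4
    | _ => fun _ => 0
  have hhalf : ∀ w : ℂ, 2 * (1 / 2 * w) = w := fun w => by ring
  refine ⟨a, b, ?_, ?_, hq, fun _ => rfl, fun _ => rfl, fun _ => rfl, fun _ => rfl, fun _ => rfl,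
    fun _ => hhalf _, fun _ => hhalf _, fun _ => hhalf _, fun _ => hhalf _⟩
  · rintro (_ | _ | _ | _ | _ | _) <;> first | assumption | exact contDiff_const
  · rintro (_ | _ | _ | _ | _ | _) <;> first | assumption | exact contDiff_const

theorem iteratedDeriv_hasDerivAt {q : ℝ → ℂ} (hq : ContDiff ℝ ∞ q) (n : ℕ) (x : ℝ) :
    HasDerivAt (iteratedDeriv n q) (iteratedDeriv (n + 1) q x) x := by
  have : Differentiable ℝ (iteratedDeriv n q) :=
    hq.differentiable_iteratedDeriv n (by exact_mod_cast ENat.natCast_lt_top n)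
  rw [iteratedDeriv_succ]
  exact (this x).hasDerivAt

/-- The coefficient of `k ^ 0` of the zero curvature condition, in terms of `q`. -/
theorem IsExpansion.flow {ε c : ℝ} {q : ℝ → ℂ} {a b : ℕ → ℝ → ℂ} (he : IsExpansion c q a b)
    (x : ℝ) :
    2 * q x * (16 * ε * a 4 x + -8 * ε * c * a 2 x + 2 * a 1 x)
        + (16 * ε * deriv (b 4) x + -8 * ε * c * deriv (b 2) x + 2 * deriv (b 1) x
          + (6 * ε * c ^ 2 + 1) * deriv (b 0) x)
      = -(2 * ((‖q x‖ ^ 2 - c : ℝ) : ℂ) * q x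
      - Complex.I * ε * iteratedDeriv 5 q x
      - 10 * Complex.I * ε * ((‖q x‖ ^ 2 : ℝ) : ℂ) * iteratedDeriv 3 q x
      - 20 * Complex.I * ε * deriv q x * conj (q x) * iteratedDeriv 2 q x
      - 30 * Complex.I * ε * ((‖q x‖ ^ 4 : ℝ) : ℂ) * deriv q x
      - 10 * Complex.I * ε * deriv (fun y => ((‖deriv q y‖ ^ 2 : ℝ) : ℂ) * q y) x
      + iteratedDeriv 2 q x - Complex.I * deriv q x) := by
  have hI := Complex.I_sq
  have d : ∀ n y, HasDerivAt (iteratedDeriv n q) (iteratedDeriv (n + 1) q y) y :=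
    iteratedDeriv_hasDerivAt he.smooth_q
  have d' : ∀ n y, HasDerivAt (fun y => conj (iteratedDeriv n q y))
      (conj (iteratedDeriv (n + 1) q y)) y := fun n y => (d n y).star
  have e0 : q = iteratedDeriv 0 q := iteratedDeriv_zero.symm
  have e1 : deriv q = iteratedDeriv 1 q := iteratedDeriv_one.symm
  have hn : ∀ w : ℂ, ((‖w‖ ^ 2 : ℝ) : ℂ) = w * conj w := fun w => by
    rw [Complex.mul_conj']; push_cast; rfl
  have hn4 : ∀ w : ℂ, ((‖w‖ ^ 4 : ℝ) : ℂ) = (w * conj w) ^ 2 := fun w => by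
    rw [Complex.mul_conj']; push_cast; ring
  rw [e1]
  simp only [Complex.ofReal_sub, hn, hn4]
  have eq0 : ∀ y, q y = iteratedDeriv 0 q y := fun y => congrFun e0 y
  obtain ⟨Q, hQ⟩ : ∃ Q : ℕ → ℝ → ℂ, Q = fun n => iteratedDeriv n q := ⟨_, rfl⟩
  have hQ' : ∀ n, iteratedDeriv n q = Q n := fun n => by rw [hQ]
  simp only [hQ'] at d d' eq0 ⊢
  simp only [eq0]
  have hb0 := he.b0
  have hb1 := he.b1
  have hb2 := he.b2
  have hb3 := he.b3
  have hb4 := he.b4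
  have ha1 := he.a1
  have ha2 := he.a2
  have ha3 := he.a3
  have ha4 := he.a4
  simp only [eq0] at hb0 hb1 hb2 hb3 hb4
  -- the coefficients `b_j`, `a_j` as differential polynomials `f_j`, `x_j` in `q`, and the
  -- derivatives `g_j` of the `b_j`
  have f0 : b 0 = fun y => Complex.I * Q 0 y := funext hb0
  have g0 : ∀ y, deriv (b 0) y = Complex.I * Q 1 y := fun y => by
    rw [f0]; exact ((d 0 y).const_mul _).deriv
  have f1 : b 1 = fun y => -(1 / 2) * Q 1 y := by
    funext y; rw [hb1, g0]; linear_combination Q 1 y / 2 * hI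
  have g1 : ∀ y, deriv (b 1) y = -(1 / 2) * Q 2 y := fun y => by
    rw [f1]; exact ((d 1 y).const_mul _).deriv
  have x1 : a 1 = fun y => 1 / 2 * (c - Q 0 y * conj (Q 0 y)) := by
    funext y
    have := ha1 y
    simp only [f0, map_mul, Complex.conj_I] at this
    linear_combination this / 2 + Q 0 y * conj (Q 0 y) / 2 * hI
  have x2 : a 2 = fun y => Complex.I / 4 * (Q 0 y * conj (Q 1 y) - Q 1 y * conj (Q 0 y)) := by
    funext y
    have := ha2 y
    simp only [f0, f1, map_mul, Complex.conj_I, map_neg, map_div₀, map_one, _root_.map_ofNat]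
      at this
    linear_combination this / 2
  have f2 : b 2 = fun y => -(Complex.I / 4) * Q 2 y
      + Complex.I / 2 * (c * Q 0 y - Q 0 y * Q 0 y * conj (Q 0 y)) := by
    funext y; rw [hb2, g1, x1]; ring
  have g2 : ∀ y, deriv (b 2) y = -(Complex.I / 4) * Q 3 y
      + Complex.I / 2 * (c * Q 1 y - 2 * Q 0 y * Q 1 y * conj (Q 0 y)
        - Q 0 y * Q 0 y * conj (Q 1 y)) := fun y => by
    rw [f2]
    refine HasDerivAt.deriv ((((d 2 y).const_mul _).add ((((d 0 y).const_mul _).sub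
      (((d 0 y).mul (d 0 y)).mul (d' 0 y))).const_mul _)).congr_deriv ?_)
    simp only [Pi.mul_apply]
    ring
  have f3 : b 3 = fun y => 1 / 8 * Q 3 y - c / 4 * Q 1 y
      + 3 / 4 * (Q 0 y * Q 1 y * conj (Q 0 y)) := by
    funext y; rw [hb3, g2, x2]
    linear_combination (-Q 3 y / 8 + c / 4 * Q 1 y - 3 / 4 * (Q 0 y * Q 1 y * conj (Q 0 y))) * hI
  have g3 : ∀ y, deriv (b 3) y = 1 / 8 * Q 4 y - c / 4 * Q 2 y
      + 3 / 4 * (Q 1 y * Q 1 y * conj (Q 0 y) + Q 0 y * Q 2 y * conj (Q 0 y)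
        + Q 0 y * Q 1 y * conj (Q 1 y)) := fun y => by
    rw [f3]
    refine HasDerivAt.deriv (((((d 3 y).const_mul _).sub ((d 1 y).const_mul _)).add
      ((((d 0 y).mul (d 1 y)).mul (d' 0 y)).const_mul _)).congr_deriv ?_)
    simp only [Pi.mul_apply]
    ring
  have x3 : a 3 = fun y => -(1 / 8) * (c * c) - c / 4 * (Q 0 y * conj (Q 0 y))
      + 3 / 8 * (Q 0 y * Q 0 y * (conj (Q 0 y) * conj (Q 0 y)))
      + 1 / 8 * (Q 0 y * conj (Q 2 y) + Q 2 y * conj (Q 0 y) - Q 1 y * conj (Q 1 y)) := by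
    funext y
    have := ha3 y
    simp only [f0, f1, f2, x1, map_mul, map_add, map_sub, Complex.conj_I, map_neg, map_div₀,
      map_one, _root_.map_ofNat, Complex.conj_ofReal, Complex.conj_conj] at this
    linear_combination this / 2 + (c * (Q 0 y * conj (Q 0 y)) / 2 - 1 / 8 * (Q 0 y * conj (Q 2 y)
      + Q 2 y * conj (Q 0 y)) - 1 / 2 * (Q 0 y * Q 0 y * (conj (Q 0 y) * conj (Q 0 y)))) * hI
  have f4 : b 4 = fun y => Complex.I / 2 * (1 / 8 * Q 4 y - c / 4 * Q 2 y
      + 3 / 4 * (Q 1 y * Q 1 y * conj (Q 0 y) + Q 0 y * Q 2 y * conj (Q 0 y)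
        + Q 0 y * Q 1 y * conj (Q 1 y))) + Complex.I * Q 0 y * a 3 y := by
    funext y; rw [hb4, g3]
  have y3 : ∀ y, HasDerivAt (a 3) (-(c / 4) * (Q 1 y * conj (Q 0 y) + Q 0 y * conj (Q 1 y))
      + 3 / 4 * (Q 0 y * Q 1 y * (conj (Q 0 y) * conj (Q 0 y))
        + Q 0 y * Q 0 y * (conj (Q 0 y) * conj (Q 1 y)))
      + 1 / 8 * (Q 0 y * conj (Q 3 y) + Q 3 y * conj (Q 0 y))) y := fun y => by
    rw [x3]
    refine (((((hasDerivAt_const y (-(1 / 8) * ((c : ℂ) * c))).sub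
      (((d 0 y).mul (d' 0 y)).const_mul _)).add ((((d 0 y).mul (d 0 y)).mul
      ((d' 0 y).mul (d' 0 y))).const_mul _)).add (((((d 0 y).mul (d' 2 y)).add
      ((d 2 y).mul (d' 0 y))).sub ((d 1 y).mul (d' 1 y))).const_mul _)).congr_deriv ?_)
    simp only [Pi.mul_apply]
    ring
  have g4 : ∀ y, deriv (b 4) y = Complex.I / 2 * (1 / 8 * Q 5 y - c / 4 * Q 3 y
      + 3 / 4 * (2 * Q 1 y * Q 2 y * conj (Q 0 y) + Q 1 y * Q 1 y * conj (Q 1 y)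
        + Q 1 y * Q 2 y * conj (Q 0 y) + Q 0 y * Q 3 y * conj (Q 0 y)
        + Q 0 y * Q 2 y * conj (Q 1 y) + Q 1 y * Q 1 y * conj (Q 1 y)
        + Q 0 y * Q 2 y * conj (Q 1 y) + Q 0 y * Q 1 y * conj (Q 2 y)))
      + Complex.I * Q 1 y * a 3 y
      + Complex.I * Q 0 y * (-(c / 4) * (Q 1 y * conj (Q 0 y) + Q 0 y * conj (Q 1 y))
      + 3 / 4 * (Q 0 y * Q 1 y * (conj (Q 0 y) * conj (Q 0 y))
        + Q 0 y * Q 0 y * (conj (Q 0 y) * conj (Q 1 y)))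
      + 1 / 8 * (Q 0 y * conj (Q 3 y) + Q 3 y * conj (Q 0 y))) := fun y => by
    rw [f4]
    refine HasDerivAt.deriv (((((((d 4 y).const_mul _).sub ((d 2 y).const_mul _)).add
      (((((d 1 y).mul (d 1 y)).mul (d' 0 y)).add (((d 0 y).mul (d 2 y)).mul (d' 0 y))).add
        (((d 0 y).mul (d 1 y)).mul (d' 1 y)) |>.const_mul _)).const_mul _).add
      (((d 0 y).const_mul _).mul (y3 y))).congr_deriv ?_)
    simp only [Pi.mul_apply]
    ring
  have gq : deriv (fun y => Q 1 y * conj (Q 1 y) * Q 0 y) x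
      = Q 2 x * conj (Q 1 x) * Q 0 x + Q 1 x * conj (Q 2 x) * Q 0 x
        + Q 1 x * conj (Q 1 x) * Q 1 x := by
    refine HasDerivAt.deriv ((((d 1 x).mul (d' 1 x)).mul (d 0 x)).congr_deriv ?_)
    simp only [Pi.mul_apply]
    ring
  have x4 := ha4 x
  simp only [f0, f1, f2, f3, x1, x2, map_mul, map_add, map_sub, Complex.conj_I, map_neg, map_div₀,
      map_one, _root_.map_ofNat, Complex.conj_ofReal, Complex.conj_conj] at x4
  rw [g4, g2, g1, g0, gq, x3, x2, x1]
  linear_combination 16 * ε * Q 0 x * x4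

/-- Equality of the mixed partial derivatives. -/
theorem deriv_deriv_comm {f : ℝ × ℝ → ℂ} (hf : ContDiff ℝ ∞ f) (x t : ℝ) :
    deriv (fun s => deriv (fun y => f (y, s)) x) t
      = deriv (fun y => deriv (fun s => f (y, s)) t) x := by
  have hd : Differentiable ℝ f := hf.differentiable (by simp)
  have hd2 : Differentiable ℝ (fderiv ℝ f) :=
    (hf.fderiv_right (m := ∞) (by simp)).differentiable (by simp)
  have c1 : ∀ y s : ℝ, HasDerivAt (fun y => (y, s)) ((1 : ℝ), (0 : ℝ)) y := fun y s =>
    (hasDerivAt_id y).prodMk (hasDerivAt_const y s)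
  have c2 : ∀ y s : ℝ, HasDerivAt (fun s => (y, s)) ((0 : ℝ), (1 : ℝ)) s := fun y s =>
    (hasDerivAt_const s y).prodMk (hasDerivAt_id s)
  have e1 : ∀ y s : ℝ, deriv (fun y => f (y, s)) y = fderiv ℝ f (y, s) (1, 0) := fun y s =>
    ((hd (y, s)).hasFDerivAt.comp_hasDerivAt y (c1 y s)).deriv
  have e2 : ∀ y s : ℝ, deriv (fun s => f (y, s)) s = fderiv ℝ f (y, s) (0, 1) := fun y s =>
    ((hd (y, s)).hasFDerivAt.comp_hasDerivAt s (c2 y s)).deriv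
  simp only [e1, e2]
  have e : ∀ {γ : ℝ → ℝ × ℝ} {v : ℝ × ℝ} {r : ℝ} (u : ℝ × ℝ), HasDerivAt γ v r →
      HasDerivAt (fun s => fderiv ℝ f (γ s) u) (fderiv ℝ (fderiv ℝ f) (γ r) v u) r := by
    intro γ v r u hγ
    have h1 : HasDerivAt (fun s => fderiv ℝ f (γ s)) (fderiv ℝ (fderiv ℝ f) (γ r) v) r :=
      (hd2 (γ r)).hasFDerivAt.comp_hasDerivAt r hγ
    exact (ContinuousLinearMap.apply ℝ ℂ u).hasFDerivAt.comp_hasDerivAt r h1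
  rw [(e (1, 0) (c2 x t)).deriv, (e (0, 1) (c1 x t)).deriv]
  exact (hf.contDiffAt.isSymmSndFDerivAt (by simpa using WithTop.coe_le_coe.2 (le_top (a := (2 : ℕ∞))))) _ _

theorem SolvesIfoNLS.neg {ε c : ℝ} {q : ℝ → ℝ → ℂ} (h : SolvesIfoNLS ε c q) :
    SolvesIfoNLS ε c fun x t => -q x t := by
  intro x t
  have := h x t
  simp only [deriv.fun_neg, iteratedDeriv_fun_neg, norm_neg, map_neg, mul_neg]
  linear_combination -this

/-- Multiplication by `e^{2ict}` removes the constant `c` from the equation. -/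
theorem SolvesIfoNLS.gauge {ε c : ℝ} {q : ℝ → ℝ → ℂ} (h : SolvesIfoNLS ε c q)
    (hd : ∀ x t, DifferentiableAt ℝ (fun s => q x s) t) :
    SolvesIfoNLS ε 0 fun x t => q x t * Complex.exp (2 * Complex.I * c * t) := by
  intro x t
  have hE : ∀ s : ℝ, ‖Complex.exp (2 * Complex.I * c * s)‖ = 1 := fun s => by
    rw [show 2 * Complex.I * c * s = ((2 * c * s : ℝ) : ℂ) * Complex.I by push_cast; ring]
    exact Complex.norm_exp_ofReal_mul_I _
  have hEE : Complex.exp (2 * Complex.I * c * t) * conj (Complex.exp (2 * Complex.I * c * t)) = 1 := by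
    rw [Complex.mul_conj', hE]; norm_num
  have ht : deriv (fun s : ℝ => q x s * Complex.exp (2 * Complex.I * c * s)) t
      = (deriv (fun s => q x s) t + 2 * Complex.I * c * q x t)
        * Complex.exp (2 * Complex.I * c * t) := by
    have h1 : HasDerivAt (fun s : ℝ => 2 * Complex.I * c * (s : ℂ)) (2 * Complex.I * c) t := by
      simpa using (Complex.ofRealCLM.hasDerivAt (x := t)).const_mul (2 * Complex.I * c)
    refine HasDerivAt.deriv (((hd x t).hasDerivAt.mul h1.cexp).congr_deriv ?_)
    ring
  have hi : ∀ n, iteratedDeriv n (fun y => q y t * Complex.exp (2 * Complex.I * c * t)) x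
      = iteratedDeriv n (fun y => q y t) x * Complex.exp (2 * Complex.I * c * t) := fun n => by
    simp [mul_comm _ (Complex.exp _)]
  have h0 := h x t
  simp only [ht, hi, deriv_mul_const_field, norm_mul, hE, mul_one, map_mul, ← mul_assoc]
  push_cast at h0 ⊢
  linear_combination Complex.exp (2 * Complex.I * c * t) * h0
    + (2 * c * q x t * Complex.exp (2 * Complex.I * c * t)) * Complex.I_sq
    - 20 * Complex.I * ε * Complex.exp (2 * Complex.I * c * t) * deriv (fun y => q y t) x
      * conj (q x t) * iteratedDeriv 2 (fun y => q y t) x * hEE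

namespace Data

variable {N : ℕ} {D : Data N}

namespace Admissible

variable (h : D.Admissible)
include h

theorem contDiff_numP_eval (z : ℂ) :
    ContDiff ℝ ∞ fun p : ℝ × ℝ => (D.numP p.1 p.2).eval z := by
  simp only [numP_eq_add_sum, eval_add, eval_finsetSum, eval_smul, smul_eq_mul]
  exact contDiff_const.add (ContDiff.sum fun i _ => (h.contDiff_coefOf i).mul contDiff_const)

theorem contDiff_numQ_eval (z : ℂ) :
    ContDiff ℝ ∞ fun p : ℝ × ℝ => (D.numQ p.1 p.2).eval z := by
  simp only [numQ, sndNum, eval_add, eval_finsetSum, eval_smul, smul_eq_mul]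
  exact contDiff_const.add (ContDiff.sum fun i _ => (h.contDiff_coefOf i).mul contDiff_const)

/-- The Jost row does not vanish at `z = q₀`, where `k = 0`. -/
theorem num_k_zero_ne (x t : ℝ) :
    (D.numP x t).eval (D.q₀ : ℂ) * conj ((D.numP x t).eval (D.q₀ : ℂ))
      + (D.numQ x t).eval (D.q₀ : ℂ) * conj ((D.numQ x t).eval (D.q₀ : ℂ)) ≠ 0 := by
  have h1 := congrArg (Polynomial.eval (D.q₀ : ℂ)) (h.det_num x t)
  simp only [eval_add, eval_mul, eval_conjP, Complex.conj_ofReal, eval_pow, eval_X, eval_C] at h1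
  rw [h1]
  have hq := h.q₀_ne
  refine mul_ne_zero ?_ (mul_ne_zero (h.eval_polyEta_ofReal_ne _) (h.eval_polyHat_ofReal_ne _))
  rw [← two_mul]
  exact mul_ne_zero two_ne_zero (pow_ne_zero _ hq)

theorem hasDerivAt_q_t (x t : ℝ) : HasDerivAt (fun s => D.q x s) (deriv (fun s => D.q x s) t) t := by
  have : ContDiff ℝ ∞ fun s : ℝ => D.q x s :=
    ContDiff.comp (g := fun p : ℝ × ℝ => D.q p.1 p.2)
      (f := fun s : ℝ => (x, s)) h.contDiff_q (contDiff_const.prodMk contDiff_id)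
  exact (this.differentiable (by simp) t).hasDerivAt

/-- The mixed derivatives of the numerators at `z = q₀` agree, which is the equation. -/
theorem solves : SolvesIfoNLS D.ε (D.q₀ ^ 2) D.q := by
  intro x t
  obtain ⟨a, b, he⟩ := exists_isExpansion (c := D.q₀ ^ 2) (h.contDiff_q_x t)
  have hflow := he.flow (ε := D.ε) x
  set Q₀ : ℂ := (D.q₀ : ℂ) with hQ₀
  set c₀ : ℂ := 6 * D.ε * Q₀ ^ 4 + 1 with hc₀
  set A : ℝ → ℂ := fun y => 16 * D.ε * a 4 y + -8 * D.ε * Q₀ ^ 2 * a 2 y + 2 * a 1 y with hA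
  set B : ℝ → ℂ := fun y => 16 * D.ε * b 4 y + -8 * D.ε * Q₀ ^ 2 * b 2 y + 2 * b 1 y
    + c₀ * b 0 y with hB
  set A' : ℂ := deriv A x
  set B' : ℂ := 16 * D.ε * deriv (b 4) x + -8 * D.ε * Q₀ ^ 2 * deriv (b 2) x + 2 * deriv (b 1) x
    + c₀ * deriv (b 0) x with hB'
  have dA : HasDerivAt A A' x := by
    have := he.smooth_a
    have : ContDiff ℝ ∞ A := by fun_prop
    exact (this.differentiable (by simp) x).hasDerivAt
  have dB : HasDerivAt B B' x := by
    have d : ∀ j, HasDerivAt (b j) (deriv (b j) x) x := fun j =>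
      ((he.smooth_b j).differentiable (by simp) x).hasDerivAt
    exact ((((d 4).const_mul _).add ((d 2).const_mul _)).add ((d 1).const_mul _)).add
      ((d 0).const_mul _)
  -- the diagonal coefficients are real, which removes `A'` from the combination below
  have hAr : ∀ y, conj (A y) = A y := by
    intro y
    have r1 : conj (a 1 y) = a 1 y := by
      have h1 := he.a1 y
      have h2 := congrArg conj h1
      simp only [map_mul, map_sub, Complex.conj_ofReal, Complex.conj_conj, _root_.map_ofNat] at h2
      linear_combination (h2 - h1) / 2
    have r2 : conj (a 2 y) = a 2 y := by
      have h1 := he.a2 y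
      have h2 := congrArg conj h1
      simp only [map_mul, map_neg, map_add, Complex.conj_conj, _root_.map_ofNat] at h2
      linear_combination (h2 - h1) / 2
    have r4 : conj (a 4 y) = a 4 y := by
      have h1 := he.a4 y
      have h2 := congrArg conj h1
      simp only [map_mul, map_neg, map_add, Complex.conj_conj, _root_.map_ofNat, r1, r2] at h2
      linear_combination (h2 - h1) / 2
    simp only [hA, hQ₀, map_add, map_mul, map_pow, map_neg, Complex.conj_ofReal,
      _root_.map_ofNat, r1, r2, r4]
  have hc : conj c₀ = c₀ := by
    simp only [hc₀, hQ₀, map_add, map_mul, map_pow, Complex.conj_ofReal, _root_.map_ofNat, map_one]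
  have hq : Q₀ ≠ 0 := h.q₀_ne
  -- the Lax pair at `k = 0`
  set P : ℝ → ℝ → ℂ := fun y s => (D.numP y s).eval Q₀ with hP
  set Q : ℝ → ℝ → ℂ := fun y s => (D.numQ y s).eval Q₀ with hQ
  have px : ∀ y s, HasDerivAt (fun y => P y s)
      (Complex.I * Q₀ * P y s - D.q y s * conj (Q y s)) y := fun y s => by
    have l := congrArg (Polynomial.eval Q₀) (h.lax_x y s).1
    simp only [eval_sub, eval_mul, eval_conjP, hQ₀, Complex.conj_ofReal, eval_X, eval_C] at l
    refine ((hasPolyDerivAt_numP (xs := fun y => y) (ts := fun _ => s)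
      (h.hasDerivAt_coefX y s)).eval Q₀).congr_deriv ?_
    refine mul_left_cancel₀ hq ?_
    simp only [hP, hQ, hQ₀]
    linear_combination l
  have qx : ∀ y s, HasDerivAt (fun y => Q y s)
      (-(Complex.I * Q₀ * Q y s) + D.q y s * conj (P y s)) y := fun y s => by
    have l := congrArg (Polynomial.eval Q₀) (h.lax_x y s).2
    simp only [eval_add, eval_neg, eval_mul, eval_conjP, hQ₀, Complex.conj_ofReal, eval_X,
      eval_C] at l
    exact ((hasPolyDerivAt_numQ (xs := fun y => y) (ts := fun _ => s)
      (h.hasDerivAt_coefX y s)).eval Q₀).congr_deriv l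
  have pt : ∀ y, HasDerivAt (fun s => P y s)
      (Complex.I * (Q₀ * c₀ - A y) * P y t + Complex.I * B y * conj (Q y t)) t := fun y => by
    refine ((hasPolyDerivAt_numP (xs := fun _ => y) (ts := fun s => s)
      (h.hasDerivAt_coefT y t)).eval Q₀).congr_deriv ?_
    exact (h.lax_t_k_zero y t he rfl rfl rfl rfl rfl rfl).1
  have qt : ∀ y, HasDerivAt (fun s => Q y s)
      (-(Complex.I * (Q₀ * c₀ + A y)) * Q y t - Complex.I * B y * conj (P y t)) t := fun y => by
    refine ((hasPolyDerivAt_numQ (xs := fun _ => y) (ts := fun s => s)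
      (h.hasDerivAt_coefT y t)).eval Q₀).congr_deriv ?_
    exact (h.lax_t_k_zero y t he rfl rfl rfl rfl rfl rfl).2
  have ut := h.hasDerivAt_q_t x t
  set u := D.q x t with hu
  set u' := deriv (fun s => D.q x s) t
  have cP : deriv (fun s => deriv (fun y => P y s) x) t = deriv (fun y => deriv (fun s => P y s) t) x :=
    deriv_deriv_comm (h.contDiff_numP_eval Q₀) x t
  have cQ : deriv (fun s => deriv (fun y => Q y s) x) t = deriv (fun y => deriv (fun s => Q y s) t) x :=
    deriv_deriv_comm (h.contDiff_numQ_eval Q₀) x t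
  have hne : P x t * conj (P x t) + Q x t * conj (Q x t) ≠ 0 := h.num_k_zero_ne x t
  simp only [(px _ _).deriv, (pt _).deriv] at cP
  simp only [(qx _ _).deriv, (qt _).deriv] at cQ
  have d1 : HasDerivAt (fun s => Complex.I * Q₀ * P x s - D.q x s * conj (Q x s)) _ t :=
    ((pt x).const_mul (Complex.I * Q₀)).sub (ut.mul (qt x).star)
  have d2 : HasDerivAt (fun y => Complex.I * (Q₀ * c₀ - A y) * P y t
      + Complex.I * B y * conj (Q y t)) _ x :=
    (((dA.const_sub (Q₀ * c₀)).const_mul Complex.I).mul (px x t)).add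
      ((dB.const_mul Complex.I).mul (qx x t).star)
  have d3 : HasDerivAt (fun s => -(Complex.I * Q₀ * Q x s) + D.q x s * conj (P x s)) _ t :=
    ((qt x).const_mul (Complex.I * Q₀)).neg.add (ut.mul (pt x).star)
  have d4 : HasDerivAt (fun y => -(Complex.I * (Q₀ * c₀ + A y)) * Q y t
      - Complex.I * B y * conj (P y t)) _ x :=
    (((dA.const_add (Q₀ * c₀)).const_mul Complex.I).neg.mul (qx x t)).sub
      ((dB.const_mul Complex.I).mul (px x t).star)
  rw [d1.deriv, d2.deriv] at cP
  rw [d3.deriv, d4.deriv] at cQ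
  have hcQ : conj Q₀ = Q₀ := Complex.conj_ofReal _
  simp only [← starRingEnd_apply, map_add, map_sub, map_mul, map_neg, Complex.conj_I,
    Complex.conj_conj, hAr, hc, hcQ, ← hu, Pi.neg_apply] at cP cQ
  -- the compatibility conditions are `conj P` and `conj Q` times this expression
  have hW : u' + 2 * Complex.I * u * A x + Complex.I * B' = 0 := by
    refine (mul_eq_zero.1 ?_).resolve_left hne
    linear_combination P x t * cQ - Q x t * cP
  push_cast at hflow ⊢
  simp only [hA, hB', hc₀] at hW
  simp only [hQ₀] at hW
  linear_combination Complex.I * hW + hflow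
    - (2 * u * (16 * D.ε * a 4 x + -8 * D.ε * (D.q₀ : ℂ) ^ 2 * a 2 x + 2 * a 1 x)
      + (16 * D.ε * deriv (b 4) x + -8 * D.ε * (D.q₀ : ℂ) ^ 2 * deriv (b 2) x + 2 * deriv (b 1) x
      + (6 * D.ε * (D.q₀ : ℂ) ^ 4 + 1) * deriv (b 0) x)) * Complex.I_sq

end Admissible

end Data

/-! ### Limits at the two ends of the line -/

/-- The polynomial of degree at most `n` with given coefficients. -/
noncomputable def ofCoeffs (n : ℕ) : (Fin (n + 1) → ℂ) →ₗ[ℂ] ℂ[X] :=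
  ∑ j : Fin (n + 1), (Polynomial.monomial (j : ℕ)).comp (LinearMap.proj j)

theorem ofCoeffs_apply (n : ℕ) (c : Fin (n + 1) → ℂ) :
    ofCoeffs n c = ∑ j : Fin (n + 1), Polynomial.monomial (j : ℕ) (c j) := by
  simp [ofCoeffs]

theorem coeff_ofCoeffs (n : ℕ) (c : Fin (n + 1) → ℂ) (j : Fin (n + 1)) :
    (ofCoeffs n c).coeff j = c j := by
  rw [ofCoeffs_apply, finsetSum_coeff, Finset.sum_eq_single j]
  · simp
  · intro i _ hi
    rw [coeff_monomial, if_neg (fun e => hi (Fin.ext e))]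
  · simp

theorem ofCoeffs_coeff {n : ℕ} {R : ℂ[X]} (hR : R.natDegree ≤ n) :
    ofCoeffs n (fun j => R.coeff j) = R := by
  rw [ofCoeffs_apply, Fin.sum_univ_eq_sum_range (fun j => Polynomial.monomial j (R.coeff j))]
  exact (R.as_sum_range' _ (Nat.lt_succ_of_le hR)).symm

theorem natDegree_ofCoeffs_le (n : ℕ) (c : Fin (n + 1) → ℂ) : (ofCoeffs n c).natDegree ≤ n := by
  rw [ofCoeffs_apply]
  exact natDegree_sum_le_of_forall_le _ _ fun j _ =>
    (natDegree_monomial_le _).trans (Nat.lt_succ_iff.1 j.2)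

/-- If the values and derivatives of `Q` at the points `a i` are small multiples of those of
`Φ Q`, then `Q` tends to the polynomial with zeros of order two at these points and with the same
value at `0`. -/
theorem tendsto_of_jets {α ι : Type*} [Fintype ι] {l : Filter α} {n : ℕ} {a : ι → ℂ}
    (ha : Function.Injective a) (ha0 : ∀ i, a i ≠ 0) (hn : n = 2 * Fintype.card ι)
    {Φ : ℂ[X] →ₗ[ℂ] ℂ[X]} {W : ℂ[X]} {Q : α → ℂ[X]} (hW : W.natDegree ≤ n)
    (hQ : ∀ x, (Q x).natDegree ≤ n) (h0 : ∀ x, (Q x).eval 0 = W.eval 0)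
    (hWa : ∀ i, (X - C (a i)) ^ 2 ∣ W) {δ₁ δ₂ δ₃ : ι → α → ℂ}
    (hδ₁ : ∀ i, Tendsto (δ₁ i) l (𝓝 0)) (hδ₂ : ∀ i, Tendsto (δ₂ i) l (𝓝 0))
    (hδ₃ : ∀ i, Tendsto (δ₃ i) l (𝓝 0))
    (hv : ∀ i x, (Q x).eval (a i) = δ₁ i x * (Φ (Q x)).eval (a i))
    (hd : ∀ i x, (derivative (Q x)).eval (a i)
      = δ₂ i x * (Φ (Q x)).eval (a i) + δ₃ i x * (derivative (Φ (Q x))).eval (a i))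
    (L : ℂ[X] →ₗ[ℂ] ℂ) : Tendsto (fun x => L (Q x)) l (𝓝 (L W)) := by
  let ev : ℂ → ℂ[X] →ₗ[ℂ] ℂ := fun z => Polynomial.leval z
  let dv : ℂ → ℂ[X] →ₗ[ℂ] ℂ := fun z => (Polynomial.leval z).comp Polynomial.derivative
  -- the value at `0` and the jets at the points `a i`; by the count of zeros it is injective
  let J : (Fin (n + 1) → ℂ) →ₗ[ℂ] (Unit ⊕ (ι ⊕ ι) → ℂ) :=
    LinearMap.pi (Sum.elim (fun _ => (ev 0).comp (ofCoeffs n))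
      (Sum.elim (fun i => (ev (a i)).comp (ofCoeffs n)) fun i => (dv (a i)).comp (ofCoeffs n)))
  have hJ : LinearMap.ker J = ⊥ := by
    rw [LinearMap.ker_eq_bot']
    intro c hc
    have j0 : (ofCoeffs n c).eval 0 = 0 := congrFun hc (Sum.inl ())
    have j1 : ∀ i, (ofCoeffs n c).eval (a i) = 0 := fun i => congrFun hc (Sum.inr (Sum.inl i))
    have j2 : ∀ i, (derivative (ofCoeffs n c)).eval (a i) = 0 := fun i =>
      congrFun hc (Sum.inr (Sum.inr i))
    have hdvd := prod_sq_dvd ha fun i => (sq_dvd_iff_eval (a i) _).2 ⟨j1 i, j2 i⟩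
    have hX : (X : ℂ[X]) ∣ ofCoeffs n c := by
      rw [X_dvd_iff, coeff_zero_eq_eval_zero, j0]
    have hcop : IsCoprime (X : ℂ[X]) (∏ i, (X - C (a i)) ^ 2) := by
      refine IsCoprime.prod_right fun i _ => IsCoprime.pow_right ?_
      have := isCoprime_X_sub_C_of_isUnit_sub (a := (0 : ℂ)) (b := a i)
        (by simpa using ha0 i)
      simpa using this
    have hmul := hcop.mul_dvd hX hdvd
    have hm : (∏ i, (X - C (a i)) ^ 2 : ℂ[X]).Monic :=
      monic_prod_of_monic _ _ fun i _ => (monic_X_sub_C _).pow 2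
    have hdeg : (X * ∏ i, (X - C (a i)) ^ 2 : ℂ[X]).natDegree = n + 1 := by
      rw [monic_X.natDegree_mul hm, natDegree_X,
        natDegree_prod_of_monic _ _ fun i _ => (monic_X_sub_C _).pow 2, hn]
      simp [natDegree_pow, mul_comm, add_comm]
    have hz : ofCoeffs n c = 0 := by
      refine eq_zero_of_dvd_of_natDegree_lt hmul ?_
      rw [hdeg]
      exact Nat.lt_succ_of_le (natDegree_ofCoeffs_le n c)
    funext j
    rw [← coeff_ofCoeffs n c j, hz, coeff_zero, Pi.zero_apply]
  obtain ⟨K, -, hK⟩ := J.exists_antilipschitzWith hJ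
  set c : α → Fin (n + 1) → ℂ := fun x j => (Q x - W).coeff j with hc
  have hcQ : ∀ x, ofCoeffs n (c x) = Q x - W := fun x =>
    ofCoeffs_coeff ((natDegree_sub_le _ _).trans (max_le (hQ x) hW))
  have hbound : ∀ M : ℂ[X] →ₗ[ℂ] ℂ, (fun x => M (Q x)) =O[l] fun x => 1 + ‖c x‖ := by
    intro M
    have e : (fun x => M (Q x)) = fun x => M W + (M.comp (ofCoeffs n)).toContinuousLinearMap (c x) := by
      funext x
      simp [hcQ]
    rw [e]
    refine Asymptotics.IsBigO.add ?_ ?_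
    · refine Asymptotics.IsBigO.of_bound ‖M W‖ (Eventually.of_forall fun x => ?_)
      rw [Real.norm_of_nonneg (by positivity)]
      nlinarith [norm_nonneg (M W), norm_nonneg (c x)]
    · refine ((ContinuousLinearMap.isBigO_comp _ c l).norm_right).trans ?_
      refine Asymptotics.IsBigO.of_bound 1 (Eventually.of_forall fun x => ?_)
      rw [norm_norm, Real.norm_of_nonneg (by positivity)]
      linarith
  -- hence `c` is small compared with `1 + ‖c‖`, which forces `c → 0`
  have hJc : (fun x => J (c x)) =o[l] fun x => 1 + ‖c x‖ := by
    have hsm : ∀ {δ : α → ℂ} {M : ℂ[X] →ₗ[ℂ] ℂ}, Tendsto δ l (𝓝 0) →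
        (fun x => δ x * M (Φ (Q x))) =o[l] fun x => 1 + ‖c x‖ := fun {δ M} hδ => by
      simpa using ((Asymptotics.isLittleO_one_iff ℝ).2 hδ).mul_isBigO (hbound (M.comp Φ))
    have hW1 : ∀ i, W.eval (a i) = 0 ∧ (derivative W).eval (a i) = 0 := fun i =>
      (sq_dvd_iff_eval _ _).1 (hWa i)
    refine Asymptotics.isLittleO_pi.2 ?_
    rintro (_ | i | i)
    · have : (fun x => J (c x) (Sum.inl ())) = fun _ => 0 := by
        funext x
        change (ofCoeffs n (c x)).eval 0 = 0
        rw [hcQ, eval_sub, h0, sub_self]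
      rw [this]
      exact Asymptotics.isLittleO_zero _ _
    · have : (fun x => J (c x) (Sum.inr (Sum.inl i)))
          = fun x => δ₁ i x * ev (a i) (Φ (Q x)) := by
        funext x
        change (ofCoeffs n (c x)).eval (a i) = δ₁ i x * (Φ (Q x)).eval (a i)
        rw [hcQ, eval_sub, (hW1 i).1, hv, sub_zero]
      rw [this]
      exact hsm (hδ₁ i)
    · have : (fun x => J (c x) (Sum.inr (Sum.inr i)))
          = fun x => δ₂ i x * ev (a i) (Φ (Q x)) + δ₃ i x * dv (a i) (Φ (Q x)) := by
        funext x
        change (derivative (ofCoeffs n (c x))).eval (a i) = δ₂ i x * (Φ (Q x)).eval (a i)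
          + δ₃ i x * (derivative (Φ (Q x))).eval (a i)
        rw [hcQ, derivative_sub, eval_sub, (hW1 i).2, hd, sub_zero]
      rw [this]
      exact (hsm (hδ₂ i)).add (hsm (hδ₃ i))
  have hcJ : ∀ x, ‖c x‖ ≤ K * ‖J (c x)‖ := fun x => by
    simpa [dist_eq_norm] using hK.le_mul_dist (c x) 0
  have hco : c =o[l] fun x => 1 + ‖c x‖ :=
    (Asymptotics.IsBigO.of_bound (K : ℝ) (Eventually.of_forall hcJ)).trans_isLittleO hJc
  have hc0 : Tendsto c l (𝓝 0) := by
    rw [Metric.tendsto_nhds]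
    intro ε hε
    have := hco.bound (c := min (1 / 2) (ε / 4)) (by positivity)
    filter_upwards [this] with x hx
    rw [dist_zero_right]
    rw [Real.norm_of_nonneg (by positivity)] at hx
    have h1 := min_le_left (1 / 2) (ε / 4)
    have h2 := min_le_right (1 / 2) (ε / 4)
    have h3 := norm_nonneg (c x)
    nlinarith
  have e : (fun x => L (Q x)) = fun x => L W + (L.comp (ofCoeffs n)).toContinuousLinearMap (c x) := by
    funext x
    simp [hcQ]
  rw [e]
  have := ((L.comp (ofCoeffs n)).toContinuousLinearMap.continuous.tendsto 0).comp hc0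
  simpa using this.const_add (L W)

theorem tendsto_affine_mul_exp_atTop {w : ℂ} (hw : w.re < 0) (v p r : ℂ) :
    Tendsto (fun x : ℝ => (p * x + r) * Complex.exp (x * w + v)) atTop (𝓝 0) := by
  have h1 : Tendsto (fun x : ℝ => Real.exp (w.re * x)) atTop (𝓝 0) :=
    Real.tendsto_exp_atBot.comp (tendsto_id.const_mul_atTop_of_neg hw)
  have h2 : Tendsto (fun x : ℝ => x * Real.exp (w.re * x)) atTop (𝓝 0) := by
    have := (Real.tendsto_pow_mul_exp_neg_atTop_nhds_zero 1).comp
      (tendsto_id.const_mul_atTop (neg_pos.2 hw))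
    have := this.const_mul (-w.re)⁻¹
    rw [mul_zero] at this
    refine this.congr fun x => ?_
    simp only [Function.comp, id, pow_one]
    have := hw.ne
    rw [neg_mul, neg_neg]
    field_simp
  have h3 : Tendsto (fun x : ℝ => Real.exp v.re * (‖p‖ * (x * Real.exp (w.re * x))
      + ‖r‖ * Real.exp (w.re * x))) atTop (𝓝 0) := by
    simpa using ((h2.const_mul ‖p‖).add (h1.const_mul ‖r‖)).const_mul (Real.exp v.re)
  refine squeeze_zero_norm' ?_ h3
  filter_upwards [eventually_ge_atTop 0] with x hx
  rw [norm_mul, Complex.norm_exp]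
  have e : ((x : ℂ) * w + v).re = v.re + w.re * x := by simp; ring
  rw [e, Real.exp_add]
  have h4 : ‖p * x + r‖ ≤ ‖p‖ * x + ‖r‖ := by
    refine (norm_add_le _ _).trans ?_
    rw [norm_mul, Complex.norm_real, Real.norm_of_nonneg hx]
  calc ‖p * x + r‖ * (Real.exp v.re * Real.exp (w.re * x))
      ≤ (‖p‖ * x + ‖r‖) * (Real.exp v.re * Real.exp (w.re * x)) := by gcongr
    _ = _ := by ring

theorem tendsto_affine_mul_exp_atBot {w : ℂ} (hw : 0 < w.re) (v p r : ℂ) :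
    Tendsto (fun x : ℝ => (p * x + r) * Complex.exp (x * w + v)) atBot (𝓝 0) := by
  have := (tendsto_affine_mul_exp_atTop (w := -w) (by simpa using hw) v (-p) r).comp
    tendsto_neg_atBot_atTop
  refine this.congr fun x => ?_
  simp

namespace Data

variable {N : ℕ} {D : Data N}

/-- `Im λ` has the sign that defines `D⁺` and `D⁻`. -/
theorem im_specLam (z : ℂ) : (specLam D.q₀ z).im = (‖z‖ ^ 2 - D.q₀ ^ 2) * z.im / (2 * ‖z‖ ^ 2) := by
  rcases eq_or_ne z 0 with rfl | hz
  · simp [specLam]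
  have h1 : ‖z‖ ^ 2 ≠ 0 := pow_ne_zero _ (norm_ne_zero_iff.2 hz)
  have h2 : ((D.q₀ : ℂ) ^ 2 / z).im = -(D.q₀ ^ 2 * z.im / ‖z‖ ^ 2) := by
    rw [← Complex.ofReal_pow, Complex.div_im, Complex.normSq_eq_norm_sq, Complex.ofReal_im,
      Complex.ofReal_re]
    ring
  have h3 : (specLam D.q₀ z).im = (z.im + ((D.q₀ : ℂ) ^ 2 / z).im) / 2 := by
    rw [specLam]; simp
  rw [h3, h2]
  field_simp
  ring

theorem exp_phase_eq (x t : ℝ) (z : ℂ) : Complex.exp (2 * Complex.I * -phase D.q₀ D.ε x t z)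
    = Complex.exp (x * (-(2 * Complex.I) * specLam D.q₀ z)
      + t * (-(2 * Complex.I) * phase D.q₀ D.ε 0 1 z)) := by
  rw [D.phase_eq, phase_one_zero]
  ring_nf

/-- `e^{-2iθ}`, multiplied by an affine function of `θ'`, tends to zero as `x → -∞` where
`Im λ > 0`. -/
theorem tendsto_exp_phase_atBot (t : ℝ) {z : ℂ} (hz : z ∈ Dplus D.q₀) (p r : ℂ) :
    Tendsto (fun x : ℝ => (p * deriv (phase D.q₀ D.ε x t) z + r)
      * Complex.exp (2 * Complex.I * -phase D.q₀ D.ε x t z)) atBot (𝓝 0) := by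
  have hz0 : z ≠ 0 := by rintro rfl; simp [Dplus] at hz
  have hn : 0 < ‖z‖ := norm_pos_iff.2 hz0
  have him : 0 < (specLam D.q₀ z).im := by
    rw [im_specLam]; exact div_pos hz (by positivity)
  refine (tendsto_affine_mul_exp_atBot (w := -(2 * Complex.I) * specLam D.q₀ z) (by simpa using him)
    (t * (-(2 * Complex.I) * phase D.q₀ D.ε 0 1 z)) (p * deriv (phase D.q₀ D.ε 1 0) z)
    (p * (t * deriv (phase D.q₀ D.ε 0 1) z) + r)).congr fun x => ?_
  rw [exp_phase_eq, D.deriv_phase_eq x t hz0]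
  ring

/-- `e^{-2iθ}`, multiplied by an affine function of `θ'`, tends to zero as `x → +∞` where
`Im λ < 0`. -/
theorem tendsto_exp_phase_atTop (t : ℝ) {z : ℂ} (hz : z ∈ Dminus D.q₀) (p r : ℂ) :
    Tendsto (fun x : ℝ => (p * deriv (phase D.q₀ D.ε x t) z + r)
      * Complex.exp (2 * Complex.I * -phase D.q₀ D.ε x t z)) atTop (𝓝 0) := by
  have hz0 : z ≠ 0 := by rintro rfl; simp [Dminus] at hz
  have hn : 0 < ‖z‖ := norm_pos_iff.2 hz0
  have him : (specLam D.q₀ z).im < 0 := by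
    rw [im_specLam]; exact div_neg_of_neg_of_pos hz (by positivity)
  refine (tendsto_affine_mul_exp_atTop (w := -(2 * Complex.I) * specLam D.q₀ z) (by simp; linarith)
    (t * (-(2 * Complex.I) * phase D.q₀ D.ε 0 1 z)) (p * deriv (phase D.q₀ D.ε 1 0) z)
    (p * (t * deriv (phase D.q₀ D.ε 0 1) z) + r)).congr fun x => ?_
  rw [exp_phase_eq, D.deriv_phase_eq x t hz0]
  ring

namespace Admissible

variable (h : D.Admissible)
include h

/-- As `x → -∞` the numerator of the second entry tends to the one of `-i q₋ / z`. -/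
theorem tendsto_numQ_atBot (t : ℝ) (L : ℂ[X] →ₗ[ℂ] ℂ) :
    Tendsto (fun x => L (D.numQ x t)) atBot (𝓝 (L (C (-(Complex.I * D.qm)) * D.polyHat))) := by
  refine tendsto_of_jets (n := 4 * N) (Φ := D.symC' • invertₗ D.rho (4 * N + 1))
    (δ₁ := fun n x => (0 * deriv (phase D.q₀ D.ε x t) (D.etaHat n) + D.bPlus n)
      * Complex.exp (2 * Complex.I * -phase D.q₀ D.ε x t (D.etaHat n)))
    (δ₂ := fun n x => (-(2 * Complex.I * D.bPlus n) * deriv (phase D.q₀ D.ε x t) (D.etaHat n)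
      + D.dPlus n) * Complex.exp (2 * Complex.I * -phase D.q₀ D.ε x t (D.etaHat n)))
    (δ₃ := fun n x => (0 * deriv (phase D.q₀ D.ε x t) (D.etaHat n) + D.bPlus n)
      * Complex.exp (2 * Complex.I * -phase D.q₀ D.ε x t (D.etaHat n)))
    h.etaHat_injective h.etaHat_ne (by simp; ring)
    ((natDegree_C_mul_le _ _).trans D.natDegree_polyHat.le) (fun x => natDegree_numQ x t) ?_ ?_
    (fun n => tendsto_exp_phase_atBot t (h.etaHat_mem n) _ _)
    (fun n => tendsto_exp_phase_atBot t (h.etaHat_mem n) _ _)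
    (fun n => tendsto_exp_phase_atBot t (h.etaHat_mem n) _ _) ?_ ?_ L
  · intro x
    rw [numQ, eval_zero_sndNum, eval_mul, eval_C, eval_polyHat_zero, mul_one]
  · intro n
    exact (Finset.dvd_prod_of_mem _ (Finset.mem_univ n)).mul_left _
  · intro n x
    refine ((jetRel_iff _ _ _ _ _).1 ((h.isRow_num x t).at_etaHat n)).1.trans ?_
    change _ = _ * (D.numP x t).eval _
    ring
  · intro n x
    refine ((jetRel_iff _ _ _ _ _).1 ((h.isRow_num x t).at_etaHat n)).2.trans ?_
    change _ = _ * (D.numP x t).eval _ + _ * (derivative (D.numP x t)).eval _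
    ring

/-- As `x → +∞` the numerator of the second entry tends to the one of `-i q₊ / z`, multiplied
by `s₁₁`. -/
theorem tendsto_numQ_atTop (t : ℝ) (L : ℂ[X] →ₗ[ℂ] ℂ) :
    Tendsto (fun x => L (D.numQ x t)) atTop (𝓝 (L (C (-(Complex.I * D.qp)) * D.polyEta))) := by
  refine tendsto_of_jets (n := 4 * N) (Φ := D.symC' • invertₗ D.rho (4 * N + 1))
    (δ₁ := fun n x => (0 * deriv (phase D.q₀ D.ε x t) (D.eta n) + (D.bMinus n)⁻¹)
      * Complex.exp (2 * Complex.I * -phase D.q₀ D.ε x t (D.eta n)))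
    (δ₂ := fun n x => (-(2 * Complex.I * (D.bMinus n)⁻¹) * deriv (phase D.q₀ D.ε x t) (D.eta n)
      + -(D.dMinus n / D.bMinus n ^ 2)) * Complex.exp (2 * Complex.I * -phase D.q₀ D.ε x t (D.eta n)))
    (δ₃ := fun n x => (0 * deriv (phase D.q₀ D.ε x t) (D.eta n) + (D.bMinus n)⁻¹)
      * Complex.exp (2 * Complex.I * -phase D.q₀ D.ε x t (D.eta n)))
    h.eta_injective h.eta_ne (by simp; ring)
    ((natDegree_C_mul_le _ _).trans D.natDegree_polyEta.le) (fun x => natDegree_numQ x t) ?_ ?_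
    (fun n => tendsto_exp_phase_atTop t (h.eta_mem n) _ _)
    (fun n => tendsto_exp_phase_atTop t (h.eta_mem n) _ _)
    (fun n => tendsto_exp_phase_atTop t (h.eta_mem n) _ _) ?_ ?_ L
  · intro x
    rw [numQ, eval_zero_sndNum, eval_mul, eval_C, eval_polyEta_zero]
    linear_combination Complex.I * h.qp_mul
  · intro n
    exact (Finset.dvd_prod_of_mem _ (Finset.mem_univ n)).mul_left _
  all_goals
    intro n x
    have hb := h.bMinus_ne n
    have hE := Complex.exp_ne_zero (2 * Complex.I * phase D.q₀ D.ε x t (D.eta n))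
    obtain ⟨h1, h2⟩ := (jetRel_iff _ _ _ _ _).1 ((h.isRow_num x t).at_eta n)
    rw [mul_neg, Complex.exp_neg]
  · change _ = _ * (D.numP x t).eval _
    rw [h1]
    field_simp
    ring
  · change _ = _ * (D.numP x t).eval _ + _ * (derivative (D.numP x t)).eval _
    rw [h2, h1]
    field_simp
    ring

/-- The first entry that corresponds to the limit of the second one as `x → -∞`. -/
theorem fstNum_polyHat : D.fstNum (C (-(Complex.I * D.qm)) * D.polyHat) = X * D.polyEta := by
  refine eq_of_eval_eq_of_ne_zero fun z hz => ?_
  rw [eval_fstNum ((natDegree_C_mul_le _ _).trans D.natDegree_polyHat.le) hz, eval_mul, eval_C,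
    eval_mul, eval_X, symC']
  have := h.eval_polyHat_inv hz
  have h1 := h.qm_ne
  have h2 := h.prodHat_ne
  field_simp
  linear_combination z * this - z * z ^ (4 * N) * eval (D.rho / z) D.polyHat * Complex.I_sq

/-- The first entry that corresponds to the limit of the second one as `x → +∞`. -/
theorem fstNum_polyEta : D.fstNum (C (-(Complex.I * D.qp)) * D.polyEta) = X * D.polyHat := by
  refine eq_of_eval_eq_of_ne_zero fun z hz => ?_
  rw [eval_fstNum ((natDegree_C_mul_le _ _).trans D.natDegree_polyEta.le) hz, eval_mul, eval_C,
    eval_mul, eval_X, symC', ← h.qp_mul]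
  have := h.eval_polyEta_inv hz
  have h1 := h.qp_ne
  have h2 := h.prodEta_ne
  field_simp
  linear_combination z * this - z * z ^ (4 * N) * eval (D.rho / z) D.polyEta * Complex.I_sq

/-- The limits of `q` are those of the leading coefficient of the second numerator. -/
theorem tendsto_q {l : Filter ℝ} {t : ℝ} {w : ℂ} {W : ℂ[X]} (hW : W.coeff (4 * N) = 1)
    (hl : ∀ L : ℂ[X] →ₗ[ℂ] ℂ, Tendsto (fun x => L (D.numQ x t)) l
      (𝓝 (L (C (-(Complex.I * w)) * W)))) :
    Tendsto (fun x => D.q x t) l (𝓝 w) := by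
  have := (hl (lcoeff ℂ (4 * N))).const_mul Complex.I
  simp only [lcoeff_apply, h.coeff_numQ, coeff_C_mul, hW] at this
  simpa [← mul_assoc] using this

theorem tendsto_q_atBot (t : ℝ) : Tendsto (fun x => D.q x t) atBot (𝓝 D.qm) := by
  refine h.tendsto_q ?_ (h.tendsto_numQ_atBot t)
  rw [← D.natDegree_polyHat]; exact D.monic_polyHat

theorem tendsto_q_atTop (t : ℝ) : Tendsto (fun x => D.q x t) atTop (𝓝 D.qp) := by
  refine h.tendsto_q ?_ (h.tendsto_numQ_atTop t)
  rw [← D.natDegree_polyEta]; exact D.monic_polyEta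

end Admissible

end Data
/-- A relation between jets of numerators, with the factor `e^{2iσ}`, is a relation with constant
coefficients between the functions `e^{-iσ} R / W` and `e^{iσ} S / W`. -/
theorem JetRel.hasDerivAt_exp_mul {a β δ σ' : ℂ} {σ : ℂ → ℂ} {R S W : ℂ[X]}
    (h : JetRel a (β * Complex.exp (2 * Complex.I * σ a))
      (Complex.exp (2 * Complex.I * σ a) * (δ + 2 * Complex.I * σ' * β)) R S)
    (hσ : HasDerivAt σ σ' a) (hW : W.eval a ≠ 0) {g' : ℂ}
    (hg : HasDerivAt (fun z => Complex.exp (Complex.I * σ z) * (S.eval z / W.eval z)) g' a) :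
    Complex.exp (-(Complex.I * σ a)) * (R.eval a / W.eval a)
      = β * (Complex.exp (Complex.I * σ a) * (S.eval a / W.eval a)) ∧
    HasDerivAt (fun z => Complex.exp (-(Complex.I * σ z)) * (R.eval z / W.eval z))
      (δ * (Complex.exp (Complex.I * σ a) * (S.eval a / W.eval a)) + β * g') a := by
  obtain ⟨h1, h2⟩ := (jetRel_iff _ _ _ _ _).1 h
  have hE : Complex.exp (2 * Complex.I * σ a)
      = Complex.exp (Complex.I * σ a) * Complex.exp (Complex.I * σ a) := by
    rw [← Complex.exp_add]; ring_nf
  have hne := Complex.exp_ne_zero (Complex.I * σ a)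
  rw [hE] at h1 h2
  have d1 := ((hσ.const_mul Complex.I).cexp).mul ((S.hasDerivAt a).div (W.hasDerivAt a) hW)
  have d2 := ((hσ.const_mul Complex.I).neg.cexp).mul ((R.hasDerivAt a).div (W.hasDerivAt a) hW)
  have e := hg.unique d1
  constructor
  · rw [h1, Complex.exp_neg]
    field_simp
  · refine d2.congr_deriv ?_
    rw [e]
    simp only [Pi.neg_apply, Complex.exp_neg, Pi.div_apply]
    rw [h2, h1]
    field_simp
    ring

theorem hasDoubleZero_div {A B W : ℂ[X]} {a : ℂ} (hA : A = (X - C a) ^ 2 * B) (hB : B.eval a ≠ 0)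
    (hW : W.eval a ≠ 0) : HasDoubleZero (fun z => A.eval z / W.eval z) a := by
  have hu : AnalyticAt ℂ (fun z => B.eval z / W.eval z) a :=
    (AnalyticOnNhd.eval_polynomial B a trivial).div (AnalyticOnNhd.eval_polynomial W a trivial) hW
  obtain ⟨h1, h2, h3, h4, -⟩ := iteratedDeriv_of_sq_mul (f := fun z => A.eval z / W.eval z) hu
    (Eventually.of_forall fun z => by simp [hA, mul_div_assoc])
  exact ⟨h1, h2, h3, by rw [h4]; exact mul_ne_zero two_ne_zero (div_ne_zero hB hW)⟩

theorem hasDoubleZero_prod_div {ι : Type*} [Fintype ι] [DecidableEq ι] {p : ι → ℂ}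
    (hp : Function.Injective p) {W : ℂ[X]} (n : ι) (hW : W.eval (p n) ≠ 0) :
    HasDoubleZero (fun z => (∏ k, (X - C (p k)) ^ 2 : ℂ[X]).eval z / W.eval z) (p n) := by
  refine hasDoubleZero_div (Finset.mul_prod_erase _ _ (Finset.mem_univ n)).symm ?_ hW
  rw [eval_prod, Finset.prod_ne_zero_iff]
  intro k hk
  simpa [sub_eq_zero] using hp.ne (Finset.ne_of_mem_erase hk).symm

theorem ne_zero_of_mem_Dplus {q₀ : ℝ} {z : ℂ} (hz : z ∈ Dplus q₀ ∪ contSpec q₀) : z ≠ 0 := by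
  rintro rfl
  rcases hz with hz | hz
  · simp [Dplus] at hz
  · exact hz.2.1 rfl

theorem ne_zero_of_mem_Dminus {q₀ : ℝ} {z : ℂ} (hz : z ∈ Dminus q₀ ∪ contSpec q₀) : z ≠ 0 := by
  rintro rfl
  rcases hz with hz | hz
  · simp [Dminus] at hz
  · exact hz.2.1 rfl

/-- The branch points `± i q₀` are excluded from all regions. -/
theorem sq_add_sq_ne_zero {q₀ : ℝ} (hq : 0 ≤ q₀) {z : ℂ}
    (hz : z ∈ Dplus q₀ ∪ contSpec q₀ ∨ z ∈ Dminus q₀ ∪ contSpec q₀) :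
    z ^ 2 + (q₀ : ℂ) ^ 2 ≠ 0 := by
  intro h0
  have h1 : (z - Complex.I * q₀) * (z + Complex.I * q₀) = 0 := by
    linear_combination h0 - (q₀ : ℂ) ^ 2 * Complex.I_sq
  have h2 : z = Complex.I * q₀ ∨ z = -(Complex.I * q₀) := by
    rcases mul_eq_zero.1 h1 with h | h
    · exact Or.inl (sub_eq_zero.1 h)
    · exact Or.inr (eq_neg_of_add_eq_zero_left h)
  have h3 : ‖z‖ = q₀ := by
    rcases h2 with rfl | rfl <;> simp [abs_of_nonneg hq]
  rcases hz with (hz | hz) | (hz | hz)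
  · simp [Dplus, h3] at hz
  · exact h2.elim hz.2.2.1 hz.2.2.2
  · simp [Dminus, h3] at hz
  · exact h2.elim hz.2.2.1 hz.2.2.2

namespace Data

variable {N : ℕ} (D : Data N)

/-! ### The Jost functions -/

/-- The numerators of the first column of the Jost matrix. -/
noncomputable def numOne (x t : ℝ) : Fin 2 → ℂ[X] := ![D.numP x t, -conjP (D.numQ x t)]

/-- The numerators of the second column of the Jost matrix. -/
noncomputable def numTwo (x t : ℝ) : Fin 2 → ℂ[X] := ![D.numQ x t, conjP (D.numP x t)]

/-- The first column of the Jost matrix, with denominator `W`. -/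
noncomputable def colOne (W : ℂ[X]) (z : ℂ) (x t : ℝ) : Fin 2 → ℂ := fun i =>
  Complex.exp (-(Complex.I * phase D.q₀ D.ε x t z)) * ((D.numOne x t i).eval z / W.eval z)

/-- The second column of the Jost matrix, with denominator `W`. -/
noncomputable def colTwo (W : ℂ[X]) (z : ℂ) (x t : ℝ) : Fin 2 → ℂ := fun i =>
  Complex.exp (Complex.I * phase D.q₀ D.ε x t z) * ((D.numTwo x t i).eval z / W.eval z)

variable {D}

theorem hasDerivAt_phase_x (x t : ℝ) (z : ℂ) :
    HasDerivAt (fun y : ℝ => phase D.q₀ D.ε y t z) (specLam D.q₀ z) x := by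
  have h1 : HasDerivAt (fun y : ℝ => (y : ℂ)) 1 x := by
    simpa using (hasDerivAt_id x).ofReal_comp
  have := (h1.add_const ((16 * specK D.q₀ z ^ 4 * D.ε - 8 * specK D.q₀ z ^ 2 * (D.q₀ : ℂ) ^ 2 * D.ε
    + 2 * specK D.q₀ z + 6 * (D.q₀ : ℂ) ^ 4 * D.ε + 1) * t)).const_mul (specLam D.q₀ z)
  simpa [phase] using this

theorem differentiableAt_colOne {W : ℂ[X]} {z : ℂ} (x t : ℝ) (hz : z ≠ 0) (hW : W.eval z ≠ 0) :
    DifferentiableAt ℂ (fun w => D.colOne W w x t) z := by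
  refine differentiableAt_pi.2 fun i => ?_
  exact (((D.differentiableAt_phase x t hz).const_mul _).neg.cexp).mul
    ((Polynomial.differentiableAt _).div (Polynomial.differentiableAt _) hW)

theorem differentiableAt_colTwo {W : ℂ[X]} {z : ℂ} (x t : ℝ) (hz : z ≠ 0) (hW : W.eval z ≠ 0) :
    DifferentiableAt ℂ (fun w => D.colTwo W w x t) z := by
  refine differentiableAt_pi.2 fun i => ?_
  exact (((D.differentiableAt_phase x t hz).const_mul _).cexp).mul
    ((Polynomial.differentiableAt _).div (Polynomial.differentiableAt _) hW)

namespace Admissible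

variable (h : D.Admissible)
include h

theorem isRow_numOne (x t : ℝ) (i : Fin 2) : D.IsRow x t (D.numOne x t i) (D.numTwo x t i) := by
  fin_cases i
  · exact h.isRow_num x t
  · exact h.isRow_conj (h.isRow_num x t)

/-- The `x`-derivatives of the values of the numerators at a point. -/
theorem hasDerivAt_eval_num (x t : ℝ) {z : ℂ} (hz : z ≠ 0) :
    HasDerivAt (fun y => (D.numP y t).eval z)
      (Complex.I * (D.q₀ : ℂ) ^ 2 / z * (D.numP x t).eval z
        - D.q x t * (conjP (D.numQ x t)).eval z) x ∧
    HasDerivAt (fun y => (D.numQ y t).eval z)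
      (-(Complex.I * z) * (D.numQ x t).eval z + D.q x t * (conjP (D.numP x t)).eval z) x := by
  obtain ⟨l1, l2⟩ := h.lax_x x t
  have l1 := congrArg (Polynomial.eval z) l1
  have l2 := congrArg (Polynomial.eval z) l2
  simp only [eval_add, eval_sub, eval_neg, eval_mul, eval_X, eval_C] at l1 l2
  constructor
  · refine ((hasPolyDerivAt_numP (xs := fun y => y) (ts := fun _ => t)
      (h.hasDerivAt_coefX x t)).eval z).congr_deriv ?_
    field_simp
    linear_combination l1
  · refine ((hasPolyDerivAt_numQ (xs := fun y => y) (ts := fun _ => t)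
      (h.hasDerivAt_coefX x t)).eval z).congr_deriv ?_
    linear_combination l2

theorem hasDerivAt_eval_conj_num (x t : ℝ) {z : ℂ} (hz : z ≠ 0) :
    HasDerivAt (fun y => (conjP (D.numP y t)).eval z)
      (-(Complex.I * (D.q₀ : ℂ) ^ 2 / z) * (conjP (D.numP x t)).eval z
        - conj (D.q x t) * (D.numQ x t).eval z) x ∧
    HasDerivAt (fun y => (conjP (D.numQ y t)).eval z)
      (Complex.I * z * (conjP (D.numQ x t)).eval z + conj (D.q x t) * (D.numP x t).eval z) x := by
  obtain ⟨h1, h2⟩ := h.hasDerivAt_eval_num x t (z := conj z) ((_root_.map_ne_zero _).2 hz)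
  simp only [eval_conjP, Complex.conj_conj] at h1 h2 ⊢
  constructor
  · refine h1.star.congr_deriv ?_
    simp only [← starRingEnd_apply, map_sub, map_mul, map_div₀, map_pow, Complex.conj_I,
      Complex.conj_ofReal, Complex.conj_conj]
    ring
  · refine h2.star.congr_deriv ?_
    simp only [← starRingEnd_apply, map_add, map_mul, map_neg, Complex.conj_I,
      Complex.conj_conj]
    ring

theorem hasDerivAt_colOne (W : ℂ[X]) {z : ℂ} (hz : z ≠ 0) (x t : ℝ) :
    HasDerivAt (fun y => D.colOne W z y t) (scatU D.q₀ z (D.q x t) *ᵥ D.colOne W z x t) x := by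
  have dE := ((D.hasDerivAt_phase_x x t z).const_mul Complex.I).neg.cexp
  have hl : specLam D.q₀ z = specK D.q₀ z + (D.q₀ : ℂ) ^ 2 / z := by
    simp only [specLam, specK]; ring
  have hl' : specLam D.q₀ z = z - specK D.q₀ z := by
    simp only [specLam, specK]; ring
  refine hasDerivAt_pi.2 fun i => ?_
  fin_cases i
  · refine (dE.mul ((h.hasDerivAt_eval_num x t hz).1.div_const (W.eval z))).congr_deriv ?_
    simp [scatU, colOne, numOne, mulVec, dotProduct, Fin.sum_univ_two, hl]
    ring
  · have e : ∀ y, (D.numOne y t 1).eval z = -(conjP (D.numQ y t)).eval z := fun y => by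
      simp [numOne]
    have d := dE.mul ((h.hasDerivAt_eval_conj_num x t hz).2.neg.div_const (W.eval z))
    refine (d.congr_of_eventuallyEq (Eventually.of_forall fun y => ?_)).congr_deriv ?_
    · simp [colOne, e]
    · simp [scatU, colOne, numOne, mulVec, dotProduct, Fin.sum_univ_two, hl']
      ring

theorem hasDerivAt_colTwo (W : ℂ[X]) {z : ℂ} (hz : z ≠ 0) (x t : ℝ) :
    HasDerivAt (fun y => D.colTwo W z y t) (scatU D.q₀ z (D.q x t) *ᵥ D.colTwo W z x t) x := by
  have dE := ((D.hasDerivAt_phase_x x t z).const_mul Complex.I).cexp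
  have hl : specLam D.q₀ z = specK D.q₀ z + (D.q₀ : ℂ) ^ 2 / z := by
    simp only [specLam, specK]; ring
  have hl' : specLam D.q₀ z = z - specK D.q₀ z := by
    simp only [specLam, specK]; ring
  refine hasDerivAt_pi.2 fun i => ?_
  fin_cases i
  · refine (dE.mul ((h.hasDerivAt_eval_num x t hz).2.div_const (W.eval z))).congr_deriv ?_
    simp [scatU, colTwo, numTwo, mulVec, dotProduct, Fin.sum_univ_two, hl']
    ring
  · refine (dE.mul ((h.hasDerivAt_eval_conj_num x t hz).1.div_const (W.eval z))).congr_deriv ?_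
    simp [scatU, colTwo, numTwo, mulVec, dotProduct, Fin.sum_univ_two, hl]
    ring

/-- The first column is a Jost function as soon as its numerators tend, as `x → ±∞`, to those of
the plane wave. -/
theorem isJost1_colOne {l : Filter ℝ} {w : ℂ} {V W : ℂ[X]}
    (hl : ∀ t, ∀ L : ℂ[X] →ₗ[ℂ] ℂ, Tendsto (fun x => L (D.numQ x t)) l
      (𝓝 (L (C (-(Complex.I * w)) * V))))
    (hV : D.fstNum (C (-(Complex.I * w)) * V) = X * W) (hc : conjP V = W) {z : ℂ} (hz : z ≠ 0)
    (hW : W.eval z ≠ 0) : IsJost1 D.q₀ D.ε D.q l w z (D.colOne (X * W) z) := by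
  refine ⟨h.hasDerivAt_colOne _ hz, fun t => ?_⟩
  have hXW : (X * W).eval z ≠ 0 := by simpa using ⟨hz, hW⟩
  have e : (fun x => Complex.exp (Complex.I * phase D.q₀ D.ε x t z) • D.colOne (X * W) z x t)
      = fun x i => (D.numOne x t i).eval z / (X * W).eval z := by
    funext x i
    simp only [Pi.smul_apply, smul_eq_mul, colOne, ← mul_assoc, ← Complex.exp_add, add_neg_cancel,
      Complex.exp_zero, one_mul]
  rw [e]
  refine tendsto_pi_nhds.2 fun i => ?_
  fin_cases i
  · have := (hl t ((leval z).comp (D.symC' • invertₗ D.rho (4 * N + 1)))).div_const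
      ((X * W).eval z)
    have e2 : ∀ S, ((leval z).comp (D.symC' • invertₗ D.rho (4 * N + 1))) S
        = (D.fstNum S).eval z := fun S => rfl
    simp only [e2, hV, div_self hXW] at this
    exact this
  · have := ((Complex.continuous_conj.tendsto _).comp (hl t (leval (conj z)))).neg.div_const
      ((X * W).eval z)
    convert this using 2
    · simp [numOne, eval_conjP]
    · have : conj (V.eval (conj z)) = W.eval z := by rw [← hc, eval_conjP]
      simp [Ecol1, this]
      field_simp

/-- The second column is a Jost function as soon as its numerators tend, as `x → ±∞`, to those of
the plane wave. -/
theorem isJost2_colTwo {l : Filter ℝ} {w : ℂ} {V W : ℂ[X]}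
    (hl : ∀ t, ∀ L : ℂ[X] →ₗ[ℂ] ℂ, Tendsto (fun x => L (D.numQ x t)) l
      (𝓝 (L (C (-(Complex.I * w)) * V))))
    (hV : D.fstNum (C (-(Complex.I * w)) * V) = X * W) (hc : conjP W = V) {z : ℂ} (hz : z ≠ 0)
    (hVz : V.eval z ≠ 0) : IsJost2 D.q₀ D.ε D.q l w z (D.colTwo (X * V) z) := by
  refine ⟨h.hasDerivAt_colTwo _ hz, fun t => ?_⟩
  have hXV : (X * V).eval z ≠ 0 := by simpa using ⟨hz, hVz⟩
  have e : (fun x => Complex.exp (-(Complex.I * phase D.q₀ D.ε x t z)) • D.colTwo (X * V) z x t)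
      = fun x i => (D.numTwo x t i).eval z / (X * V).eval z := by
    funext x i
    simp only [Pi.smul_apply, smul_eq_mul, colTwo, ← mul_assoc, ← Complex.exp_add, neg_add_cancel,
      Complex.exp_zero, one_mul]
  rw [e]
  refine tendsto_pi_nhds.2 fun i => ?_
  fin_cases i
  · have e3 : (C (-(Complex.I * w)) * V).eval z / (X * V).eval z = Ecol2 w z 0 := by
      simp [Ecol2]
      field_simp
    have l1 := hl t (leval z)
    simp only [leval_apply] at l1
    have l2 := l1.div_const ((X * V).eval z)
    rw [e3] at l2
    refine l2.congr fun x => ?_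
    simp only [numTwo, Fin.zero_eta, cons_val_zero]
  · have e2 : ∀ S, ((leval (conj z)).comp (D.symC' • invertₗ D.rho (4 * N + 1))) S
        = (D.fstNum S).eval (conj z) := fun S => rfl
    have l1 := hl t ((leval (conj z)).comp (D.symC' • invertₗ D.rho (4 * N + 1)))
    simp only [e2, hV] at l1
    have e3 : conj ((X * W).eval (conj z)) = (X * V).eval z := by
      rw [← eval_conjP, conjP_mul, hc]
      simp [eval_conjP]
    have l2 : Tendsto (fun x => conj ((D.fstNum (D.numQ x t)).eval (conj z))) l
        (𝓝 (conj ((X * W).eval (conj z)))) := (Complex.continuous_conj.tendsto _).comp l1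
    have l3 := l2.div_const ((X * V).eval z)
    rw [e3, div_self hXV] at l3
    refine l3.congr fun x => ?_
    simp only [numTwo, numP, eval_conjP, Fin.mk_one, cons_val_one, cons_val_fin_one]

/-- The Wronskian of the two columns is the constant `γ` times the quotient of the
denominators. -/
theorem wronskian_cols {V W : ℂ[X]} {z : ℂ} (x t : ℝ) (hz : z ≠ 0)
    (hb : z ^ 2 + (D.q₀ : ℂ) ^ 2 ≠ 0) :
    wronskianCoeff D.q₀ z (D.colOne (X * V) z x t) (D.colTwo (X * W) z x t)
      = D.polyEta.eval z * D.polyHat.eval z / (V.eval z * W.eval z) := by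
  have h1 := congrArg (Polynomial.eval z) (h.det_num x t)
  simp only [eval_add, eval_mul, eval_pow, eval_X, eval_C] at h1
  have hE : Complex.exp (-(Complex.I * phase D.q₀ D.ε x t z))
      * Complex.exp (Complex.I * phase D.q₀ D.ε x t z) = 1 := by
    rw [← Complex.exp_add, neg_add_cancel, Complex.exp_zero]
  have hg : 1 + (D.q₀ : ℂ) ^ 2 / z ^ 2 = (z ^ 2 + (D.q₀ : ℂ) ^ 2) / z ^ 2 := by field_simp
  rw [wronskianCoeff, hg, div_div_eq_mul_div, div_eq_iff hb]
  have e : D.colOne (X * V) z x t 0 * D.colTwo (X * W) z x t 1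
      - D.colOne (X * V) z x t 1 * D.colTwo (X * W) z x t 0
      = (Complex.exp (-(Complex.I * phase D.q₀ D.ε x t z))
        * Complex.exp (Complex.I * phase D.q₀ D.ε x t z))
        * (((D.numP x t).eval z * (conjP (D.numP x t)).eval z
          + (D.numQ x t).eval z * (conjP (D.numQ x t)).eval z) / (z * z * (V.eval z * W.eval z))) := by
    simp [colOne, colTwo, numOne, numTwo]
    ring
  rw [e, hE, h1]
  field_simp

/-- The proportionality of the Jost functions and of their derivatives at `η_n`. -/
theorem eta_relation (x t : ℝ) (n) :
    D.colOne (X * D.polyHat) (D.eta n) x t = D.bMinus n • D.colTwo (X * D.polyHat) (D.eta n) x t ∧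
    deriv (fun w => D.colOne (X * D.polyHat) w x t) (D.eta n)
      = D.dMinus n • D.colTwo (X * D.polyHat) (D.eta n) x t
        + D.bMinus n • deriv (fun w => D.colTwo (X * D.polyHat) w x t) (D.eta n) := by
  have hz := h.eta_ne n
  have hW : (X * D.polyHat).eval (D.eta n) ≠ 0 := by
    rw [eval_mul, eval_X]
    exact mul_ne_zero hz (D.eval_polyHat_ne fun k => h.eta_ne_etaHat n k)
  have hd := hasDerivAt_pi.1 (differentiableAt_colTwo (D := D) x t hz hW).hasDerivAt
  have key := fun i => ((h.isRow_numOne x t i).at_eta n).hasDerivAt_exp_mul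
    (D.differentiableAt_phase x t hz).hasDerivAt hW (hd i)
  exact ⟨funext fun i => (key i).1, (hasDerivAt_pi.2 fun i => (key i).2).deriv⟩

/-- The proportionality of the Jost functions and of their derivatives at `η̂_n`. -/
theorem etaHat_relation (x t : ℝ) (n) :
    D.colTwo (X * D.polyEta) (D.etaHat n) x t
      = D.bPlus n • D.colOne (X * D.polyEta) (D.etaHat n) x t ∧
    deriv (fun w => D.colTwo (X * D.polyEta) w x t) (D.etaHat n)
      = D.dPlus n • D.colOne (X * D.polyEta) (D.etaHat n) x t
        + D.bPlus n • deriv (fun w => D.colOne (X * D.polyEta) w x t) (D.etaHat n) := by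
  have hz := h.etaHat_ne n
  have hW : (X * D.polyEta).eval (D.etaHat n) ≠ 0 := by
    rw [eval_mul, eval_X]
    exact mul_ne_zero hz (D.eval_polyEta_ne fun k => (h.eta_ne_etaHat k n).symm)
  have hd := hasDerivAt_pi.1 (differentiableAt_colOne (D := D) x t hz hW).hasDerivAt
  have key := fun i => ((h.isRow_numOne x t i).at_etaHat n).hasDerivAt_exp_mul
    (σ := fun z => -phase D.q₀ D.ε x t z)
    (D.differentiableAt_phase x t hz).hasDerivAt.neg hW (g' := _)
    (by simp only [mul_neg]; exact hd i)
  simp only [mul_neg, neg_neg] at key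
  exact ⟨funext fun i => (key i).1, (hasDerivAt_pi.2 fun i => (key i).2).deriv⟩

/-- The denominators `z Π (z - η_n)²` and `z Π (z - η̂_n)²` normalise the same two columns at
`x → -∞` and at `x → +∞`. -/
theorem isJostSystem : IsJostSystem D.q₀ D.ε D.q D.qm D.qp (D.colOne (X * D.polyEta))
    (D.colTwo (X * D.polyHat)) (D.colOne (X * D.polyHat)) (D.colTwo (X * D.polyEta)) := by
  have hp := fun z hz => D.eval_polyEta_ne (h.ne_eta_of_mem (w := z) hz)
  have hm := fun z hz => D.eval_polyHat_ne (h.ne_etaHat_of_mem (w := z) hz)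
  have hp' : ∀ z ∈ Dplus D.q₀, (X * D.polyEta).eval z ≠ 0 := fun z hz => by
    rw [eval_mul, eval_X]
    exact mul_ne_zero (ne_zero_of_mem_Dplus (Or.inl hz)) (hp z (Or.inl hz))
  have hm' : ∀ z ∈ Dminus D.q₀, (X * D.polyHat).eval z ≠ 0 := fun z hz => by
    rw [eval_mul, eval_X]
    exact mul_ne_zero (ne_zero_of_mem_Dminus (Or.inl hz)) (hm z (Or.inl hz))
  refine ⟨fun z hz => ?_, fun z hz => ?_, fun z hz => ?_, fun z hz => ?_, ?_, ?_, ?_, ?_⟩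
  · exact h.isJost1_colOne h.tendsto_numQ_atBot h.fstNum_polyHat h.conjP_polyHat
      (ne_zero_of_mem_Dplus hz) (hp z hz)
  · exact h.isJost2_colTwo h.tendsto_numQ_atBot h.fstNum_polyHat h.conjP_polyEta
      (ne_zero_of_mem_Dminus hz) (hm z hz)
  · exact h.isJost1_colOne h.tendsto_numQ_atTop h.fstNum_polyEta h.conjP_polyEta
      (ne_zero_of_mem_Dminus hz) (hm z hz)
  · exact h.isJost2_colTwo h.tendsto_numQ_atTop h.fstNum_polyEta h.conjP_polyHat
      (ne_zero_of_mem_Dplus hz) (hp z hz)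
  · exact fun x t z hz => (differentiableAt_colOne x t (ne_zero_of_mem_Dplus (Or.inl hz))
      (hp' z hz)).differentiableWithinAt
  · exact fun x t z hz => (differentiableAt_colTwo x t (ne_zero_of_mem_Dminus (Or.inl hz))
      (hm' z hz)).differentiableWithinAt
  · exact fun x t z hz => (differentiableAt_colOne x t (ne_zero_of_mem_Dminus (Or.inl hz))
      (hm' z hz)).differentiableWithinAt
  · exact fun x t z hz => (differentiableAt_colTwo x t (ne_zero_of_mem_Dplus (Or.inl hz))
      (hp' z hz)).differentiableWithinAt

end Admissible

end Data
end IfoNLS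

theorem theorem1p2 {N : ℕ} (D : IfoNLS.Data N)
    (hqm : D.qm ≠ 0)
    (hz : ∀ n, ‖D.qm‖ < ‖D.z n‖ ∧ (D.z n).im < 0)
    (hinj : Function.Injective D.z)
    (hb : ∀ n, D.b n ≠ 0) :
    -- the formula makes sense everywhere and defines a smooth function
    (∀ x t : ℝ, (D.G x t).det ≠ 0) ∧
    ContDiff ℝ ∞ (fun p : ℝ × ℝ => D.q p.1 p.2) ∧
    -- the function is a solution, and so is its negative
    IfoNLS.SolvesIfoNLS D.ε (D.q₀ ^ 2) D.q ∧
    IfoNLS.SolvesIfoNLS D.ε 0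
      (fun x t => D.q x t * Complex.exp (2 * Complex.I * (D.q₀ : ℂ) ^ 2 * t)) ∧
    IfoNLS.SolvesIfoNLS D.ε (D.q₀ ^ 2)
      (fun x t => -D.qm + Complex.I * (D.borderedG x t).det / (D.G x t).det) ∧
    -- nonzero boundary conditions
    ‖D.qp‖ = D.q₀ ∧
    (∀ t : ℝ, Tendsto (fun x => D.q x t) atBot (𝓝 D.qm)) ∧
    (∀ t : ℝ, Tendsto (fun x => D.q x t) atTop (𝓝 D.qp)) ∧
    -- the scattering data of the potential
    ∃ φm1 φm2 φp1 φp2 : ℂ → ℝ → ℝ → Fin 2 → ℂ,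
      IfoNLS.IsJostSystem D.q₀ D.ε D.q D.qm D.qp φm1 φm2 φp1 φp2 ∧
      (∀ z ∈ IfoNLS.Dminus D.q₀ ∪ IfoNLS.contSpec D.q₀, ∀ x t : ℝ,
        IfoNLS.wronskianCoeff D.q₀ z (φp1 z x t) (φm2 z x t) = D.s11 z) ∧
      (∀ z ∈ IfoNLS.Dplus D.q₀ ∪ IfoNLS.contSpec D.q₀, ∀ x t : ℝ,
        IfoNLS.wronskianCoeff D.q₀ z (φm1 z x t) (φp2 z x t) = D.s22 z) ∧
      -- no reflection
      (∀ z ∈ IfoNLS.contSpec D.q₀, ∀ x t : ℝ,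
        IfoNLS.wronskianCoeff D.q₀ z (φp2 z x t) (φm2 z x t) = 0 ∧
        IfoNLS.wronskianCoeff D.q₀ z (φm1 z x t) (φp1 z x t) = 0) ∧
      -- the zeros of the scattering coefficients are double, and are exactly the given points
      (∀ n, D.eta n ∈ IfoNLS.Dminus D.q₀ ∧ IfoNLS.HasDoubleZero D.s11 (D.eta n)) ∧
      (∀ n, D.etaHat n ∈ IfoNLS.Dplus D.q₀ ∧ IfoNLS.HasDoubleZero D.s22 (D.etaHat n)) ∧
      (∀ z ∈ IfoNLS.Dminus D.q₀, D.s11 z = 0 → ∃ n, z = D.eta n) ∧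
      (∀ z ∈ IfoNLS.Dplus D.q₀, D.s22 z = 0 → ∃ n, z = D.etaHat n) ∧
      -- the constants `b` and `d`, which do not depend on `x` and `t`
      (∀ n, ∀ x t : ℝ,
        φp1 (D.eta n) x t = D.bMinus n • φm2 (D.eta n) x t ∧
        deriv (fun w => φp1 w x t) (D.eta n) =
          D.dMinus n • φm2 (D.eta n) x t
            + D.bMinus n • deriv (fun w => φm2 w x t) (D.eta n) ∧
        φp2 (D.etaHat n) x t = D.bPlus n • φm1 (D.etaHat n) x t ∧
        deriv (fun w => φp2 w x t) (D.etaHat n) =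
          D.dPlus n • φm1 (D.etaHat n) x t
            + D.bPlus n • deriv (fun w => φm1 w x t) (D.etaHat n)) := by
  have h : D.Admissible := ⟨hqm, fun n => (hz n).1, fun n => (hz n).2, hinj, hb⟩
  refine ⟨h.det_G_ne, h.contDiff_q, h.solves, ?_, ?_, h.norm_qp, h.tendsto_q_atBot,
    h.tendsto_q_atTop, _, _, _, _, h.isJostSystem, ?_, ?_, ?_, ?_, ?_, fun z => h.s11_eq_zero,
    fun z => h.s22_eq_zero, ?_⟩
  · have := h.solves.gauge fun x t => (h.hasDerivAt_q_t x t).differentiableAt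
    simpa only [Complex.ofReal_pow] using this
  · have := h.solves.neg
    have e : (fun x t : ℝ => -D.qm + Complex.I * (D.borderedG x t).det / (D.G x t).det)
        = fun x t => -D.q x t := by
      funext x t
      rw [IfoNLS.Data.q]
      ring
    rwa [e]
  · intro z hz x t
    have hne := D.eval_polyHat_ne (h.ne_etaHat_of_mem hz)
    rw [h.wronskian_cols x t (IfoNLS.ne_zero_of_mem_Dminus hz)
      (IfoNLS.sq_add_sq_ne_zero h.q₀_pos.le (Or.inr hz)), h.s11_eq]
    field_simp
  · intro z hz x t
    have hne := D.eval_polyEta_ne (h.ne_eta_of_mem hz)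
    rw [h.wronskian_cols x t (IfoNLS.ne_zero_of_mem_Dplus hz)
      (IfoNLS.sq_add_sq_ne_zero h.q₀_pos.le (Or.inl hz)), h.s22_eq]
    field_simp
  · intro z _ x t
    constructor
    · simp only [IfoNLS.wronskianCoeff, IfoNLS.Data.colTwo]
      ring
    · simp only [IfoNLS.wronskianCoeff, IfoNLS.Data.colOne]
      ring
  · refine fun n => ⟨h.eta_mem n, ?_⟩
    rw [funext h.s11_eq]
    exact IfoNLS.hasDoubleZero_prod_div h.eta_injective n
      (D.eval_polyHat_ne fun k => h.eta_ne_etaHat n k)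
  · refine fun n => ⟨h.etaHat_mem n, ?_⟩
    rw [funext h.s22_eq]
    exact IfoNLS.hasDoubleZero_prod_div h.etaHat_injective n
      (D.eval_polyEta_ne fun k => (h.eta_ne_etaHat k n).symm)
  · intro n x t
    obtain ⟨h1, h2⟩ := h.eta_relation x t n
    obtain ⟨h3, h4⟩ := h.etaHat_relation x t n
    exact ⟨h1, h2, h3, h4⟩
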